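/- **Setting.** Let $n\ge 1$, $\gamma>0$. A noisy circuit $\mathcal C$ of depth $d$ on $n$ qubits with gate-based noise is $$\mathcal C\{\rho\}=\mathcal D_0\{U_1\mathcal D_1\{\cdots U_d\,\mathcal D_d\{\rho\}\,U_d^\dagger\cdots\}U_1^\dagger\},$$ where each $U_t$ is a product of arbitrary two-qubit unitary gates on pairwise disjoint pairs of qubits, $\mathcal D_t$ ($t\ge1$) applies the depolarizing channel $\mathcal D_j\{A\}=e^{-\gamma}A+(1-e^{-\gamma})\,\mathrm{tr}_j(A)\otimes\frac{\mathbb 1_j}{2}$ to every qubit $j$ that participates in a gate of $U_t$, and the read-out noise $\mathcal D_0$ applies $\mathcal D_j$ to all qubits. Let $\mathcal C^\dagger\{O\}$ be the Heisenberg evolution of an observable $O$: $A\mapsto\mathcal D_0\{A\}$, followed by $A\mapsto \mathcal D_t\{U_t^\dagger AU_t\}$ for $t=1,\dots,d$. Let $\|A\|_F^2=2^{-n}\mathrm{tr}(A^\dagger A)$; $O$ is normalized if $\|O\|_F=1$. An ensemble of states $\rho_1,\dots,\rho_m$ ($m\geq 1$) is low-average with purity $c$ if the operator norm satisfies $\|\frac1m\sum_i\rho_i\|_\infty\le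 c/2^n$. For a Pauli string $P$ let $w[P]$ be its number of non-identity letters and $w_{U_t}[P]$ the number of those on qubits participating in gates of $U_t$. For a threshold $\ell\in\mathbb N$ define, for Pauli strings of weight at most $\ell$, $$c^{(0)}_P=e^{-\gamma w[P]}\,\frac{\mathrm{tr}(OP)}{2^n},\qquad c^{(t)}_Q=e^{-\gamma w_{U_t}[Q]}\sum_{P:\,w[P]\le\ell}\frac{\mathrm{tr}(Q\,U_t^\dagger PU_t)}{2^n}\,c^{(t-1)}_P,\qquad \tilde O=\sum_{P:\,w[P]\le\ell}c^{(d)}_P\,P .$$ The machine model is a random-access machine at unit cost per operation, with words (natural numbers under addition and truncated subtraction), complex numbers under exact addition, multiplication and conjugation, and zero-initialized arrays of both. It receives $n$, $d$, $\ell$, and can query at unit cost the number $e^{-\gamma}$, the description of each gate (the two qubits, the $16$ matrix entries, and the gate of a given layer acting on a given qubit), and the Pauli coefficients $\mathrm{tr}(OP)/2^n$ and $\mathrm{tr}(\rho P)$ of a Pauli string stored in an array. **Theorem (classical algorithm for quantum circuits with gate-based noise).** There are a single program and a universal constant $K$ such that for all $n\ge1$, $\gamma>0$, every circuit $\mathcal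 C$ of depth $d$ with gate-based noise, and every observable $O$: 1. for every $\ell\in\mathbb N$ and every state $\rho$, the program outputs $\mathrm{tr}(\rho\,\tilde O)$ in at most $K\max(d,1)\,n^{\ell}$ steps; 2. for every $\ell\in\mathbb N$, $\ \|\mathcal C^\dagger\{O\}-\tilde O\|_F\le\sqrt{d+1}\;e^{-\gamma(\ell+1)}\,\|O\|_F$; 3. if $O$ is normalized and $\varepsilon>0$, then, run with the threshold $\ell=\max\!\big(0,\big\lceil\frac1\gamma\log\frac{\sqrt{d+1}}{\varepsilon}-1\big\rceil\big)$, the program computes in at most $$K\max(d,1)\,n^{\ell}=\mathcal O\big(\max(d,1)\,n^{\max(0,\lceil\frac1\gamma\log(\sqrt{d+1}/\varepsilon)-1\rceil)}\big)$$ steps per state estimates $v_i$ of the expectation values, with root-mean-square error $$\Big(\frac1m\sum_{i=1}^m\big|\mathrm{tr}(\mathcal C\{\rho_i\}O)-v_i\big|^2\Big)^{1/2}\le\sqrt c\;\varepsilon$$ for every low-average ensemble $\rho_1,\dots,\rho_m$ with purity $c$. -/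

import Mathlib

open scoped Matrix

/-! ## Operators, Pauli strings and norms on `n` qubits -/

namespace GateNoise

/-- Operators on `n` qubits, in the computational basis `Fin n → Fin 2`. -/
abbrev Op (n : ℕ) := Matrix (Fin n → Fin 2) (Fin n → Fin 2) ℂ

/-- The single-qubit Pauli matrices `1, X, Y, Z`, labelled `0, 1, 2, 3`. -/
def pauli1 : Fin 4 → Matrix (Fin 2) (Fin 2) ℂ
  | 0 => 1
  | 1 => !![0, 1; 1, 0]
  | 2 => !![0, -Complex.I; Complex.I, 0]
  | 3 => !![1, 0; 0, -1]

/-- Pauli strings on `n` qubits. -/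
abbrev Pauli (n : ℕ) := Fin n → Fin 4

/-- The operator `P = P_1 ⊗ ⋯ ⊗ P_n` of a Pauli string. -/
def Pauli.op {n : ℕ} (P : Pauli n) : Op n :=
  fun x y => ∏ j, pauli1 (P j) (x j) (y j)

/-- The weight `w[P]`: the number of non-identity letters. -/
def Pauli.weight {n : ℕ} (P : Pauli n) : ℕ :=
  (Finset.univ.filter fun j => P j ≠ 0).card

/-- The normalized Frobenius norm, `‖A‖_F² = tr(A† A) / 2ⁿ`. -/
noncomputable def frobNorm {n : ℕ} (A : Op n) : ℝ :=
  Real.sqrt ((Aᴴ * A).trace.re / 2 ^ n)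

section
open scoped ComplexOrder

/-- Density matrices. -/
def IsState {n : ℕ} (ρ : Op n) : Prop := ρ.PosSemidef ∧ ρ.trace = 1

end

section
open scoped Matrix.Norms.L2Operator

/-- A finite ensemble of operators is low-average with purity `c` if the operator norm
(largest singular value) of its uniform mixture is at most `c / 2ⁿ`. -/
def IsLowAverage {n m : ℕ} (ρ : Fin m → Op n) (c : ℝ) : Prop :=
  ‖((m : ℂ)⁻¹ • ∑ i, ρ i : Op n)‖ ≤ c / 2 ^ n

end

/-! ## Noisy circuits with gate-based noise -/

/-- A two-qubit gate on the ordered pair `(fst, snd)` of distinct qubits. -/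
structure Gate (n : ℕ) where
  fst : Fin n
  snd : Fin n
  ne : fst ≠ snd
  mat : Matrix.unitaryGroup (Fin 2 × Fin 2) ℂ

/-- The gate as an operator on all `n` qubits (identity on the other qubits). -/
def Gate.op {n : ℕ} (g : Gate n) : Op n := fun x y =>
  if ∀ k, k ≠ g.fst → k ≠ g.snd → x k = y k then
    (g.mat : Matrix (Fin 2 × Fin 2) (Fin 2 × Fin 2) ℂ) (x g.fst, x g.snd) (y g.fst, y g.snd)
  else 0

/-- A circuit layer: two-qubit gates on pairwise disjoint pairs of qubits. -/
structure Layer (n : ℕ) where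
  gates : List (Gate n)
  disjoint : gates.Pairwise fun g h =>
    g.fst ≠ h.fst ∧ g.fst ≠ h.snd ∧ g.snd ≠ h.fst ∧ g.snd ≠ h.snd

/-- The depth-1 unitary of a layer. -/
def Layer.op {n : ℕ} (L : Layer n) : Op n := (L.gates.map Gate.op).prod

/-- The qubits that participate in a gate of the layer. -/
def Layer.qubits {n : ℕ} (L : Layer n) : List (Fin n) :=
  L.gates.flatMap fun g => [g.fst, g.snd]

/-- The number of qubits that are in the support of `P` and participate in a gate of the layer. -/
def Layer.weight {n : ℕ} (L : Layer n) (P : Pauli n) : ℕ :=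
  (Finset.univ.filter fun j => P j ≠ 0 ∧ j ∈ L.qubits).card

/-- Tracing out qubit `j` and replacing it by the maximally mixed state,
`A ↦ tr_j(A) ⊗ (1/2)_j`. -/
noncomputable def resetQubit {n : ℕ} (j : Fin n) (A : Op n) : Op n := fun x y =>
  if x j = y j then (1 / 2) * ∑ b, A (Function.update x j b) (Function.update y j b) else 0

/-- Depolarizing channel of strength `γ` on qubit `j`:
`A ↦ e^{-γ} A + (1 - e^{-γ}) tr_j(A) ⊗ (1/2)_j`. -/
noncomputable def depolarize {n : ℕ} (γ : ℝ) (j : Fin n) (A : Op n) : Op n :=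
  (Real.exp (-γ) : ℂ) • A + (1 - Real.exp (-γ) : ℂ) • resetQubit j A

/-- Depolarizing noise on all qubits in a list. -/
noncomputable def noiseOn {n : ℕ} (γ : ℝ) (js : List (Fin n)) (A : Op n) : Op n :=
  js.foldr (depolarize γ) A

/-- A circuit `U_1, …, U_d`, listed with the layer next to the read-out first
(the input state passes through the last layer in the list first). The depth is the length. -/
abbrev Circuit (n : ℕ) := List (Layer n)

/-- `ρ ↦ U_1 D_1{ ⋯ U_d D_d{ρ} U_d† ⋯ } U_1†`, with `D_t` acting on the qubits in gates
of `U_t`. -/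
noncomputable def Circuit.evolve {n : ℕ} (γ : ℝ) : Circuit n → Op n → Op n
  | [], ρ => ρ
  | L :: Ls, ρ => L.op * noiseOn γ L.qubits (Circuit.evolve γ Ls ρ) * L.opᴴ

/-- The noisy circuit `ρ ↦ D_0{ U_1 D_1{ ⋯ U_d D_d{ρ} U_d† ⋯ } U_1† }`, with read-out noise
`D_0` on all qubits. -/
noncomputable def Circuit.channel {n : ℕ} (γ : ℝ) (C : Circuit n) (ρ : Op n) : Op n :=
  noiseOn γ (List.finRange n) (C.evolve γ ρ)

/-- The Heisenberg evolution `C†{O}`: read-out noise, then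
`A ↦ D_t{ U_t† A U_t }` for `t = 1, …, d`. -/
noncomputable def Circuit.heisenberg {n : ℕ} (γ : ℝ) (C : Circuit n) (O : Op n) : Op n :=
  C.foldl (fun A L => noiseOn γ L.qubits (L.opᴴ * A * L.op)) (noiseOn γ (List.finRange n) O)

/-! ## Weight-truncated Heisenberg evolution -/

/-- The transition amplitude `a_{PQ} = tr(Q U† P U) / 2ⁿ` of a layer. -/
noncomputable def Layer.amplitude {n : ℕ} (L : Layer n) (P Q : Pauli n) : ℂ :=
  (Q.op * (L.opᴴ * P.op * L.op)).trace / 2 ^ n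

/-- Initial coefficients: `c_P = e^{-γ w[P]} tr(O P) / 2ⁿ` for `w[P] ≤ ℓ`. -/
noncomputable def initCoeff {n : ℕ} (γ : ℝ) (l : ℕ) (O : Op n) : Pauli n → ℂ := fun P =>
  if P.weight ≤ l then (Real.exp (-γ * P.weight) : ℂ) * ((O * P.op).trace / 2 ^ n) else 0

/-- One layer: `c_Q ← e^{-γ w_U[Q]} ∑_{P : w[P] ≤ ℓ} a_{PQ} c_P`, for `w[Q] ≤ ℓ`. -/
noncomputable def stepCoeff {n : ℕ} (γ : ℝ) (l : ℕ) (c : Pauli n → ℂ) (L : Layer n) :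
    Pauli n → ℂ := fun Q =>
  if Q.weight ≤ l then
    (Real.exp (-γ * L.weight Q) : ℂ) *
      ∑ P ∈ Finset.univ.filter (fun P : Pauli n => P.weight ≤ l), L.amplitude P Q * c P
  else 0

/-- The approximation of `C†{O}` that keeps only Pauli operators of weight at most `ℓ`,
truncating after the read-out noise and after each layer. -/
noncomputable def Circuit.truncated {n : ℕ} (γ : ℝ) (l : ℕ) (C : Circuit n) (O : Op n) : Op n :=
  ∑ P ∈ Finset.univ.filter (fun P : Pauli n => P.weight ≤ l),
    (C.foldl (stepCoeff γ l) (initCoeff γ l O)) P • P.op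

/-! ## Classical algorithms

A random-access machine with finitely many word registers, number registers, word arrays and
number arrays. Words are natural numbers with addition and truncated subtraction only; numbers
are complex numbers with exact `+`, `*` and conjugation. Control flow depends on words only.
Every operation, memory access and access to the input has unit cost. -/

/-- A problem instance: the data the machine can query. -/
structure Instance (n : ℕ) where
  γ : ℝ
  circuit : Circuit n
  obs : Op n
  state : Op n

/-- Machine memory. -/
structure Store where
  /-- word registers -/
  word : ℕ → ℕ
  /-- number registers -/
  num : ℕ → ℂ
  /-- word arrays -/
  wordArr : ℕ → ℕ → ℕ
  /-- number arrays -/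
  numArr : ℕ → ℕ → ℂ

/-- Word expressions. -/
inductive WExpr where
  | lit (k : ℕ)
  | reg (x : ℕ)
  | get (a : ℕ) (i : WExpr)
  | add (e f : WExpr)
  | sub (e f : WExpr)
  /-- One plus the index, in layer `t`, of the gate that acts on qubit `j`; zero if there is
  none. Here and below, layers, qubits and gates are numbered from zero. -/
  | gateAt (t j : WExpr)
  /-- First qubit of gate `g` in layer `t`. -/
  | gateFst (t g : WExpr)
  /-- Second qubit of gate `g` in layer `t`. -/
  | gateSnd (t g : WExpr)

/-- Number expressions. -/
inductive NExpr where
  | rat (q : ℚ)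
  | imag
  | reg (x : ℕ)
  | get (a : ℕ) (i : WExpr)
  | add (e f : NExpr)
  | mul (e f : NExpr)
  | conj (e : NExpr)
  /-- The damping factor `e^{-γ}`. -/
  | damping
  /-- The entry in row `r`, column `c` of the `4 × 4` matrix of gate `g` in layer `t`. -/
  | entry (t g r c : WExpr)
  /-- The Pauli coefficient `tr(O P) / 2ⁿ`, with `P` written letter by letter in word array `a`. -/
  | obsCoeff (a : ℕ)
  /-- The Pauli coefficient `tr(ρ P)`, with `P` written letter by letter in word array `a`. -/
  | stateCoeff (a : ℕ)

/-- Programs. A test succeeds if its value is nonzero. -/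
inductive Prog where
  | skip
  | setWord (x : ℕ) (e : WExpr)
  | setNum (x : ℕ) (e : NExpr)
  | putWord (a : ℕ) (i e : WExpr)
  | putNum (a : ℕ) (i : WExpr) (e : NExpr)
  | seq (p q : Prog)
  | ite (b : WExpr) (p q : Prog)
  | while (b : WExpr) (p : Prog)

/-- The cost of evaluating a word expression: one per node. -/
def WExpr.cost : WExpr → ℕ
  | lit _ => 1
  | reg _ => 1
  | get _ i => i.cost + 1
  | add e f => e.cost + f.cost + 1
  | sub e f => e.cost + f.cost + 1
  | gateAt t j => t.cost + j.cost + 1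
  | gateFst t g => t.cost + g.cost + 1
  | gateSnd t g => t.cost + g.cost + 1

/-- The cost of evaluating a number expression: one per node. -/
def NExpr.cost : NExpr → ℕ
  | rat _ => 1
  | imag => 1
  | reg _ => 1
  | get _ i => i.cost + 1
  | add e f => e.cost + f.cost + 1
  | mul e f => e.cost + f.cost + 1
  | conj e => e.cost + 1
  | damping => 1
  | entry t g r c => t.cost + g.cost + r.cost + c.cost + 1
  | obsCoeff _ => 1
  | stateCoeff _ => 1

/-- Gate `g` of layer `t`, if there is one. -/
def Circuit.gate? {n : ℕ} (C : Circuit n) (t g : ℕ) : Option (Gate n) :=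
  C[t]?.bind fun L => L.gates[g]?

/-- One plus the index of the gate of layer `t` that acts on qubit `j`, or zero. -/
def Circuit.gateAt {n : ℕ} (C : Circuit n) (t j : ℕ) : ℕ :=
  match C[t]? with
  | none => 0
  | some L =>
    match L.gates.findIdx? (fun g => decide (g.fst.val = j ∨ g.snd.val = j)) with
    | none => 0
    | some i => i + 1

/-- The entry `⟨a b| U |a' b'⟩` of a gate, with `r = 2 a + b` and `c = 2 a' + b'`;
zero out of range. -/
def Gate.entry {n : ℕ} (g : Gate n) (r c : ℕ) : ℂ :=
  if r < 4 ∧ c < 4 then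
    (g.mat : Matrix (Fin 2 × Fin 2) (Fin 2 × Fin 2) ℂ)
      (Fin.ofNat 2 (r / 2), Fin.ofNat 2 r) (Fin.ofNat 2 (c / 2), Fin.ofNat 2 c)
  else 0

/-- The Pauli string whose `j`-th letter is the word at address `j` of an array (mod 4). -/
def readPauli (n : ℕ) (a : ℕ → ℕ) : Pauli n := fun j => Fin.ofNat 4 (a j)

/-- The value of a word expression. -/
def WExpr.eval {n : ℕ} (I : Instance n) (s : Store) : WExpr → ℕ
  | lit k => k
  | reg x => s.word x
  | get a i => s.wordArr a (i.eval I s)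
  | add e f => e.eval I s + f.eval I s
  | sub e f => e.eval I s - f.eval I s
  | gateAt t j => I.circuit.gateAt (t.eval I s) (j.eval I s)
  | gateFst t g => ((I.circuit.gate? (t.eval I s) (g.eval I s)).map fun h => h.fst.val).getD 0
  | gateSnd t g => ((I.circuit.gate? (t.eval I s) (g.eval I s)).map fun h => h.snd.val).getD 0

/-- The value of a number expression. -/
noncomputable def NExpr.eval {n : ℕ} (I : Instance n) (s : Store) : NExpr → ℂ
  | rat q => (q : ℂ)
  | imag => Complex.I
  | reg x => s.num x
  | get a i => s.numArr a (i.eval I s)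
  | add e f => e.eval I s + f.eval I s
  | mul e f => e.eval I s * f.eval I s
  | conj e => star (e.eval I s)
  | damping => (Real.exp (-I.γ) : ℂ)
  | entry t g r c =>
    ((I.circuit.gate? (t.eval I s) (g.eval I s)).map
      fun h => h.entry (r.eval I s) (c.eval I s)).getD 0
  | obsCoeff a => (I.obs * (readPauli n (s.wordArr a)).op).trace / 2 ^ n
  | stateCoeff a => (I.state * (readPauli n (s.wordArr a)).op).trace

/-- Write `v` at address `i` of array `a`. -/
def putAt {α : Type} (m : ℕ → ℕ → α) (a i : ℕ) (v : α) : ℕ → ℕ → α :=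
  Function.update m a (Function.update (m a) i v)

/-- `Exec I p s s' t`: on instance `I`, program `p` started in memory `s` halts in memory `s'`
after exactly `t` steps. -/
inductive Exec {n : ℕ} (I : Instance n) : Prog → Store → Store → ℕ → Prop where
  | skip (s : Store) : Exec I Prog.skip s s 1
  | setWord (x : ℕ) (e : WExpr) (s : Store) :
      Exec I (Prog.setWord x e) s
        { s with word := Function.update s.word x (e.eval I s) } (e.cost + 1)
  | setNum (x : ℕ) (e : NExpr) (s : Store) :
      Exec I (Prog.setNum x e) s
        { s with num := Function.update s.num x (e.eval I s) } (e.cost + 1)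
  | putWord (a : ℕ) (i e : WExpr) (s : Store) :
      Exec I (Prog.putWord a i e) s
        { s with wordArr := putAt s.wordArr a (i.eval I s) (e.eval I s) } (i.cost + e.cost + 1)
  | putNum (a : ℕ) (i : WExpr) (e : NExpr) (s : Store) :
      Exec I (Prog.putNum a i e) s
        { s with numArr := putAt s.numArr a (i.eval I s) (e.eval I s) } (i.cost + e.cost + 1)
  | seq {p q : Prog} {s₁ s₂ s₃ : Store} {t₁ t₂ : ℕ} :
      Exec I p s₁ s₂ t₁ → Exec I q s₂ s₃ t₂ → Exec I (Prog.seq p q) s₁ s₃ (t₁ + t₂)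
  | iteTrue {b : WExpr} {p q : Prog} {s s' : Store} {t : ℕ} :
      b.eval I s ≠ 0 → Exec I p s s' t → Exec I (Prog.ite b p q) s s' (b.cost + 1 + t)
  | iteFalse {b : WExpr} {p q : Prog} {s s' : Store} {t : ℕ} :
      b.eval I s = 0 → Exec I q s s' t → Exec I (Prog.ite b p q) s s' (b.cost + 1 + t)
  | whileDone {b : WExpr} {p : Prog} {s : Store} :
      b.eval I s = 0 → Exec I (Prog.while b p) s s (b.cost + 1)
  | whileStep {b : WExpr} {p : Prog} {s₁ s₂ s₃ : Store} {t₁ t₂ : ℕ} :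
      b.eval I s₁ ≠ 0 → Exec I p s₁ s₂ t₁ → Exec I (Prog.while b p) s₂ s₃ t₂ →
      Exec I (Prog.while b p) s₁ s₃ (b.cost + 1 + t₁ + t₂)

/-- The initial memory: `n`, the depth `d` and the threshold `ℓ` in word registers `0, 1, 2`,
and zero everywhere else. -/
def startStore (n d l : ℕ) : Store where
  word := fun x => if x = 0 then n else if x = 1 then d else if x = 2 then l else 0
  num := fun _ => 0
  wordArr := fun _ _ => 0
  numArr := fun _ _ => 0

/-- On instance `I` and threshold `ℓ`, program `p` outputs `v` (in number register `0`) after at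
most `T` steps. -/
def Prog.Outputs {n : ℕ} (p : Prog) (I : Instance n) (l : ℕ) (v : ℂ) (T : ℕ) : Prop :=
  ∃ (s : Store) (t : ℕ),
    Exec I p (startStore n I.circuit.length l) s t ∧ s.num 0 = v ∧ t ≤ T

/-- The truncation threshold `⌈(1/γ) log(√(d+1)/ε) - 1⌉` (or `0` if this is negative). -/
noncomputable def threshold (γ ε : ℝ) (d : ℕ) : ℕ :=
  ⌈1 / γ * Real.log (Real.sqrt (d + 1) / ε) - 1⌉₊

end GateNoise

open GateNoise

/-! All arguments take place in the Pauli basis, which is orthonormal for the normalized Frobenius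
inner product (`sum_coef_smul_op`, `trace_mul_eq_sum_coef`). In this basis depolarizing noise is
diagonal, and conjugation by a layer is an isometry of coefficient vectors.

Truncation error. The noise of a layer damps only letters on its gates, but letters on idle qubits
do not change. Hence, whenever the amplitude from `P` to `Q` is nonzero, e^{-γ w_U[Q]} e^{-γ w[P]} =
e^{-γ w[Q]} e^{-γ w_U[P]} (`Layer.evolveCoef_fullDamp`). The full damping e^{-γ w}, supplied by the
read-out noise, is thus handed on through every layer, and each of the d + 1 truncations discards
coefficients damped by at least e^{-γ(ℓ+1)}. The undamped discarded parts have squared norms that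
sum to at most ‖O‖_F² by Pythagoras, the remaining evolution is a contraction, and Cauchy–Schwarz
gives the factor √(d+1) instead of d + 1 (`coefNorm_truncation_step`, `coefNorm_truncation_le`).

Ensembles. For a state, |tr(ρA)|² ≤ tr(A†ρA). The right side is linear in ρ, so it can be averaged
over the ensemble and bounded by the operator norm of the mixture times tr(A†A). Here A is the
difference between the exact and the truncated Heisenberg operators.

Running time. The amplitude of a layer is a product of local factors (`Layer.prod_siteFactor`), so
pairs (P, Q) can be enumerated by depth-first search: one qubit at a time, all letters of a gate
being chosen at its first qubit. By unitarity, a gate never maps the identity on its pair to another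
string, or conversely. Every choice other than identity letters therefore raises both weights, and
as soon as one weight reaches ℓ all remaining letters are forced to be identities
(`Node.eq_of_contrib_ne_zero`). The search tree has at most K n^ℓ nodes with K independent of ℓ
(`Node.size_le`, `exists_treeBound_le`).

The program runs this search with an explicit stack, one loop iteration per node. The read-out noise
and the final trace are searches too, over an empty layer, which makes d + 2 searches in all. The
threshold 0 is treated separately, since then even n steps are too many. -/

namespace GateNoise

/-! ### Pauli strings as an orthonormal basis -/

/-- The tensor product of single-qubit operators. -/
def tensor {n : ℕ} (M : Fin n → Matrix (Fin 2) (Fin 2) ℂ) : Op n :=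
  fun x y => ∏ j, M j (x j) (y j)

lemma Pauli.op_eq_tensor {n : ℕ} (P : Pauli n) : P.op = tensor fun j => pauli1 (P j) := rfl

lemma tensor_mul {n : ℕ} (M N : Fin n → Matrix (Fin 2) (Fin 2) ℂ) :
    tensor M * tensor N = tensor fun j => M j * N j := by
  ext x y
  simp only [Matrix.mul_apply, tensor, ← Finset.prod_mul_distrib]
  rw [Finset.prod_univ_sum, Fintype.piFinset_univ]

lemma trace_tensor {n : ℕ} (M : Fin n → Matrix (Fin 2) (Fin 2) ℂ) :
    (tensor M).trace = ∏ j, (M j).trace := by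
  simp only [Matrix.trace, Matrix.diag, tensor]
  rw [Finset.prod_univ_sum, Fintype.piFinset_univ]

lemma tensor_conjTranspose {n : ℕ} (M : Fin n → Matrix (Fin 2) (Fin 2) ℂ) :
    (tensor M)ᴴ = tensor fun j => (M j)ᴴ := by
  ext x y
  simp [tensor, Matrix.conjTranspose_apply]

lemma pauli1_conjTranspose (a : Fin 4) : (pauli1 a)ᴴ = pauli1 a := by
  fin_cases a <;> ext i j <;> fin_cases i <;> fin_cases j <;>
    simp [pauli1, Matrix.conjTranspose_apply]

lemma trace_pauli1_mul (a b : Fin 4) :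
    (pauli1 a * pauli1 b).trace = if a = b then 2 else 0 := by
  fin_cases a <;> fin_cases b <;>
    simp [pauli1, Matrix.trace_fin_two] <;> norm_num

lemma trace_pauli1 (a : Fin 4) : (pauli1 a).trace = if a = 0 then 2 else 0 := by
  simpa [pauli1] using trace_pauli1_mul a 0

/-- Completeness of the Pauli matrices: the sum of σ_a ⊗ σ_a is twice the swap operator. Its tensor
power `sum_op_mul_op` is what makes every operator a combination of Pauli strings. -/
lemma sum_pauli1_mul (i j k l : Fin 2) :
    ∑ a, pauli1 a i j * pauli1 a k l = if i = l ∧ j = k then 2 else 0 := by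
  fin_cases i <;> fin_cases j <;> fin_cases k <;> fin_cases l <;>
    simp [pauli1, Fin.sum_univ_four] <;> norm_num

lemma Pauli.op_conjTranspose {n : ℕ} (P : Pauli n) : P.opᴴ = P.op := by
  simp [Pauli.op_eq_tensor, tensor_conjTranspose, pauli1_conjTranspose]

lemma trace_op_mul_op {n : ℕ} (P Q : Pauli n) :
    (P.op * Q.op).trace = if P = Q then 2 ^ n else 0 := by
  simp only [Pauli.op_eq_tensor, tensor_mul, trace_tensor, trace_pauli1_mul]
  split_ifs with h
  · subst h; simp
  · obtain ⟨j, hj⟩ := Function.ne_iff.1 h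
    exact Finset.prod_eq_zero (Finset.mem_univ j) (if_neg hj)

lemma Pauli.op_zero {n : ℕ} : Pauli.op (0 : Pauli n) = 1 := by
  ext x y
  by_cases h : x = y
  · subst h; simp [Pauli.op, pauli1]
  · obtain ⟨j, hj⟩ := Function.ne_iff.1 h
    rw [Matrix.one_apply_ne h]
    exact Finset.prod_eq_zero (Finset.mem_univ j) (by simp [pauli1, Matrix.one_apply_ne hj])

lemma sum_op_mul_op {n : ℕ} (x y z w : Fin n → Fin 2) :
    ∑ P : Pauli n, P.op x y * P.op z w = if x = w ∧ y = z then 2 ^ n else 0 := by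
  have h : ∀ P : Pauli n, P.op x y * P.op z w =
      ∏ j, pauli1 (P j) (x j) (y j) * pauli1 (P j) (z j) (w j) := fun P => by
    simp [Pauli.op, Finset.prod_mul_distrib]
  simp only [h]
  have := Finset.prod_univ_sum (fun _ : Fin n => (Finset.univ : Finset (Fin 4)))
    (fun j a => pauli1 a (x j) (y j) * pauli1 a (z j) (w j))
  rw [Fintype.piFinset_univ] at this
  rw [← this]
  simp only [sum_pauli1_mul]
  split_ifs with hh
  · obtain ⟨rfl, rfl⟩ := hh; simp
  · have : ∃ j, ¬(x j = w j ∧ y j = z j) := by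
      by_contra hc
      push Not at hc
      exact hh ⟨funext fun j => (hc j).1, funext fun j => (hc j).2⟩
    obtain ⟨j, hj⟩ := this
    exact Finset.prod_eq_zero (Finset.mem_univ j) (if_neg hj)

/-- The Pauli coefficients of an operator. -/
noncomputable def coef {n : ℕ} (A : Op n) (P : Pauli n) : ℂ := (A * P.op).trace / 2 ^ n

/-- Once the traces are written out, the sum over `P` is a swap of index pairs and returns the entry
of `A`; no dimension count is needed. -/
lemma sum_coef_smul_op {n : ℕ} (A : Op n) : ∑ P, coef A P • P.op = A := by
  ext x y
  have h : ∀ P : Pauli n, (coef A P • P.op) x y =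
      ∑ z, ∑ w, A z w / 2 ^ n * (P.op w z * P.op x y) := fun P => by
    simp only [coef, Matrix.trace, Matrix.diag, Matrix.mul_apply, Matrix.smul_apply, smul_eq_mul,
      Finset.sum_div, Finset.sum_mul]
    refine Finset.sum_congr rfl fun z _ => Finset.sum_congr rfl fun w _ => by ring
  rw [Matrix.sum_apply]
  simp only [h]
  rw [Finset.sum_comm]
  have h2 : ∀ z : Fin n → Fin 2, ∑ P : Pauli n, ∑ w, A z w / 2 ^ n * (P.op w z * P.op x y) =
      ∑ w, A z w / 2 ^ n * (if w = y ∧ z = x then 2 ^ n else 0) := fun z => by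
    rw [Finset.sum_comm]
    refine Finset.sum_congr rfl fun w _ => ?_
    rw [← Finset.mul_sum, sum_op_mul_op]
  simp only [h2]
  rw [Finset.sum_eq_single x, Finset.sum_eq_single y]
  · simp
  · intro b _ hb; simp [hb]
  · simp
  · intro b _ hb; simp [hb]
  · simp

lemma coef_add {n : ℕ} (A B : Op n) (P : Pauli n) : coef (A + B) P = coef A P + coef B P := by
  simp [coef, add_mul, add_div]

lemma coef_sub {n : ℕ} (A B : Op n) (P : Pauli n) : coef (A - B) P = coef A P - coef B P := by
  simp [coef, sub_mul, sub_div]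

lemma coef_smul {n : ℕ} (a : ℂ) (A : Op n) (P : Pauli n) : coef (a • A) P = a * coef A P := by
  simp [coef, mul_div_assoc]

lemma coef_sum {n : ℕ} {ι : Type*} (s : Finset ι) (A : ι → Op n) (P : Pauli n) :
    coef (∑ i ∈ s, A i) P = ∑ i ∈ s, coef (A i) P := by
  simp [coef, Finset.sum_mul, Matrix.trace_sum, Finset.sum_div]

lemma coef_op {n : ℕ} (P Q : Pauli n) : coef P.op Q = if P = Q then 1 else 0 := by
  simp only [coef, trace_op_mul_op]
  split_ifs <;> simp

lemma coef_sum_smul_op {n : ℕ} (s : Finset (Pauli n)) (c : Pauli n → ℂ) (Q : Pauli n) :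
    coef (∑ P ∈ s, c P • P.op) Q = if Q ∈ s then c Q else 0 := by
  simp [coef_sum, coef_smul, coef_op]

/-- Parseval without conjugation. Applied to Aᴴ and A it yields the Frobenius norm, and in this
bilinear form it also shows that diagonal noise can be moved across a trace. -/
lemma trace_mul_eq_sum_coef {n : ℕ} (A B : Op n) :
    (A * B).trace = 2 ^ n * ∑ P, coef A P * coef B P := by
  conv_lhs => rw [← sum_coef_smul_op B]
  simp only [Matrix.mul_smul, Matrix.trace_sum, Matrix.trace_smul, Finset.mul_sum,
    coef, smul_eq_mul]
  refine Finset.sum_congr rfl fun P _ => ?_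
  field_simp

lemma coef_conjTranspose {n : ℕ} (A : Op n) (P : Pauli n) : coef Aᴴ P = star (coef A P) := by
  have : (Aᴴ * P.op).trace = star ((A * P.op).trace) := by
    rw [← Matrix.trace_conjTranspose, Matrix.conjTranspose_mul, P.op_conjTranspose,
      Matrix.trace_mul_comm]
  simp [coef, this]

lemma trace_conjTranspose_mul_self {n : ℕ} (A : Op n) :
    ((Aᴴ * A).trace.re / 2 ^ n : ℝ) = ∑ P, ‖coef A P‖ ^ 2 := by
  have : (Aᴴ * A).trace = ((2 ^ n * ∑ P, ‖coef A P‖ ^ 2 : ℝ) : ℂ) := by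
    rw [trace_mul_eq_sum_coef]
    push_cast
    congr 1
    refine Finset.sum_congr rfl fun P _ => ?_
    rw [coef_conjTranspose, ← Complex.conj_mul']
    rfl
  rw [this, Complex.ofReal_re]
  field_simp

lemma frobNorm_eq {n : ℕ} (A : Op n) : frobNorm A = Real.sqrt (∑ P, ‖coef A P‖ ^ 2) := by
  rw [frobNorm, trace_conjTranspose_mul_self]

/-! ### Transition amplitudes of a single gate -/

open scoped Kronecker

/-- Gates act on pairwise disjoint pairs of qubits. -/
abbrev DisjointGates {n : ℕ} (gs : List (Gate n)) : Prop :=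
  gs.Pairwise fun g h => g.fst ≠ h.fst ∧ g.fst ≠ h.snd ∧ g.snd ≠ h.fst ∧ g.snd ≠ h.snd

/-- The two-qubit Pauli transition amplitude `tr(G† (p₁ ⊗ p₂) G (q₁ ⊗ q₂)) / 4` of a gate. -/
noncomputable def Gate.factor {n : ℕ} (g : Gate n) (p₁ p₂ q₁ q₂ : Fin 4) : ℂ :=
  ((g.mat : Matrix (Fin 2 × Fin 2) (Fin 2 × Fin 2) ℂ)ᴴ * (pauli1 p₁ ⊗ₖ pauli1 p₂) *
    (g.mat : Matrix (Fin 2 × Fin 2) (Fin 2 × Fin 2) ℂ) * (pauli1 q₁ ⊗ₖ pauli1 q₂)).trace / 4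

lemma trace_pauli1_kronecker (p₁ p₂ : Fin 4) :
    (pauli1 p₁ ⊗ₖ pauli1 p₂).trace = if p₁ = 0 ∧ p₂ = 0 then 4 else 0 := by
  rw [Matrix.trace_kronecker, trace_pauli1, trace_pauli1]
  by_cases h₁ : p₁ = 0 <;> by_cases h₂ : p₂ = 0 <;> simp [h₁, h₂]; norm_num

lemma pauli1_zero_kronecker : (pauli1 0 ⊗ₖ pauli1 0) = 1 := by
  simp [pauli1]

/-- G†G = 1, and the identity is orthogonal to every other string. Together with
`Gate.factor_zero_right` this is what makes the search tree small. -/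
lemma Gate.factor_zero_left {n : ℕ} (g : Gate n) (q₁ q₂ : Fin 4) :
    g.factor 0 0 q₁ q₂ = if q₁ = 0 ∧ q₂ = 0 then 1 else 0 := by
  have h := (Matrix.mem_unitaryGroup_iff'.1 g.mat.2)
  rw [Matrix.star_eq_conjTranspose] at h
  rw [Gate.factor, pauli1_zero_kronecker, mul_one, h, one_mul, trace_pauli1_kronecker]
  split_ifs <;> simp

/-- Conjugation preserves the trace, by cyclicity and GG† = 1, and only the identity string has
nonzero trace. -/
lemma Gate.factor_zero_right {n : ℕ} (g : Gate n) (p₁ p₂ : Fin 4) :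
    g.factor p₁ p₂ 0 0 = if p₁ = 0 ∧ p₂ = 0 then 1 else 0 := by
  have h := (Matrix.mem_unitaryGroup_iff.1 g.mat.2)
  rw [Matrix.star_eq_conjTranspose] at h
  rw [Gate.factor, pauli1_zero_kronecker, mul_one, Matrix.trace_mul_comm, ← mul_assoc, h, one_mul,
    trace_pauli1_kronecker]
  split_ifs <;> simp

/-- Splitting off two factors of a product. -/
lemma prod_eq_mul_mul_prod_compl {n : ℕ} {a b : Fin n} (h : a ≠ b) (f : Fin n → ℂ) :
    ∏ j, f j = f a * f b * ∏ j ∈ ({a, b} : Finset (Fin n))ᶜ, f j := by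
  rw [← Finset.prod_mul_prod_compl {a, b}, Finset.prod_pair h]

/-- The matrix unit `|r⟩⟨c|` on a pair of qubits as a family of single-qubit operators. -/
def pairUnit {n : ℕ} (a b : Fin n) (r c : Fin 2 × Fin 2) (j : Fin n) : Matrix (Fin 2) (Fin 2) ℂ :=
  if j = a then Matrix.single r.1 c.1 1 else if j = b then Matrix.single r.2 c.2 1 else 1

lemma tensor_pairUnit_apply {n : ℕ} {a b : Fin n} (h : a ≠ b) (r c : Fin 2 × Fin 2)
    (x y : Fin n → Fin 2) :
    tensor (pairUnit a b r c) x y =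
      if r = (x a, x b) then if c = (y a, y b) then
        if ∀ k, k ≠ a → k ≠ b → x k = y k then 1 else 0 else 0 else 0 := by
  have h1 : tensor (pairUnit a b r c) x y = Matrix.single r.1 c.1 (1 : ℂ) (x a) (y a) *
      Matrix.single r.2 c.2 (1 : ℂ) (x b) (y b) *
      ∏ j ∈ ({a, b} : Finset (Fin n))ᶜ, (1 : Matrix (Fin 2) (Fin 2) ℂ) (x j) (y j) := by
    rw [tensor, prod_eq_mul_mul_prod_compl h]
    congr 1
    · simp [pairUnit, h.symm]
    · refine Finset.prod_congr rfl fun j hj => ?_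
      simp only [Finset.mem_compl, Finset.mem_insert, Finset.mem_singleton, not_or] at hj
      simp [pairUnit, hj.1, hj.2]
  have h2 : ∏ j ∈ ({a, b} : Finset (Fin n))ᶜ, (1 : Matrix (Fin 2) (Fin 2) ℂ) (x j) (y j) =
      if ∀ k, k ≠ a → k ≠ b → x k = y k then 1 else 0 := by
    split_ifs with hk
    · refine Finset.prod_eq_one fun j hj => ?_
      simp only [Finset.mem_compl, Finset.mem_insert, Finset.mem_singleton, not_or] at hj
      rw [hk j hj.1 hj.2, Matrix.one_apply_eq]
    · push Not at hk
      obtain ⟨k, ha, hb, hk⟩ := hk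
      exact Finset.prod_eq_zero (i := k) (by simp [ha, hb]) (Matrix.one_apply_ne hk)
  rw [h1, h2]
  obtain ⟨r1, r2⟩ := r
  obtain ⟨c1, c2⟩ := c
  simp only [Matrix.single_apply, Prod.mk.injEq]
  by_cases e1 : r1 = x a <;> by_cases e2 : r2 = x b <;> by_cases e3 : c1 = y a <;>
    by_cases e4 : c2 = y b <;> simp [e1, e2, e3, e4]

/-- A gate is not a tensor product over single qubits, but matrix units on its pair are. The
expansion reduces traces of conjugated strings to products of single-qubit traces. -/
lemma Gate.op_eq_sum {n : ℕ} (g : Gate n) :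
    g.op = ∑ i : (Fin 2 × Fin 2) × (Fin 2 × Fin 2),
      (g.mat : Matrix (Fin 2 × Fin 2) (Fin 2 × Fin 2) ℂ) i.1 i.2 •
        tensor (pairUnit g.fst g.snd i.1 i.2) := by
  ext x y
  rw [Fintype.sum_prod_type]
  simp only [Matrix.sum_apply, Matrix.smul_apply, tensor_pairUnit_apply g.ne, smul_eq_mul,
    mul_ite, mul_one, mul_zero]
  simp [Gate.op]

lemma matrix_eq_sum_kronecker (G : Matrix (Fin 2 × Fin 2) (Fin 2 × Fin 2) ℂ) :
    G = ∑ i : (Fin 2 × Fin 2) × (Fin 2 × Fin 2), G i.1 i.2 •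
      (Matrix.single i.1.1 i.2.1 (1 : ℂ) ⊗ₖ Matrix.single i.1.2 i.2.2 (1 : ℂ)) := by
  rw [Fintype.sum_prod_type]
  conv_lhs => rw [Matrix.matrix_eq_sum_single G]
  refine Finset.sum_congr rfl fun r _ => Finset.sum_congr rfl fun c _ => ?_
  rw [Matrix.single_kronecker_single]
  simp

lemma trace_conj_sum {m ι : Type*} [Fintype m] [DecidableEq m] [Fintype ι] (a : ι → ℂ)
    (M : ι → Matrix m m ℂ) (A B : Matrix m m ℂ) :
    ((∑ i, a i • M i)ᴴ * A * (∑ i, a i • M i) * B).trace =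
      ∑ i, ∑ j, a i * star (a j) * ((M j)ᴴ * A * M i * B).trace := by
  simp only [Matrix.conjTranspose_sum, Matrix.conjTranspose_smul, Matrix.sum_mul,
    Matrix.smul_mul, Matrix.mul_smul, Matrix.trace_sum, Matrix.trace_smul, smul_eq_mul, mul_assoc,
    Finset.mul_sum]

/-- The trace of a tensor product is a product of traces. The factors at `a` and `b` recombine into
a trace on the pair, and every other qubit contributes tr(P_j Q_j). -/
lemma trace_conj_pairUnit {n : ℕ} {a b : Fin n} (h : a ≠ b) (r' c' r c : Fin 2 × Fin 2)
    (P Q : Pauli n) :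
    ((tensor (pairUnit a b r' c'))ᴴ * P.op * tensor (pairUnit a b r c) * Q.op).trace =
      ((Matrix.single r'.1 c'.1 (1 : ℂ) ⊗ₖ Matrix.single r'.2 c'.2 (1 : ℂ))ᴴ *
        (pauli1 (P a) ⊗ₖ pauli1 (P b)) *
        (Matrix.single r.1 c.1 (1 : ℂ) ⊗ₖ Matrix.single r.2 c.2 (1 : ℂ)) *
        (pauli1 (Q a) ⊗ₖ pauli1 (Q b))).trace *
      ∏ j ∈ ({a, b} : Finset (Fin n))ᶜ, (2 * if P j = Q j then 1 else 0) := by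
  rw [P.op_eq_tensor, Q.op_eq_tensor, tensor_conjTranspose, tensor_mul, tensor_mul, tensor_mul,
    trace_tensor, prod_eq_mul_mul_prod_compl h, Matrix.conjTranspose_kronecker,
    ← Matrix.mul_kronecker_mul, ← Matrix.mul_kronecker_mul, ← Matrix.mul_kronecker_mul,
    Matrix.trace_kronecker]
  have ha : ∀ r c, pairUnit a b r c a = Matrix.single r.1 c.1 1 := fun r c => if_pos rfl
  have hb : ∀ r c, pairUnit a b r c b = Matrix.single r.2 c.2 1 := fun r c => by
    rw [pairUnit, if_neg h.symm, if_pos rfl]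
  rw [ha, ha, hb, hb]
  congr 1
  refine Finset.prod_congr rfl fun j hj => ?_
  simp only [Finset.mem_compl, Finset.mem_insert, Finset.mem_singleton, not_or] at hj
  simp [pairUnit, hj.1, hj.2, trace_pauli1_mul]

/-- Conjugating a Pauli string by a gate only changes the letters on the qubits of the gate. -/
lemma Gate.coef_conj {n : ℕ} (g : Gate n) (P Q : Pauli n) :
    coef (g.opᴴ * P.op * g.op) Q = g.factor (P g.fst) (P g.snd) (Q g.fst) (Q g.snd) *
      ∏ j ∈ ({g.fst, g.snd} : Finset (Fin n))ᶜ, if P j = Q j then 1 else 0 := by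
  -- The normalization is split the same way: 4 belongs to the pair of the gate, and each remaining
  -- 2 cancels the trace on an idle qubit.
  have h2 : (2 : ℂ) ^ n = 4 * ∏ j ∈ ({g.fst, g.snd} : Finset (Fin n))ᶜ, (2 : ℂ) := by
    have := prod_eq_mul_mul_prod_compl g.ne (fun _ => (2 : ℂ))
    simp only [Finset.prod_const, Finset.card_univ, Fintype.card_fin] at this ⊢
    rw [this]; ring
  have h3 : (∏ j ∈ ({g.fst, g.snd} : Finset (Fin n))ᶜ, (2 : ℂ)) ≠ 0 :=
    Finset.prod_ne_zero_iff.2 fun _ _ => two_ne_zero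
  have hg := g.op_eq_sum
  have hG := matrix_eq_sum_kronecker (g.mat : Matrix (Fin 2 × Fin 2) (Fin 2 × Fin 2) ℂ)
  have key : (g.opᴴ * P.op * g.op * Q.op).trace = 4 *
      g.factor (P g.fst) (P g.snd) (Q g.fst) (Q g.snd) *
      ∏ j ∈ ({g.fst, g.snd} : Finset (Fin n))ᶜ, (2 * if P j = Q j then 1 else 0) := by
    rw [Gate.factor, mul_div_cancel₀ _ (by norm_num)]
    generalize hM : (g.mat : Matrix (Fin 2 × Fin 2) (Fin 2 × Fin 2) ℂ) = M at hg hG ⊢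
    -- The trace on all qubits and the one on the pair become the same double sum over matrix units,
    -- with equal coefficients.
    rw [hg, trace_conj_sum]
    conv_rhs => rw [hG, trace_conj_sum]
    simp only [trace_conj_pairUnit g.ne, Finset.sum_mul]
    refine Finset.sum_congr rfl fun i _ => Finset.sum_congr rfl fun j _ => ?_
    rw [mul_assoc (M i.1 i.2 * star (M j.1 j.2))]
  rw [coef, key, h2, Finset.prod_mul_distrib]
  field_simp

/-! ### Factorization of layer amplitudes over the qubits -/

/-- The gate that acts on qubit `j`. -/
def gateOf {n : ℕ} (gs : List (Gate n)) (j : Fin n) : Option (Gate n) :=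
  gs.find? fun g => decide (g.fst = j ∨ g.snd = j)

/-- The operator of a list of gates. -/
def gatesOp {n : ℕ} (gs : List (Gate n)) : Op n := (gs.map Gate.op).prod

/-- The qubits of a list of gates. -/
def gatesQubits {n : ℕ} (gs : List (Gate n)) : List (Fin n) :=
  gs.flatMap fun g => [g.fst, g.snd]

/-- The factor `e` of a non-identity letter. -/
noncomputable def damp (e : ℂ) (q : Fin 4) : ℂ := if q = 0 then 1 else e

/-- The damped transition amplitude of a gate. -/
noncomputable def Gate.weight {n : ℕ} (g : Gate n) (e : ℂ) (p₁ p₂ q₁ q₂ : Fin 4) : ℂ :=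
  damp e q₁ * damp e q₂ * g.factor p₁ p₂ q₁ q₂

/-- The factor of the transition amplitude from `P` to `Q` that is attributed to qubit `j`:
that of the gate for the first qubit of a gate, and `1` for the second one. Letters on idle
qubits stay the same, with a factor of `δ` for non-identity letters. -/
noncomputable def siteFactor {n : ℕ} (δ e : ℂ) (gs : List (Gate n)) (P Q : Pauli n) (j : Fin n) :
    ℂ :=
  match gateOf gs j with
  | none => if P j = Q j then damp δ (Q j) else 0
  | some g => if g.fst = j then g.weight e (P g.fst) (P g.snd) (Q g.fst) (Q g.snd) else 1

lemma gateOf_cons {n : ℕ} (g : Gate n) (gs : List (Gate n)) (j : Fin n) :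
    gateOf (g :: gs) j = if g.fst = j ∨ g.snd = j then some g else gateOf gs j := by
  simp only [gateOf, List.find?_cons]
  by_cases h : g.fst = j ∨ g.snd = j <;> simp [h]

lemma mem_of_gateOf {n : ℕ} {gs : List (Gate n)} {j : Fin n} {g : Gate n}
    (h : gateOf gs j = some g) : g ∈ gs ∧ (g.fst = j ∨ g.snd = j) := by
  refine ⟨List.mem_of_find?_eq_some h, ?_⟩
  simpa using List.find?_some h

lemma gateOf_eq_none {n : ℕ} {gs : List (Gate n)} {j : Fin n} :
    gateOf gs j = none ↔ ∀ g ∈ gs, g.fst ≠ j ∧ g.snd ≠ j := by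
  simp [gateOf, List.find?_eq_none]

lemma gateOf_eq_some {n : ℕ} {gs : List (Gate n)} (hd : DisjointGates gs) {g : Gate n}
    (hg : g ∈ gs) {j : Fin n} (hj : g.fst = j ∨ g.snd = j) : gateOf gs j = some g := by
  induction gs with
  | nil => simp at hg
  | cons h gs ih =>
    rw [gateOf_cons]
    rw [DisjointGates, List.pairwise_cons] at hd
    rcases List.mem_cons.1 hg with rfl | hg
    · rw [if_pos hj]
    · have := hd.1 g hg
      rw [if_neg, ih hd.2 hg]
      rintro (h1 | h1) <;> rcases hj with h2 | h2 <;> simp_all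

lemma mem_gatesQubits {n : ℕ} {gs : List (Gate n)} {j : Fin n} :
    j ∈ gatesQubits gs ↔ gateOf gs j ≠ none := by
  rw [ne_eq, gateOf_eq_none]
  simp only [gatesQubits, List.mem_flatMap, List.mem_cons, List.not_mem_nil, or_false]
  push Not
  constructor
  · rintro ⟨g, hg, rfl | rfl⟩
    · exact ⟨g, hg, fun h => absurd rfl h⟩
    · exact ⟨g, hg, fun _ => rfl⟩
  · rintro ⟨g, hg, h⟩
    refine ⟨g, hg, ?_⟩
    by_cases h1 : g.fst = j
    · exact Or.inl h1.symm
    · exact Or.inr (h h1).symm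

/-- Replacing the letters of `P` on the qubits of a gate by those of `Q`. -/
def Gate.replace {n : ℕ} (g : Gate n) (P Q : Pauli n) : Pauli n := fun j =>
  if j = g.fst ∨ j = g.snd then Q j else P j

lemma DisjointGates.gateOf_eq_none {n : ℕ} {g : Gate n} {gs : List (Gate n)}
    (hd : DisjointGates (g :: gs)) {j : Fin n} (hj : j = g.fst ∨ j = g.snd) :
    gateOf gs j = none := by
  rw [DisjointGates, List.pairwise_cons] at hd
  refine GateNoise.gateOf_eq_none.2 fun h hh => ?_
  have := hd.1 h hh
  rcases hj with rfl | rfl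
  · exact ⟨this.1.symm, this.2.1.symm⟩
  · exact ⟨this.2.2.1.symm, this.2.2.2.symm⟩

/-- The later gates are disjoint from `g`, so the string between `g` and them must already agree
with `Q` on the pair of `g` and still agree with `P` elsewhere. For the later gates this pair is
idle and, as δ = 1, contributes trivial factors. -/
lemma prod_siteFactor_cons {n : ℕ} (e : ℂ) {g : Gate n} {gs : List (Gate n)}
    (hd : DisjointGates (g :: gs)) (P Q : Pauli n) :
    ∏ j, siteFactor 1 e (g :: gs) P Q j =
      g.weight e (P g.fst) (P g.snd) (Q g.fst) (Q g.snd) *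
        ∏ j, siteFactor 1 e gs (g.replace P Q) Q j := by
  have hdamp : ∀ q, damp 1 q = 1 := fun q => by simp [damp]
  rw [prod_eq_mul_mul_prod_compl g.ne, prod_eq_mul_mul_prod_compl g.ne]
  have h1 : siteFactor 1 e (g :: gs) P Q g.fst =
      g.weight e (P g.fst) (P g.snd) (Q g.fst) (Q g.snd) := by
    simp [siteFactor, gateOf_cons]
  have h2 : siteFactor 1 e (g :: gs) P Q g.snd = 1 := by
    simp [siteFactor, gateOf_cons, g.ne]
  have h3 : siteFactor 1 e gs (g.replace P Q) Q g.fst = 1 := by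
    simp [siteFactor, hd.gateOf_eq_none (Or.inl rfl), Gate.replace, hdamp]
  have h4 : siteFactor 1 e gs (g.replace P Q) Q g.snd = 1 := by
    simp [siteFactor, hd.gateOf_eq_none (Or.inr rfl), Gate.replace, hdamp]
  rw [h1, h2, h3, h4, mul_one, one_mul, one_mul]
  congr 1
  refine Finset.prod_congr rfl fun j hj => ?_
  simp only [Finset.mem_compl, Finset.mem_insert, Finset.mem_singleton, not_or] at hj
  have hc : gateOf (g :: gs) j = gateOf gs j := by
    rw [gateOf_cons, if_neg]
    rintro (h | h)
    · exact hj.1 h.symm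
    · exact hj.2 h.symm
  simp only [siteFactor, hc]
  cases hg : gateOf gs j with
  | none => simp [Gate.replace, hj.1, hj.2]
  | some h =>
    have hm := mem_of_gateOf hg
    rw [DisjointGates, List.pairwise_cons] at hd
    obtain ⟨h1, h2, h3, h4⟩ := hd.1 h hm.1
    simp [Gate.replace, h1.symm, h2.symm, h3.symm, h4.symm]

lemma siteFactor_nil {n : ℕ} (δ e : ℂ) (P Q : Pauli n) (j : Fin n) :
    siteFactor δ e [] P Q j = if P j = Q j then damp δ (Q j) else 0 := rfl

/-- In the Heisenberg picture the left factor conjugates first; the Pauli expansion is inserted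
between the two conjugations. -/
lemma coef_mul_conj {n : ℕ} (U V : Op n) (P Q : Pauli n) :
    coef ((U * V)ᴴ * P.op * (U * V)) Q =
      ∑ R, coef (Uᴴ * P.op * U) R * coef (Vᴴ * R.op * V) Q := by
  have : (U * V)ᴴ * P.op * (U * V) = ∑ R, coef (Uᴴ * P.op * U) R • (Vᴴ * R.op * V) := by
    have h : (U * V)ᴴ * P.op * (U * V) = Vᴴ * (Uᴴ * P.op * U) * V := by
      simp only [Matrix.conjTranspose_mul, mul_assoc]
    rw [h]
    conv_lhs => rw [← sum_coef_smul_op (Uᴴ * P.op * U)]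
    simp only [Finset.mul_sum, Finset.sum_mul, Matrix.mul_smul, Matrix.smul_mul]
  rw [this, coef_sum]
  simp only [coef_smul]

/-- The transition amplitude of a layer factorizes over the qubits. -/
lemma prod_siteFactor_one {n : ℕ} {gs : List (Gate n)} (hd : DisjointGates gs) (P Q : Pauli n) :
    ∏ j, siteFactor 1 1 gs P Q j = coef ((gatesOp gs)ᴴ * P.op * gatesOp gs) Q := by
  have hdamp : ∀ q, damp 1 q = 1 := fun q => by simp [damp]
  induction gs generalizing P with
  | nil =>
    simp only [siteFactor_nil, hdamp, gatesOp, List.map_nil, List.prod_nil]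
    simp only [Matrix.conjTranspose_one, one_mul, mul_one, coef_op]
    split_ifs with h
    · subst h; simp
    · obtain ⟨j, hj⟩ := Function.ne_iff.1 h
      exact Finset.prod_eq_zero (Finset.mem_univ j) (if_neg hj)
  | cons g gs ih =>
    have ih := ih (List.pairwise_cons.1 hd).2
    rw [prod_siteFactor_cons 1 hd]
    have : gatesOp (g :: gs) = g.op * gatesOp gs := by simp [gatesOp]
    -- A single intermediate string survives: the tail of the list fixes the letters on the pair of
    -- `g`, and `g` fixes all others.
    rw [this, coef_mul_conj, Finset.sum_eq_single (g.replace P Q)]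
    · rw [ih, g.coef_conj]
      congr 1
      rw [Finset.prod_eq_one, mul_one]
      · simp [Gate.weight, hdamp, Gate.replace]
      · intro j hj
        simp only [Finset.mem_compl, Finset.mem_insert, Finset.mem_singleton, not_or] at hj
        simp [Gate.replace, hj.1, hj.2]
    · intro R _ hR
      obtain ⟨j, hj⟩ := Function.ne_iff.1 hR
      by_cases hjg : j = g.fst ∨ j = g.snd
      · rw [← ih, Finset.prod_eq_zero (Finset.mem_univ j), mul_zero]
        simp only [Gate.replace, hjg, if_true] at hj
        simp [siteFactor, hd.gateOf_eq_none hjg, hj]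
      · simp only [Gate.replace, hjg, if_false] at hj
        rw [g.coef_conj, Finset.prod_eq_zero (i := j), mul_zero, zero_mul]
        · simpa using hjg
        · exact if_neg (Ne.symm hj)
    · simp

/-- The damping depends only on the final letters on the gates, and passing from `P` to the
intermediate string leaves `Q` alone, so it can be pulled out gate by gate. -/
lemma prod_siteFactor_damp {n : ℕ} (e : ℂ) {gs : List (Gate n)} (hd : DisjointGates gs)
    (P Q : Pauli n) :
    ∏ j, siteFactor 1 e gs P Q j =
      (∏ j, if j ∈ gatesQubits gs then damp e (Q j) else 1) *
        ∏ j, siteFactor 1 1 gs P Q j := by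
  have hdamp : ∀ q, damp 1 q = 1 := fun q => by simp [damp]
  induction gs generalizing P with
  | nil => simp [gatesQubits, siteFactor_nil]
  | cons g gs ih =>
    have ih := ih (List.pairwise_cons.1 hd).2
    rw [prod_siteFactor_cons e hd, prod_siteFactor_cons 1 hd, ih]
    have hq : ∏ j, (if j ∈ gatesQubits (g :: gs) then damp e (Q j) else 1) =
        damp e (Q g.fst) * damp e (Q g.snd) *
          ∏ j, (if j ∈ gatesQubits gs then damp e (Q j) else 1) := by
      rw [prod_eq_mul_mul_prod_compl g.ne, prod_eq_mul_mul_prod_compl g.ne]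
      have h1 : g.fst ∉ gatesQubits gs := by simp [mem_gatesQubits, hd.gateOf_eq_none]
      have h2 : g.snd ∉ gatesQubits gs := by simp [mem_gatesQubits, hd.gateOf_eq_none]
      have h3 : ∀ j, j ∈ gatesQubits (g :: gs) ↔ j = g.fst ∨ j = g.snd ∨ j ∈ gatesQubits gs := by
        intro j; simp [gatesQubits]
      simp only [h1, h2, h3, if_false, one_mul, true_or, or_true, if_true]
      congr 1
      refine Finset.prod_congr rfl fun j hj => ?_
      simp only [Finset.mem_compl, Finset.mem_insert, Finset.mem_singleton, not_or] at hj
      simp [hj.1, hj.2]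
    rw [hq]
    simp only [Gate.weight, hdamp]
    ring

lemma prod_damp {n : ℕ} (γ : ℝ) (s : Finset (Fin n)) (Q : Pauli n) :
    ∏ j ∈ s, damp (Real.exp (-γ)) (Q j) =
      (Real.exp (-γ * (s.filter fun j => Q j ≠ 0).card) : ℂ) := by
  simp only [damp]
  rw [Finset.prod_ite, Finset.prod_const_one, one_mul, Finset.prod_const, mul_comm (-γ),
    Real.exp_nat_mul]
  push_cast
  rfl

/-- The damped transition amplitude of a layer factorizes over the qubits. -/
lemma Layer.prod_siteFactor {n : ℕ} (γ : ℝ) (L : Layer n) (P Q : Pauli n) :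
    ∏ j, siteFactor 1 (Real.exp (-γ)) L.gates P Q j =
      (Real.exp (-γ * L.weight Q) : ℂ) * L.amplitude P Q := by
  rw [prod_siteFactor_damp _ L.disjoint, prod_siteFactor_one L.disjoint]
  congr 1
  · rw [← Finset.prod_filter, prod_damp, Finset.filter_filter]
    simp only [Layer.weight, Layer.qubits, gatesQubits, and_comm]
    congr!
  · rw [coef, Matrix.trace_mul_comm]
    rfl

lemma Layer.amplitude_eq_coef {n : ℕ} (L : Layer n) (P Q : Pauli n) :
    L.amplitude P Q = coef (L.opᴴ * P.op * L.op) Q := by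
  rw [coef, Matrix.trace_mul_comm]
  rfl

/-- The purpose of δ: over an empty layer, δ = e^{-γ} yields the read-out noise and δ = 1 the
identity map, so one search serves for the initial coefficients, the layers and the final trace. -/
lemma prod_siteFactor_nil {n : ℕ} (δ e : ℂ) (P Q : Pauli n) :
    ∏ j, siteFactor δ e [] P Q j = if P = Q then ∏ j, damp δ (Q j) else 0 := by
  simp only [siteFactor_nil]
  split_ifs with h
  · subst h; simp
  · obtain ⟨j, hj⟩ := Function.ne_iff.1 h
    exact Finset.prod_eq_zero (Finset.mem_univ j) (if_neg hj)

/-! ### Layers are unitary -/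

/-- Unitarity of the embedded gate is read off from Pauli coefficients: conjugating the identity
string leaves only the identity by `Gate.factor_zero_left`. -/
lemma Gate.op_conjTranspose_mul_self {n : ℕ} (g : Gate n) : g.opᴴ * g.op = 1 := by
  have h : ∀ Q, coef (g.opᴴ * g.op) Q = coef (1 : Op n) Q := fun Q => by
    have := g.coef_conj 0 Q
    rw [Pauli.op_zero, mul_one] at this
    rw [this, ← Pauli.op_zero, coef_op]
    simp only [Pi.zero_apply, g.factor_zero_left]
    split_ifs with h0 h1 h1
    · rw [one_mul]
      exact Finset.prod_eq_one fun j _ => by simp [← h1]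
    · rw [one_mul]
      obtain ⟨j, hj⟩ := Function.ne_iff.1 h1
      refine Finset.prod_eq_zero (i := j) ?_ (if_neg hj)
      simp only [Finset.mem_compl, Finset.mem_insert, Finset.mem_singleton, not_or]
      constructor <;> rintro rfl <;> simp_all
    · exact absurd (by simp [← h1]) h0
    · rw [zero_mul]
  rw [← sum_coef_smul_op (g.opᴴ * g.op), ← sum_coef_smul_op (1 : Op n)]
  simp only [h]

lemma gatesOp_conjTranspose_mul_self {n : ℕ} (gs : List (Gate n)) :
    (gatesOp gs)ᴴ * gatesOp gs = 1 := by
  induction gs with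
  | nil => simp [gatesOp]
  | cons g gs ih =>
    have : gatesOp (g :: gs) = g.op * gatesOp gs := by simp [gatesOp]
    rw [this, Matrix.conjTranspose_mul, mul_assoc, ← mul_assoc g.opᴴ, g.op_conjTranspose_mul_self,
      one_mul, ih]

lemma Layer.conjTranspose_mul_self {n : ℕ} (L : Layer n) : L.opᴴ * L.op = 1 :=
  gatesOp_conjTranspose_mul_self L.gates

lemma Layer.mul_conjTranspose_self {n : ℕ} (L : Layer n) : L.op * L.opᴴ = 1 :=
  mul_eq_one_comm.1 L.conjTranspose_mul_self

lemma frobNorm_conj {n : ℕ} (L : Layer n) (A : Op n) : frobNorm (L.opᴴ * A * L.op) = frobNorm A := by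
  have : (L.opᴴ * A * L.op)ᴴ * (L.opᴴ * A * L.op) = L.opᴴ * (Aᴴ * A * L.op) := by
    simp only [Matrix.conjTranspose_mul, Matrix.conjTranspose_conjTranspose]
    calc _ = L.opᴴ * (Aᴴ * (L.op * L.opᴴ) * A * L.op) := by simp only [mul_assoc]
      _ = _ := by rw [L.mul_conjTranspose_self, mul_one]
  rw [frobNorm, this, Matrix.trace_mul_comm, mul_assoc, L.mul_conjTranspose_self, mul_one, frobNorm]

/-! ### The noise is diagonal in the Pauli basis -/

lemma resetQubit_add {n : ℕ} (j : Fin n) (A B : Op n) :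
    resetQubit j (A + B) = resetQubit j A + resetQubit j B := by
  ext x y
  simp only [resetQubit, Matrix.add_apply, Finset.sum_add_distrib]
  split_ifs <;> ring

lemma resetQubit_smul {n : ℕ} (j : Fin n) (a : ℂ) (A : Op n) :
    resetQubit j (a • A) = a • resetQubit j A := by
  ext x y
  simp only [resetQubit, Matrix.smul_apply, smul_eq_mul, ← Finset.mul_sum]
  split_ifs <;> ring

lemma resetQubit_sum {n : ℕ} {ι : Type*} (s : Finset ι) (j : Fin n) (A : ι → Op n) :
    resetQubit j (∑ i ∈ s, A i) = ∑ i ∈ s, resetQubit j (A i) := by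
  classical
  induction s using Finset.induction_on with
  | empty => ext x y; simp [resetQubit]
  | insert i s hi ih => rw [Finset.sum_insert hi, Finset.sum_insert hi, resetQubit_add, ih]

/-- Tracing out qubit `j` sees only the trace of its letter, which vanishes for X, Y and Z. This is
why the noise is diagonal. -/
lemma resetQubit_op {n : ℕ} (j : Fin n) (P : Pauli n) :
    resetQubit j P.op = if P j = 0 then P.op else 0 := by
  ext x y
  have h : ∀ b, P.op (Function.update x j b) (Function.update y j b) =
      pauli1 (P j) b b * ∏ i ∈ Finset.univ.erase j, pauli1 (P i) (x i) (y i) := fun b => by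
    rw [Pauli.op, ← Finset.mul_prod_erase _ _ (Finset.mem_univ j)]
    congr 1
    · simp
    · refine Finset.prod_congr rfl fun i hi => ?_
      have := Finset.ne_of_mem_erase hi
      simp [this]
  have h2 : P.op x y = pauli1 (P j) (x j) (y j) *
      ∏ i ∈ Finset.univ.erase j, pauli1 (P i) (x i) (y i) := by
    rw [Pauli.op, ← Finset.mul_prod_erase _ _ (Finset.mem_univ j)]
  have h3 : ∑ b, pauli1 (P j) b b = if P j = 0 then 2 else 0 := trace_pauli1 (P j)
  simp only [resetQubit, h, ← Finset.sum_mul, h3]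
  by_cases hP : P j = 0
  · simp only [hP, if_true, h2]
    by_cases hx : x j = y j
    · have : pauli1 0 (x j) (y j) = 1 := by rw [hx]; exact Matrix.one_apply_eq _
      rw [if_pos hx, this]
      ring
    · have : pauli1 0 (x j) (y j) = 0 := Matrix.one_apply_ne hx
      rw [if_neg hx, this, zero_mul]
  · simp [hP]

lemma coef_resetQubit {n : ℕ} (j : Fin n) (A : Op n) (P : Pauli n) :
    coef (resetQubit j A) P = if P j = 0 then coef A P else 0 := by
  conv_lhs => rw [← sum_coef_smul_op A]
  simp only [resetQubit_sum, resetQubit_smul, resetQubit_op, coef_sum, coef_smul]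
  rw [Finset.sum_eq_single P]
  · split_ifs
    · simp [coef_op]
    · simp [coef]
  · intro Q _ hQ
    split_ifs
    · simp [coef_op, hQ]
    · simp [coef]
  · simp

lemma coef_depolarize {n : ℕ} (γ : ℝ) (j : Fin n) (A : Op n) (P : Pauli n) :
    coef (depolarize γ j A) P = damp (Real.exp (-γ)) (P j) * coef A P := by
  rw [depolarize, coef_add, coef_smul, coef_smul, coef_resetQubit, damp]
  split_ifs <;> push_cast <;> ring

lemma coef_noiseOn {n : ℕ} (γ : ℝ) (js : List (Fin n)) (A : Op n) (P : Pauli n) :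
    coef (noiseOn γ js A) P = (js.map fun j => damp (Real.exp (-γ)) (P j)).prod * coef A P := by
  induction js with
  | nil => simp [noiseOn]
  | cons j js ih =>
    have : noiseOn γ (j :: js) A = depolarize γ j (noiseOn γ js A) := rfl
    rw [this, coef_depolarize, ih, List.map_cons, List.prod_cons, mul_assoc]

/-- Disjointness ensures that the noise of a layer hits each of its qubits once, so that the damping
exponent is a count of letters. -/
lemma Layer.nodup_qubits {n : ℕ} (L : Layer n) : L.qubits.Nodup := by
  obtain ⟨gs, hd⟩ := L
  change (gatesQubits gs).Nodup
  induction gs with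
  | nil => simp [gatesQubits]
  | cons g gs ih =>
    have h1 : g.fst ∉ gatesQubits gs := by
      simp [mem_gatesQubits, DisjointGates.gateOf_eq_none hd]
    have h2 : g.snd ∉ gatesQubits gs := by
      simp [mem_gatesQubits, DisjointGates.gateOf_eq_none hd]
    have : gatesQubits (g :: gs) = g.fst :: g.snd :: gatesQubits gs := by simp [gatesQubits]
    rw [this, List.nodup_cons, List.nodup_cons]
    refine ⟨?_, h2, ih (List.pairwise_cons.1 hd).2⟩
    simp [h1, g.ne]

lemma coef_noiseOn_layer {n : ℕ} (γ : ℝ) (L : Layer n) (A : Op n) (P : Pauli n) :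
    coef (noiseOn γ L.qubits A) P = (Real.exp (-γ * L.weight P) : ℂ) * coef A P := by
  rw [coef_noiseOn, ← List.prod_toFinset _ L.nodup_qubits, prod_damp, Layer.weight]
  congr 6
  ext j
  simp [and_comm]

lemma coef_noiseOn_univ {n : ℕ} (γ : ℝ) (A : Op n) (P : Pauli n) :
    coef (noiseOn γ (List.finRange n) A) P = (Real.exp (-γ * P.weight) : ℂ) * coef A P := by
  rw [coef_noiseOn, ← List.prod_toFinset _ (List.nodup_finRange n), prod_damp, Pauli.weight]
  congr 6
  ext j
  simp

/-! ### Evolution of Pauli coefficients -/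

/-- Conjugation by a layer in terms of Pauli coefficients. -/
noncomputable def Layer.conjCoef {n : ℕ} (L : Layer n) (c : Pauli n → ℂ) : Pauli n → ℂ := fun Q =>
  ∑ P, L.amplitude P Q * c P

/-- Conjugation by a layer and noise in terms of Pauli coefficients. -/
noncomputable def Layer.evolveCoef {n : ℕ} (γ : ℝ) (L : Layer n) (c : Pauli n → ℂ) :
    Pauli n → ℂ := fun Q =>
  (Real.exp (-γ * L.weight Q) : ℂ) * L.conjCoef c Q

lemma Layer.coef_conj {n : ℕ} (L : Layer n) (A : Op n) :
    coef (L.opᴴ * A * L.op) = L.conjCoef (coef A) := by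
  funext Q
  conv_lhs => rw [← sum_coef_smul_op A]
  simp only [Finset.mul_sum, Finset.sum_mul, Matrix.mul_smul, Matrix.smul_mul, coef_sum, coef_smul,
    Layer.conjCoef, L.amplitude_eq_coef]
  exact Finset.sum_congr rfl fun P _ => mul_comm _ _

lemma coef_heisenberg {n : ℕ} (γ : ℝ) (C : Circuit n) (O : Op n) :
    coef (C.heisenberg γ O) = C.foldl (fun c L => L.evolveCoef γ c)
      fun P => (Real.exp (-γ * P.weight) : ℂ) * coef O P := by
  have : (fun P => (Real.exp (-γ * P.weight) : ℂ) * coef O P) =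
      coef (noiseOn γ (List.finRange n) O) := funext fun P => (coef_noiseOn_univ γ O P).symm
  rw [this, Circuit.heisenberg]
  generalize noiseOn γ (List.finRange n) O = A
  induction C generalizing A with
  | nil => rfl
  | cons L C ih =>
    rw [List.foldl_cons, List.foldl_cons, ih]
    congr 1
    funext Q
    rw [coef_noiseOn_layer, L.coef_conj, Layer.evolveCoef]

/-- Dropping the coefficients of weight more than `l`. -/
noncomputable def lowPart {n : ℕ} (l : ℕ) (c : Pauli n → ℂ) : Pauli n → ℂ := fun P =>
  if P.weight ≤ l then c P else 0

/-- Dropping the coefficients of weight at most `l`. -/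
noncomputable def highPart {n : ℕ} (l : ℕ) (c : Pauli n → ℂ) : Pauli n → ℂ := fun P =>
  if P.weight ≤ l then 0 else c P

lemma lowPart_add_highPart {n : ℕ} (l : ℕ) (c : Pauli n → ℂ) :
    lowPart l c + highPart l c = c := by
  funext P
  simp only [Pi.add_apply, lowPart, highPart]
  split_ifs <;> simp

lemma initCoeff_eq {n : ℕ} (γ : ℝ) (l : ℕ) (O : Op n) :
    initCoeff γ l O = lowPart l fun P => (Real.exp (-γ * P.weight) : ℂ) * coef O P := rfl

lemma stepCoeff_eq {n : ℕ} (γ : ℝ) (l : ℕ) (c : Pauli n → ℂ) (L : Layer n) :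
    stepCoeff γ l c L = lowPart l (L.evolveCoef γ (lowPart l c)) := by
  funext Q
  simp only [stepCoeff, lowPart, Layer.evolveCoef, Layer.conjCoef, Finset.sum_filter, mul_ite,
    mul_zero]

lemma lowPart_lowPart {n : ℕ} (l : ℕ) (c : Pauli n → ℂ) :
    lowPart l (lowPart l c) = lowPart l c := by
  funext P
  simp only [lowPart]
  split_ifs <;> rfl

/-- Each step ends with a truncation, so truncating once more in the definition of the approximating
operator loses nothing. -/
lemma lowPart_foldl {n : ℕ} (γ : ℝ) (l : ℕ) (C : Circuit n) (c : Pauli n → ℂ) :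
    lowPart l (C.foldl (stepCoeff γ l) (lowPart l c)) = C.foldl (stepCoeff γ l) (lowPart l c) := by
  induction C generalizing c with
  | nil => exact lowPart_lowPart l c
  | cons L C ih => rw [List.foldl_cons, stepCoeff_eq, ih]

lemma coef_truncated {n : ℕ} (γ : ℝ) (l : ℕ) (C : Circuit n) (O : Op n) :
    coef (C.truncated γ l O) = C.foldl (stepCoeff γ l) (initCoeff γ l O) := by
  rw [initCoeff_eq, ← lowPart_foldl]
  funext P
  rw [Circuit.truncated, coef_sum_smul_op, initCoeff_eq]
  simp [lowPart]

/-! ### The truncation error -/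

/-- The Euclidean norm of a family of Pauli coefficients. -/
noncomputable def coefNorm {n : ℕ} (c : Pauli n → ℂ) : ℝ := ‖WithLp.toLp 2 c‖

lemma coefNorm_sq {n : ℕ} (c : Pauli n → ℂ) : coefNorm c ^ 2 = ∑ P, ‖c P‖ ^ 2 := by
  rw [coefNorm, EuclideanSpace.norm_sq_eq]

lemma coefNorm_nonneg {n : ℕ} (c : Pauli n → ℂ) : 0 ≤ coefNorm c := norm_nonneg _

lemma coefNorm_add_le {n : ℕ} (c c' : Pauli n → ℂ) :
    coefNorm (c + c') ≤ coefNorm c + coefNorm c' := by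
  rw [coefNorm, WithLp.toLp_add]
  exact norm_add_le _ _

lemma frobNorm_eq_coefNorm {n : ℕ} (A : Op n) : frobNorm A = coefNorm (coef A) := by
  rw [frobNorm_eq, ← coefNorm_sq, Real.sqrt_sq (coefNorm_nonneg _)]

lemma coefNorm_le_mul {n : ℕ} {c c' : Pauli n → ℂ} {k : ℝ} (hk : 0 ≤ k)
    (h : ∀ P, ‖c P‖ ≤ k * ‖c' P‖) : coefNorm c ≤ k * coefNorm c' := by
  refine abs_le_of_sq_le_sq' ?_ (mul_nonneg hk (coefNorm_nonneg _)) |>.2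
  rw [mul_pow, coefNorm_sq, coefNorm_sq, Finset.mul_sum]
  refine Finset.sum_le_sum fun P _ => ?_
  rw [← mul_pow]
  exact pow_le_pow_left₀ (norm_nonneg _) (h P) 2

/-- Pythagoras. Norm that is discarded at one truncation is no longer available to later ones. -/
lemma coefNorm_sq_add {n : ℕ} (l : ℕ) (c : Pauli n → ℂ) :
    coefNorm (lowPart l c) ^ 2 + coefNorm (highPart l c) ^ 2 = coefNorm c ^ 2 := by
  simp only [coefNorm_sq, ← Finset.sum_add_distrib]
  refine Finset.sum_congr rfl fun P _ => ?_
  simp only [lowPart, highPart]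
  split_ifs <;> simp

/-- Any coefficient vector comes from an operator, so this is the unitary invariance of the
Frobenius norm. -/
lemma Layer.coefNorm_conjCoef {n : ℕ} (L : Layer n) (c : Pauli n → ℂ) :
    coefNorm (L.conjCoef c) = coefNorm c := by
  have h : coef (∑ P, c P • P.op) = c := by
    funext P; simp [coef_sum_smul_op]
  have := frobNorm_conj L (∑ P, c P • P.op)
  rwa [frobNorm_eq_coefNorm, frobNorm_eq_coefNorm, L.coef_conj, h] at this

lemma norm_exp_neg_mul_le {γ : ℝ} (hγ : 0 < γ) {k m : ℕ} (h : k ≤ m) :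
    ‖(Real.exp (-γ * m) : ℂ)‖ ≤ Real.exp (-γ * k) := by
  rw [Complex.norm_real, Real.norm_eq_abs, Real.abs_exp, Real.exp_le_exp]
  have : (k : ℝ) ≤ m := by exact_mod_cast h
  nlinarith

lemma norm_exp_neg_mul_le_one {γ : ℝ} (hγ : 0 < γ) (m : ℕ) : ‖(Real.exp (-γ * m) : ℂ)‖ ≤ 1 := by
  simpa using norm_exp_neg_mul_le hγ (Nat.zero_le m)

lemma Layer.coefNorm_evolveCoef_le {n : ℕ} {γ : ℝ} (hγ : 0 < γ) (L : Layer n) (c : Pauli n → ℂ) :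
    coefNorm (L.evolveCoef γ c) ≤ coefNorm c := by
  have : coefNorm (L.evolveCoef γ c) ≤ 1 * coefNorm (L.conjCoef c) :=
    coefNorm_le_mul zero_le_one fun P => by
      rw [Layer.evolveCoef, norm_mul]
      exact mul_le_mul_of_nonneg_right (norm_exp_neg_mul_le_one hγ _) (norm_nonneg _)
  rwa [one_mul, L.coefNorm_conjCoef] at this

lemma Layer.evolveCoef_add {n : ℕ} (γ : ℝ) (L : Layer n) (c c' : Pauli n → ℂ) :
    L.evolveCoef γ (c + c') = L.evolveCoef γ c + L.evolveCoef γ c' := by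
  funext Q
  simp only [Layer.evolveCoef, Layer.conjCoef, Pi.add_apply, mul_add, Finset.sum_add_distrib]

lemma foldl_evolveCoef_add {n : ℕ} (γ : ℝ) (C : Circuit n) (c c' : Pauli n → ℂ) :
    C.foldl (fun c L => L.evolveCoef γ c) (c + c') =
      C.foldl (fun c L => L.evolveCoef γ c) c + C.foldl (fun c L => L.evolveCoef γ c) c' := by
  induction C generalizing c c' with
  | nil => rfl
  | cons L C ih => simp only [List.foldl_cons, L.evolveCoef_add, ih]

lemma coefNorm_foldl_evolveCoef_le {n : ℕ} {γ : ℝ} (hγ : 0 < γ) (C : Circuit n)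
    (c : Pauli n → ℂ) : coefNorm (C.foldl (fun c L => L.evolveCoef γ c) c) ≤ coefNorm c := by
  induction C generalizing c with
  | nil => rfl
  | cons L C ih => exact (ih _).trans (L.coefNorm_evolveCoef_le hγ c)

lemma Layer.eq_of_amplitude_ne_zero {n : ℕ} (L : Layer n) {P Q : Pauli n}
    (h : L.amplitude P Q ≠ 0) {j : Fin n} (hj : j ∉ L.qubits) : P j = Q j := by
  have h1 := prod_siteFactor_one L.disjoint P Q
  by_contra hc
  refine h ?_
  rw [L.amplitude_eq_coef]
  refine h1.symm.trans (Finset.prod_eq_zero (Finset.mem_univ j) ?_)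
  have : gateOf L.gates j = none := by
    by_contra hg
    exact hj (mem_gatesQubits.2 hg)
  simp [siteFactor, this, hc]

/-- Both strings have the same letters on idle qubits, so w - w_U takes the same value on them. The
additive form avoids subtraction in ℕ. -/
lemma Layer.weight_add_of_amplitude_ne_zero {n : ℕ} (L : Layer n) {P Q : Pauli n}
    (h : L.amplitude P Q ≠ 0) : L.weight Q + P.weight = Q.weight + L.weight P := by
  have key : ∀ R : Pauli n, R.weight = L.weight R +
      (Finset.univ.filter fun j => R j ≠ 0 ∧ j ∉ L.qubits).card := fun R => by
    rw [Pauli.weight, Layer.weight, ← Finset.filter_filter, ← Finset.filter_filter,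
      Finset.card_filter_add_card_filter_not]
  have h2 : (Finset.univ.filter fun j => P j ≠ 0 ∧ j ∉ L.qubits) =
      Finset.univ.filter fun j => Q j ≠ 0 ∧ j ∉ L.qubits := by
    ext j
    simp only [Finset.mem_filter, Finset.mem_univ, true_and]
    refine and_congr_left fun hj => ?_
    rw [L.eq_of_amplitude_ne_zero h hj]
  rw [key P, key Q, h2]
  ring

/-- Noise on all qubits in terms of Pauli coefficients. -/
noncomputable def fullDamp {n : ℕ} (γ : ℝ) (c : Pauli n → ℂ) : Pauli n → ℂ := fun P =>
  (Real.exp (-γ * P.weight) : ℂ) * c P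

/-- Idle letters carry their old damping through the layer, and letters on gates are damped anew.
Hence full damping before the layer becomes full damping after it, and what remains in front of the
unitary is damping on the gates, a contraction. -/
lemma Layer.evolveCoef_fullDamp {n : ℕ} (γ : ℝ) (L : Layer n) (c : Pauli n → ℂ) :
    L.evolveCoef γ (fullDamp γ c) =
      fullDamp γ (L.conjCoef fun P => (Real.exp (-γ * L.weight P) : ℂ) * c P) := by
  funext Q
  simp only [Layer.evolveCoef, Layer.conjCoef, fullDamp, Finset.mul_sum]
  refine Finset.sum_congr rfl fun P _ => ?_
  by_cases h : L.amplitude P Q = 0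
  · simp [h]
  have hw := L.weight_add_of_amplitude_ne_zero h
  have : (Real.exp (-γ * L.weight Q) : ℂ) * Real.exp (-γ * P.weight) =
      Real.exp (-γ * Q.weight) * Real.exp (-γ * L.weight P) := by
    rw [← Complex.ofReal_mul, ← Complex.ofReal_mul, ← Real.exp_add, ← Real.exp_add, ← mul_add,
      ← mul_add]
    congr 3
    exact_mod_cast hw
  linear_combination (L.amplitude P Q * c P) * this

lemma lowPart_fullDamp {n : ℕ} (γ : ℝ) (l : ℕ) (c : Pauli n → ℂ) :
    lowPart l (fullDamp γ c) = fullDamp γ (lowPart l c) := by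
  funext P
  simp [lowPart, fullDamp]

/-- Discarded strings have weight at least `l + 1`. The bound keeps the norm of the high part alone,
which is what Pythagoras needs. -/
lemma coefNorm_highPart_fullDamp_le {n : ℕ} {γ : ℝ} (hγ : 0 < γ) (l : ℕ) (c : Pauli n → ℂ) :
    coefNorm (highPart l (fullDamp γ c)) ≤ Real.exp (-γ * (l + 1)) * coefNorm (highPart l c) := by
  refine coefNorm_le_mul (Real.exp_nonneg _) fun P => ?_
  simp only [highPart, fullDamp]
  split_ifs with h
  · simp
  · rw [norm_mul]
    refine mul_le_mul_of_nonneg_right ?_ (norm_nonneg _)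
    have := norm_exp_neg_mul_le hγ (show l + 1 ≤ P.weight by omega)
    exact_mod_cast this

/-- Cauchy–Schwarz for (1, √k) and (x, y). With `x` the norm discarded now and `y` the norm kept for
`k` more truncations, it is the inductive step that turns a sum of errors into a square root. -/
lemma add_sqrt_mul_le {k x y z : ℝ} (hk : 0 ≤ k) (hz : 0 ≤ z) (h : y ^ 2 + x ^ 2 ≤ z ^ 2) :
    x + Real.sqrt k * y ≤ Real.sqrt (k + 1) * z := by
  refine abs_le_of_sq_le_sq' ?_ (mul_nonneg (Real.sqrt_nonneg _) hz) |>.2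
  rw [mul_pow, Real.sq_sqrt (by linarith)]
  have hs := Real.sq_sqrt hk
  nlinarith [sq_nonneg (Real.sqrt k * x - y)]

/-- The truncation error of one step, and those of the following steps. -/
lemma coefNorm_truncation_step {n : ℕ} {γ : ℝ} (hγ : 0 < γ) (l : ℕ) (C : Circuit n)
    (ih : ∀ c : Pauli n → ℂ, coefNorm (C.foldl (fun c L => L.evolveCoef γ c) (lowPart l (fullDamp γ c)) -
      C.foldl (stepCoeff γ l) (lowPart l (fullDamp γ c))) ≤
      Real.exp (-γ * (l + 1)) * (Real.sqrt C.length * coefNorm (lowPart l c)))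
    (c : Pauli n → ℂ) :
    coefNorm (C.foldl (fun c L => L.evolveCoef γ c) (fullDamp γ c) -
      C.foldl (stepCoeff γ l) (lowPart l (fullDamp γ c))) ≤
      Real.exp (-γ * (l + 1)) * (Real.sqrt (C.length + 1) * coefNorm c) := by
  -- By linearity of the exact evolution, the error is the exactly evolved discarded part, bounded
  -- by contractivity, plus the later error of the kept part.
  have h1 : C.foldl (fun c L => L.evolveCoef γ c) (fullDamp γ c) -
      C.foldl (stepCoeff γ l) (lowPart l (fullDamp γ c)) =
      C.foldl (fun c L => L.evolveCoef γ c) (highPart l (fullDamp γ c)) +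
      (C.foldl (fun c L => L.evolveCoef γ c) (lowPart l (fullDamp γ c)) -
        C.foldl (stepCoeff γ l) (lowPart l (fullDamp γ c))) := by
    conv_lhs => rw [← lowPart_add_highPart l (fullDamp γ c), foldl_evolveCoef_add,
      lowPart_add_highPart]
    abel
  rw [h1]
  refine (coefNorm_add_le _ _).trans ?_
  have h2 := (coefNorm_foldl_evolveCoef_le hγ C _).trans (coefNorm_highPart_fullDamp_le hγ l c)
  refine (add_le_add h2 (ih c)).trans ?_
  rw [← mul_add]
  refine mul_le_mul_of_nonneg_left ?_ (Real.exp_nonneg _)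
  exact add_sqrt_mul_le (Nat.cast_nonneg _) (coefNorm_nonneg _) (coefNorm_sq_add l c).le

/-- The invariant of the induction: the coefficients in front of the next layer are fully damped and
already truncated. Only the kept part of `c` enters the bound, since the discarded part was charged
to the truncation before. -/
lemma coefNorm_truncation_le {n : ℕ} {γ : ℝ} (hγ : 0 < γ) (l : ℕ) (C : Circuit n)
    (c : Pauli n → ℂ) :
    coefNorm (C.foldl (fun c L => L.evolveCoef γ c) (lowPart l (fullDamp γ c)) -
      C.foldl (stepCoeff γ l) (lowPart l (fullDamp γ c))) ≤
      Real.exp (-γ * (l + 1)) * (Real.sqrt C.length * coefNorm (lowPart l c)) := by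
  induction C generalizing c with
  | nil => simp [coefNorm]
  | cons L C ih =>
    -- `X` represents the coefficients after the layer with the full damping stripped off; its norm
    -- is at most that of the kept part.
    set X := L.conjCoef fun P => (Real.exp (-γ * L.weight P) : ℂ) * lowPart l c P with hX
    have hE : L.evolveCoef γ (lowPart l (fullDamp γ c)) = fullDamp γ X := by
      rw [lowPart_fullDamp, L.evolveCoef_fullDamp]
    have hXn : coefNorm X ≤ coefNorm (lowPart l c) := by
      rw [hX, L.coefNorm_conjCoef, ← one_mul (coefNorm (lowPart l c))]
      refine coefNorm_le_mul zero_le_one fun P => ?_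
      rw [norm_mul]
      exact mul_le_mul_of_nonneg_right (norm_exp_neg_mul_le_one hγ _) (norm_nonneg _)
    rw [List.foldl_cons, List.foldl_cons, stepCoeff_eq, lowPart_lowPart, hE]
    refine (coefNorm_truncation_step hγ l C ih X).trans ?_
    rw [List.length_cons]
    push_cast
    gcongr

/-- The error of weight truncation in the normalized Frobenius norm. -/
theorem frobNorm_heisenberg_sub_truncated_le {n : ℕ} {γ : ℝ} (hγ : 0 < γ) (l : ℕ) (C : Circuit n)
    (O : Op n) : frobNorm (C.heisenberg γ O - C.truncated γ l O) ≤
      Real.sqrt (C.length + 1) * Real.exp (-γ * (l + 1)) * frobNorm O := by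
  have h : coef (C.heisenberg γ O - C.truncated γ l O) =
      C.foldl (fun c L => L.evolveCoef γ c) (fullDamp γ (coef O)) -
        C.foldl (stepCoeff γ l) (lowPart l (fullDamp γ (coef O))) := by
    funext P
    rw [coef_sub, coef_heisenberg, coef_truncated]
    rfl
  rw [frobNorm_eq_coefNorm, frobNorm_eq_coefNorm, h]
  refine (coefNorm_truncation_step hγ l C (coefNorm_truncation_le hγ l C) _).trans (le_of_eq ?_)
  ring

/-! ### Duality and the error on low-average ensembles -/

lemma trace_noiseOn_mul {n : ℕ} (γ : ℝ) (js : List (Fin n)) (A B : Op n) :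
    (noiseOn γ js A * B).trace = (A * noiseOn γ js B).trace := by
  rw [trace_mul_eq_sum_coef, trace_mul_eq_sum_coef]
  congr 1
  refine Finset.sum_congr rfl fun P _ => ?_
  rw [coef_noiseOn, coef_noiseOn]
  ring

lemma trace_evolve_mul {n : ℕ} (γ : ℝ) (C : Circuit n) (ρ A : Op n) :
    (C.evolve γ ρ * A).trace =
      (ρ * C.foldl (fun A L => noiseOn γ L.qubits (L.opᴴ * A * L.op)) A).trace := by
  induction C generalizing A with
  | nil => rfl
  | cons L C ih =>
    rw [List.foldl_cons, ← ih, Circuit.evolve, ← trace_noiseOn_mul, mul_assoc, mul_assoc,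
      Matrix.trace_mul_comm, mul_assoc, mul_assoc]

lemma trace_channel_mul {n : ℕ} (γ : ℝ) (C : Circuit n) (ρ O : Op n) :
    (C.channel γ ρ * O).trace = (ρ * C.heisenberg γ O).trace := by
  rw [Circuit.channel, trace_noiseOn_mul, trace_evolve_mul, Circuit.heisenberg]

lemma re_trace_conjTranspose_mul_self {m : Type*} [Fintype m] (X : Matrix m m ℂ) :
    (Xᴴ * X).trace.re = ∑ i, ∑ j, ‖X j i‖ ^ 2 := by
  simp only [Matrix.trace, Matrix.diag, Matrix.mul_apply, Matrix.conjTranspose_apply,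
    Complex.re_sum]
  refine Finset.sum_congr rfl fun i _ => Finset.sum_congr rfl fun j _ => ?_
  have : star (X j i) * X j i = ((‖X j i‖ ^ 2 : ℝ) : ℂ) := by
    push_cast; exact Complex.conj_mul' _
  rw [this, Complex.ofReal_re]

lemma norm_trace_conjTranspose_mul_sq_le {m : Type*} [Fintype m] (X Y : Matrix m m ℂ) :
    ‖(Xᴴ * Y).trace‖ ^ 2 ≤ (Xᴴ * X).trace.re * (Yᴴ * Y).trace.re := by
  rw [re_trace_conjTranspose_mul_self, re_trace_conjTranspose_mul_self]
  have h1 : ‖(Xᴴ * Y).trace‖ ≤ ∑ p : m × m, ‖X p.2 p.1‖ * ‖Y p.2 p.1‖ := by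
    rw [Fintype.sum_prod_type]
    simp only [Matrix.trace, Matrix.diag, Matrix.mul_apply, Matrix.conjTranspose_apply]
    refine (norm_sum_le _ _).trans (Finset.sum_le_sum fun i _ => ?_)
    refine (norm_sum_le _ _).trans (Finset.sum_le_sum fun j _ => ?_)
    rw [norm_mul, norm_star]
  refine (pow_le_pow_left₀ (norm_nonneg _) h1 2).trans ?_
  refine (Finset.sum_mul_sq_le_sq_mul_sq _ _ _).trans ?_
  rw [Fintype.sum_prod_type, Fintype.sum_prod_type]

-- Cauchy–Schwarz for ρ = B†B, as tr(ρA) = tr(B†(BA)) and tr(B†B) = 1. The bound is linear in ρ,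
-- unlike the quantity it bounds.
open scoped ComplexOrder MatrixOrder Matrix.Norms.L2Operator in
lemma IsState.norm_trace_mul_sq_le {n : ℕ} {ρ : Op n} (hρ : IsState ρ) (A : Op n) :
    ‖(ρ * A).trace‖ ^ 2 ≤ (Aᴴ * ρ * A).trace.re := by
  obtain ⟨B, hB⟩ := CStarAlgebra.nonneg_iff_eq_star_mul_self.1 hρ.1.nonneg
  rw [Matrix.star_eq_conjTranspose] at hB
  have h := norm_trace_conjTranspose_mul_sq_le B (B * A)
  rw [← mul_assoc, ← hB, hρ.2, Complex.one_re, one_mul] at h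
  refine h.trans (le_of_eq ?_)
  rw [Matrix.conjTranspose_mul, hB]
  simp only [mul_assoc]

-- Column by column: the diagonal entries on the left are the quadratic form of `M` at the columns
-- of `A`.
open scoped Matrix.Norms.L2Operator in
lemma re_trace_conj_le {m : Type*} [Fintype m] [DecidableEq m] (M A : Matrix m m ℂ) :
    (Aᴴ * M * A).trace.re ≤ ‖M‖ * (Aᴴ * A).trace.re := by
  rw [re_trace_conjTranspose_mul_self, Finset.mul_sum, Matrix.trace, Complex.re_sum]
  refine Finset.sum_le_sum fun i _ => ?_
  set v : EuclideanSpace ℂ m := WithLp.toLp 2 fun j => A j i with hv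
  have h1 : (Aᴴ * M * A).diag i = inner ℂ v (WithLp.toLp 2 (M *ᵥ v.ofLp) : EuclideanSpace ℂ m) := by
    rw [mul_assoc]
    simp only [Matrix.diag, Matrix.mul_apply, Matrix.conjTranspose_apply, PiLp.inner_apply, hv,
      Matrix.mulVec, dotProduct]
    refine Finset.sum_congr rfl fun j _ => ?_
    simp [mul_comm]
  have h2 : ∑ j, ‖A j i‖ ^ 2 = ‖v‖ * ‖v‖ := by
    rw [← sq, EuclideanSpace.norm_sq_eq]
  rw [h1, h2]
  refine (Complex.re_le_norm _).trans ((norm_inner_le_norm _ _).trans ?_)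
  have := Matrix.l2_opNorm_mulVec M v
  calc ‖v‖ * ‖(WithLp.toLp 2 (M *ᵥ v.ofLp) : EuclideanSpace ℂ m)‖ ≤ ‖v‖ * (‖M‖ * ‖v‖) :=
        mul_le_mul_of_nonneg_left this (norm_nonneg _)
    _ = _ := by ring

open scoped Matrix.Norms.L2Operator in
lemma IsLowAverage.nonneg {n m : ℕ} {ρ : Fin m → Op n} {c : ℝ} (h : IsLowAverage ρ c) : 0 ≤ c := by
  have : 0 ≤ c / 2 ^ n := (norm_nonneg _).trans h
  by_contra hc
  exact absurd this (not_le.2 (div_neg_of_neg_of_pos (not_le.1 hc) (by positivity)))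

open scoped Matrix.Norms.L2Operator in
/-- The mean-square expectation value of an operator on a low-average ensemble. -/
lemma IsLowAverage.sum_norm_trace_mul_sq_le {n m : ℕ} {ρ : Fin m → Op n}
    (hρ : ∀ i, IsState (ρ i)) {c : ℝ} (h : IsLowAverage ρ c) (A : Op n) :
    (∑ i, ‖(ρ i * A).trace‖ ^ 2) / m ≤ c * frobNorm A ^ 2 := by
  have hn : 0 ≤ (Aᴴ * A).trace.re := by
    rw [re_trace_conjTranspose_mul_self]; positivity
  have h1 : (∑ i, ‖(ρ i * A).trace‖ ^ 2) / m ≤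
      (Aᴴ * ((m : ℂ)⁻¹ • ∑ i, ρ i : Op n) * A).trace.re := by
    rw [Matrix.mul_smul, Matrix.smul_mul, Matrix.trace_smul, smul_eq_mul, Finset.mul_sum,
      Finset.sum_mul, Matrix.trace_sum]
    have : ((m : ℂ)⁻¹ * ∑ i, (Aᴴ * ρ i * A).trace).re = (∑ i, (Aᴴ * ρ i * A).trace.re) / m := by
      rw [← Complex.ofReal_natCast, ← Complex.ofReal_inv, Complex.re_ofReal_mul, Complex.re_sum]
      ring
    rw [this]
    gcongr with i
    exact (hρ i).norm_trace_mul_sq_le A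
  refine h1.trans ((re_trace_conj_le _ _).trans ?_)
  refine (mul_le_mul_of_nonneg_right h hn).trans (le_of_eq ?_)
  rw [frobNorm, Real.sq_sqrt (by positivity)]
  ring

lemma exp_threshold_le {γ ε : ℝ} (hγ : 0 < γ) (hε : 0 < ε) (d : ℕ) :
    Real.sqrt (d + 1) * Real.exp (-γ * (threshold γ ε d + 1)) ≤ ε := by
  have hs : 0 < Real.sqrt (d + 1) := Real.sqrt_pos.2 (by positivity)
  -- The ceiling in ℕ bounds its argument from above also when that is negative, which covers the
  -- maximum with 0.
  have h1 : 1 / γ * Real.log (Real.sqrt (d + 1) / ε) - 1 ≤ threshold γ ε d := Nat.le_ceil _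
  have h2 : Real.log (Real.sqrt (d + 1) / ε) ≤ γ * (threshold γ ε d + 1) := by
    have : 1 / γ * Real.log (Real.sqrt (d + 1) / ε) ≤ threshold γ ε d + 1 := by linarith
    rwa [one_div, inv_mul_le_iff₀ hγ] at this
  have h3 : Real.sqrt (d + 1) / ε ≤ Real.exp (γ * (threshold γ ε d + 1)) :=
    (Real.log_le_iff_le_exp (by positivity)).1 h2
  rw [neg_mul, Real.exp_neg, ← div_eq_mul_inv, div_le_iff₀ (Real.exp_pos _)]
  rwa [div_le_iff₀ hε, mul_comm] at h3

/-- The root-mean-square error of the truncated evolution on a low-average ensemble. -/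
theorem rms_error_le {n : ℕ} {γ : ℝ} (hγ : 0 < γ) (C : Circuit n) {O : Op n} (hO : frobNorm O = 1)
    {ε : ℝ} (hε : 0 < ε) {m : ℕ} {ρ : Fin m → Op n} (hρ : ∀ i, IsState (ρ i)) {c : ℝ}
    (hc : IsLowAverage ρ c) :
    Real.sqrt ((∑ i, ‖(C.channel γ (ρ i) * O).trace -
      (ρ i * C.truncated γ (threshold γ ε C.length) O).trace‖ ^ 2) / m) ≤ Real.sqrt c * ε := by
  set l := threshold γ ε C.length
  have h1 : ∀ i, (C.channel γ (ρ i) * O).trace - (ρ i * C.truncated γ l O).trace =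
      (ρ i * (C.heisenberg γ O - C.truncated γ l O)).trace := fun i => by
    rw [trace_channel_mul, mul_sub, Matrix.trace_sub]
  simp only [h1]
  have h2 := frobNorm_heisenberg_sub_truncated_le hγ l C O
  rw [hO, mul_one] at h2
  have h3 := h2.trans (exp_threshold_le hγ hε C.length)
  have h4 : 0 ≤ frobNorm (C.heisenberg γ O - C.truncated γ l O) := Real.sqrt_nonneg _
  calc _ ≤ Real.sqrt (c * ε ^ 2) := by
        refine Real.sqrt_le_sqrt ((hc.sum_norm_trace_mul_sq_le hρ _).trans ?_)
        exact mul_le_mul_of_nonneg_left (pow_le_pow_left₀ h4 h3 2) hc.nonneg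
    _ = Real.sqrt c * ε := by
        rw [Real.sqrt_mul hc.nonneg, Real.sqrt_sq hε.le]

/-! ### Enumeration of low-weight transitions by depth-first search -/

/-- The qubit at which the letter of qubit `i` is chosen: the first qubit of its gate. -/
def owner {n : ℕ} (gs : List (Gate n)) (i : Fin n) : Fin n :=
  match gateOf gs i with
  | none => i
  | some g => g.fst

/-- A partial transition from `P` to `Q`: the letters with owner below `pos` are chosen, with
amplitude `amp`, and the other letters are `0`. -/
structure Node (n : ℕ) where
  pos : ℕ
  P : Pauli n
  Q : Pauli n
  amp : ℂ
  -- The letter of `P` chosen last, at `pos - 1`, to be written into the array through which Pauli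
  -- coefficients are queried.
  letter : Fin 4

/-- The nonzero single-qubit letters. -/
noncomputable def letters : List (Fin 4) := (Finset.univ.filter fun a : Fin 4 => a ≠ 0).toList

/-- The two-qubit transitions between strings other than the identity. -/
noncomputable def transitions : List ((Fin 4 × Fin 4) × (Fin 4 × Fin 4)) :=
  (Finset.univ.filter fun t : (Fin 4 × Fin 4) × (Fin 4 × Fin 4) => t.1 ≠ 0 ∧ t.2 ≠ 0).toList

/-- Setting the letters on qubits `j` and `k`. -/
def setPair {n : ℕ} (P : Pauli n) (j k : Fin n) (a b : Fin 4) : Pauli n :=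
  Function.update (Function.update P k b) j a

/-- Choosing identity letters, or no letters. -/
def Node.rest {n : ℕ} (x : Node n) : Node n :=
  { x with pos := x.pos + 1, letter := 0 }

/-- Choosing the letters `p` and `q` on the qubits `j` and `k`. -/
noncomputable def Node.child {n : ℕ} (x : Node n) (j k : Fin n) (p q : Fin 4 × Fin 4) (f : ℂ) :
    Node n :=
  ⟨x.pos + 1, setPair x.P j k p.1 p.2, setPair x.Q j k q.1 q.2, x.amp * f, p.1⟩

/-- The extensions of a partial transition by the letters that qubit `j` owns. -/
noncomputable def Node.extend {n : ℕ} (δ e : ℂ) (gs : List (Gate n)) (x : Node n) (j : Fin n) :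
    List (Node n) :=
  match gateOf gs j with
  | none => x.rest :: letters.map fun a => x.child j j (a, 0) (a, 0) δ
  | some g =>
    if g.fst = j then
      x.rest :: transitions.map fun t =>
        x.child j g.snd t.1 t.2 (g.weight e t.1.1 t.1.2 t.2.1 t.2.2)
    else [x.rest]

/-- A partial transition is extended as long as both weights are below the threshold. -/
def Node.Active {n : ℕ} (l : ℕ) (x : Node n) : Prop :=
  x.pos < n ∧ x.P.weight < l ∧ x.Q.weight < l

instance {n : ℕ} (l : ℕ) (x : Node n) : Decidable (x.Active l) :=
  inferInstanceAs (Decidable (_ ∧ _ ∧ _))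

/-- Both weights are at most the threshold. -/
def Node.Low {n : ℕ} (l : ℕ) (x : Node n) : Prop := x.P.weight ≤ l ∧ x.Q.weight ≤ l

instance {n : ℕ} (l : ℕ) (x : Node n) : Decidable (x.Low l) :=
  inferInstanceAs (Decidable (_ ∧ _))

/-- The children of a node in the search tree. -/
noncomputable def Node.children {n : ℕ} (δ e : ℂ) (gs : List (Gate n)) (l : ℕ) (x : Node n) :
    List (Node n) :=
  -- The stack returns the child pushed last first. So `rest`, the head of `extend`, is visited
  -- after its siblings, and its letter 0 clears what they wrote.
  if h : x.Active l then (x.extend δ e gs ⟨x.pos, h.1⟩).reverse else []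

/-- The leaves below a node in a search tree of height `m`, except those of too high weight. -/
noncomputable def Node.leaves {n : ℕ} (δ e : ℂ) (gs : List (Gate n)) (l : ℕ) :
    ℕ → Node n → List (Node n)
  | 0, x => if x.Low l then [x] else []
  -- A gate can add two letters at once, so a node that stops being active may have overshot the
  -- threshold; such leaves are dropped.
  | m + 1, x => if x.Active l then (x.children δ e gs l).flatMap (Node.leaves δ e gs l m)
      else if x.Low l then [x] else []

/-- The number of nodes of a search tree of height `m`. -/
noncomputable def Node.size {n : ℕ} (δ e : ℂ) (gs : List (Gate n)) (l : ℕ) : ℕ → Node n → ℕ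
  | 0, _ => 1
  | m + 1, x => 1 + ((x.children δ e gs l).map (Node.size δ e gs l m)).sum

/-- The letters that are still to be chosen are `0`. -/
def Node.Valid {n : ℕ} (gs : List (Gate n)) (x : Node n) : Prop :=
  ∀ i, x.pos ≤ (owner gs i).val → x.P i = 0 ∧ x.Q i = 0

lemma owner_of_none {n : ℕ} {gs : List (Gate n)} {j : Fin n} (h : gateOf gs j = none) :
    owner gs j = j := by simp [owner, h]

lemma owner_of_some {n : ℕ} {gs : List (Gate n)} {j : Fin n} {g : Gate n}
    (h : gateOf gs j = some g) : owner gs j = g.fst := by simp [owner, h]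

lemma owner_eq_iff_of_none {n : ℕ} {gs : List (Gate n)} (hd : DisjointGates gs) {i j : Fin n}
    (h : gateOf gs j = none) : owner gs i = j ↔ i = j := by
  constructor
  · intro hi
    cases hg : gateOf gs i with
    | none => rwa [owner_of_none hg] at hi
    | some g =>
      rw [owner_of_some hg] at hi
      rw [gateOf_eq_some hd (mem_of_gateOf hg).1 (Or.inl hi)] at h
      simp at h
  · rintro rfl
    exact owner_of_none h

lemma owner_eq_iff_of_fst {n : ℕ} {gs : List (Gate n)} (hd : DisjointGates gs) {i j : Fin n}
    {g : Gate n} (h : gateOf gs j = some g) (hj : g.fst = j) :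
    owner gs i = j ↔ i = j ∨ i = g.snd := by
  have hm := (mem_of_gateOf h).1
  constructor
  · intro hi
    cases hg : gateOf gs i with
    | none => rw [owner_of_none hg] at hi; exact Or.inl hi
    | some g' =>
      rw [owner_of_some hg] at hi
      rw [gateOf_eq_some hd (mem_of_gateOf hg).1 (Or.inl hi)] at h
      obtain rfl : g' = g := by simpa using h
      rcases (mem_of_gateOf hg).2 with h' | h'
      · exact Or.inl (h'.symm.trans hj)
      · exact Or.inr h'.symm
  · rintro (rfl | rfl)
    · rw [owner_of_some h, hj]
    · rw [owner_of_some (gateOf_eq_some hd hm (Or.inr rfl)), hj]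

lemma owner_ne_of_snd {n : ℕ} {gs : List (Gate n)} (hd : DisjointGates gs) {i j : Fin n}
    {g : Gate n} (h : gateOf gs j = some g) (hj : g.fst ≠ j) : owner gs i ≠ j := by
  intro hi
  cases hg : gateOf gs i with
  | none =>
    rw [owner_of_none hg] at hi
    rw [hi, h] at hg
    simp at hg
  | some g' =>
    rw [owner_of_some hg] at hi
    rw [gateOf_eq_some hd (mem_of_gateOf hg).1 (Or.inl hi)] at h
    obtain rfl : g' = g := by simpa using h
    exact hj hi

lemma Gate.weight_zero_left {n : ℕ} (g : Gate n) (e : ℂ) {q : Fin 4 × Fin 4} (hq : q ≠ 0) :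
    g.weight e 0 0 q.1 q.2 = 0 := by
  rw [Gate.weight, g.factor_zero_left, if_neg, mul_zero]
  rintro ⟨h1, h2⟩
  exact hq (Prod.ext h1 h2)

lemma Gate.weight_zero_right {n : ℕ} (g : Gate n) (e : ℂ) {p : Fin 4 × Fin 4} (hp : p ≠ 0) :
    g.weight e p.1 p.2 0 0 = 0 := by
  rw [Gate.weight, g.factor_zero_right, if_neg, mul_zero]
  rintro ⟨h1, h2⟩
  exact hp (Prod.ext h1 h2)

lemma Gate.weight_zero {n : ℕ} (g : Gate n) (e : ℂ) : g.weight e 0 0 0 0 = 1 := by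
  simp [Gate.weight, g.factor_zero_left, damp]

/-- A transition with nonzero amplitude keeps or changes non-identity letters, but neither
creates nor annihilates strings on the letters with a common owner. -/
lemma zero_iff_of_siteFactor_ne_zero {n : ℕ} {gs : List (Gate n)} (hd : DisjointGates gs)
    {δ e : ℂ} {P Q : Pauli n} {o : Fin n} (h : siteFactor δ e gs P Q o ≠ 0) :
    (∀ i, owner gs i = o → P i = 0) ↔ ∀ i, owner gs i = o → Q i = 0 := by
  cases hg : gateOf gs o with
  | none =>
    simp only [siteFactor, hg, ne_eq, ite_eq_right_iff, Classical.not_imp] at h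
    simp only [owner_eq_iff_of_none hd hg, forall_eq, h.1]
  | some g =>
    by_cases ho : g.fst = o
    · simp only [siteFactor, hg, ho, if_true] at h
      simp only [owner_eq_iff_of_fst hd hg ho, forall_eq_or_imp, forall_eq]
      constructor
      · rintro ⟨h1, h2⟩
        rw [h1, h2] at h
        by_contra hc
        exact h (g.weight_zero_left e (q := (Q o, Q g.snd)) (by simpa [Prod.ext_iff] using hc))
      · rintro ⟨h1, h2⟩
        rw [h1, h2] at h
        by_contra hc
        exact h (g.weight_zero_right e (p := (P o, P g.snd)) (by simpa [Prod.ext_iff] using hc))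
    · simp [owner_ne_of_snd hd hg ho]

/-! ### Contributions of partial transitions -/

/-- Letters that are chosen agree with those of the full strings `P` and `Q`. -/
def Node.Agree {n : ℕ} (gs : List (Gate n)) (x : Node n) (P Q : Pauli n) : Prop :=
  ∀ i, (owner gs i).val < x.pos → x.P i = P i ∧ x.Q i = Q i

open scoped Classical in
/-- The contribution of the transition from `P` to `Q` below a node. -/
noncomputable def Node.contrib {n : ℕ} (δ e : ℂ) (gs : List (Gate n)) (x : Node n)
    (P Q : Pauli n) : ℂ :=
  if x.Agree gs P Q then
    x.amp * ∏ i ∈ Finset.univ.filter (fun i : Fin n => x.pos ≤ i.val), siteFactor δ e gs P Q i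
  else 0

lemma agree_succ_iff {n : ℕ} {gs : List (Gate n)} {x y : Node n} {j : Fin n} (hj : x.pos = j.val)
    (hy : y.pos = x.pos + 1)
    (hP : ∀ i, (owner gs i).val < x.pos → y.P i = x.P i ∧ y.Q i = x.Q i) (P Q : Pauli n) :
    y.Agree gs P Q ↔ x.Agree gs P Q ∧ ∀ i, owner gs i = j → y.P i = P i ∧ y.Q i = Q i := by
  simp only [Node.Agree, hy]
  constructor
  · intro h
    refine ⟨fun i hi => ?_, fun i hi => h i (by rw [hi]; omega)⟩
    rw [← (hP i hi).1, ← (hP i hi).2]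
    exact h i (by omega)
  · rintro ⟨h1, h2⟩ i hi
    rcases Nat.lt_succ_iff_lt_or_eq.1 hi with h | h
    · rw [(hP i h).1, (hP i h).2]
      exact h1 i h
    · exact h2 i (Fin.ext (by omega))

lemma prod_siteFactor_succ {n : ℕ} (δ e : ℂ) (gs : List (Gate n)) (P Q : Pauli n) (j : Fin n) :
    ∏ i ∈ Finset.univ.filter (fun i : Fin n => j.val ≤ i.val), siteFactor δ e gs P Q i =
      siteFactor δ e gs P Q j *
        ∏ i ∈ Finset.univ.filter (fun i : Fin n => j.val + 1 ≤ i.val), siteFactor δ e gs P Q i := by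
  have : Finset.univ.filter (fun i : Fin n => j.val ≤ i.val) =
      insert j (Finset.univ.filter (fun i : Fin n => j.val + 1 ≤ i.val)) := by
    ext i
    simp only [Finset.mem_filter, Finset.mem_univ, true_and, Finset.mem_insert, Fin.ext_iff]
    omega
  rw [this, Finset.prod_insert (by simp)]

lemma setPair_of_ne {n : ℕ} (P : Pauli n) {i j k : Fin n} (a b : Fin 4) (h1 : i ≠ j)
    (h2 : i ≠ k) : setPair P j k a b i = P i := by
  simp [setPair, h1, h2]

lemma setPair_fst {n : ℕ} (P : Pauli n) (j k : Fin n) (a b : Fin 4) :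
    setPair P j k a b j = a := by simp [setPair]

lemma setPair_snd {n : ℕ} (P : Pauli n) {j k : Fin n} (h : k ≠ j) (a b : Fin 4) :
    setPair P j k a b k = b := by simp [setPair, h]

lemma sum_map_toList_ite {α : Type*} [DecidableEq α] (s : Finset α) (b : α) (f : α → ℂ) :
    (s.toList.map fun a => if a = b then f a else 0).sum = if b ∈ s then f b else 0 := by
  rw [Finset.sum_map_toList, Finset.sum_ite_eq']

open scoped Classical in
lemma Node.contrib_eq {n : ℕ} (δ e : ℂ) {gs : List (Gate n)} {x : Node n} {j : Fin n}
    (hj : x.pos = j.val) (P Q : Pauli n) :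
    x.contrib δ e gs P Q = if x.Agree gs P Q then x.amp * (siteFactor δ e gs P Q j *
      ∏ i ∈ Finset.univ.filter (fun i : Fin n => j.val + 1 ≤ i.val), siteFactor δ e gs P Q i)
    else 0 := by
  rw [Node.contrib, hj, prod_siteFactor_succ]

open scoped Classical in
lemma Node.contrib_of_agree {n : ℕ} (δ e : ℂ) {gs : List (Gate n)} {x y : Node n} {j : Fin n}
    (hj : x.pos = j.val) (hy : y.pos = x.pos + 1) {P Q : Pauli n} {c : Prop}
    (h : y.Agree gs P Q ↔ x.Agree gs P Q ∧ c) :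
    y.contrib δ e gs P Q = if x.Agree gs P Q ∧ c then y.amp *
      ∏ i ∈ Finset.univ.filter (fun i : Fin n => j.val + 1 ≤ i.val), siteFactor δ e gs P Q i
    else 0 := by
  rw [Node.contrib, hy, hj]
  simp only [h]

/-- At most one child agrees with `P` and `Q` at `j`, the one with letter `P j`, and its amplitude
gains the site factor. If `P j ≠ Q j`, no child agrees and the site factor is 0. -/
lemma Node.sum_extend_contrib_of_none {n : ℕ} (δ e : ℂ) {gs : List (Gate n)} (hd : DisjointGates gs)
    {x : Node n} (hx : x.Valid gs) {j : Fin n} (hj : x.pos = j.val) (hg : gateOf gs j = none) (P Q : Pauli n) :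
    ((x.extend δ e gs j).map fun y => y.contrib δ e gs P Q).sum = x.contrib δ e gs P Q := by
  classical
  have hrest := agree_succ_iff (gs := gs) (y := x.rest) hj rfl (fun i _ => ⟨rfl, rfl⟩) P Q
  rw [Node.contrib_eq δ e hj]
  have hrc := Node.contrib_of_agree δ e hj rfl hrest
  have hra : x.rest.amp = x.amp := rfl
  rw [hra] at hrc
  set R := ∏ i ∈ Finset.univ.filter (fun i : Fin n => j.val + 1 ≤ i.val),
    siteFactor δ e gs P Q i
  unfold Node.extend
  rw [hg]
  have hc : ∀ a, (x.child j j (a, 0) (a, 0) δ).contrib δ e gs P Q =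
      if a = P j then (if x.Agree gs P Q ∧ Q j = P j then x.amp * δ * R else 0) else 0 := by
    intro a
    have h1 := agree_succ_iff (gs := gs) (y := x.child j j (a, 0) (a, 0) δ) hj rfl (fun i hi => by
      have : i ≠ j := by
        rintro rfl
        rw [owner_of_none hg] at hi
        omega
      exact ⟨setPair_of_ne _ _ _ this this, setPair_of_ne _ _ _ this this⟩) P Q
    rw [Node.contrib_of_agree δ e hj rfl h1]
    simp only [owner_eq_iff_of_none hd hg, forall_eq, Node.child, setPair_fst]
    by_cases ha : a = P j
    · subst ha
      simp only [true_and, if_true, eq_comm (a := P j)]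
      rfl
    · simp [ha]
  simp only [List.map_cons, List.map_map, List.sum_cons, Function.comp_def, hc, hrc, letters]
  rw [sum_map_toList_ite]
  have hs : siteFactor δ e gs P Q j = if P j = Q j then damp δ (Q j) else 0 := by
    simp [siteFactor, hg]
  have hx0 := hx j (by rw [owner_of_none hg, hj])
  simp only [owner_eq_iff_of_none hd hg, forall_eq, Node.rest, hx0, hs, damp, Finset.mem_filter,
    Finset.mem_univ, true_and, eq_comm (a := (0 : Fin 4))]
  by_cases hA : x.Agree gs P Q <;> by_cases hP : P j = 0 <;> by_cases hQ : Q j = P j <;>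
    simp_all [eq_comm] 
  ring

/-- The children cover all choices except those with the identity on exactly one side, whose
amplitude is 0 by `Gate.weight_zero_left` and `Gate.weight_zero_right`. When both sides are the
identity, `rest` is the child that agrees, with factor 1. -/
lemma Node.sum_extend_contrib_of_fst {n : ℕ} (δ e : ℂ) {gs : List (Gate n)} (hd : DisjointGates gs)
    {x : Node n} (hx : x.Valid gs) {j : Fin n} (hj : x.pos = j.val) {g : Gate n}
    (hg : gateOf gs j = some g) (hf : g.fst = j) (P Q : Pauli n) :
    ((x.extend δ e gs j).map fun y => y.contrib δ e gs P Q).sum = x.contrib δ e gs P Q := by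
  classical
  have hrest := agree_succ_iff (gs := gs) (y := x.rest) hj rfl (fun i _ => ⟨rfl, rfl⟩) P Q
  rw [Node.contrib_eq δ e hj]
  have hrc := Node.contrib_of_agree δ e hj rfl hrest
  have hra : x.rest.amp = x.amp := rfl
  rw [hra] at hrc
  set R := ∏ i ∈ Finset.univ.filter (fun i : Fin n => j.val + 1 ≤ i.val),
    siteFactor δ e gs P Q i
  unfold Node.extend
  rw [hg]
  have hk : g.snd ≠ j := hf ▸ g.ne.symm
  have hoj : owner gs j = j := by rw [owner_of_some hg, hf]
  have hok : owner gs g.snd = j := (owner_eq_iff_of_fst hd hg hf).2 (Or.inr rfl)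
  have hc : ∀ t : (Fin 4 × Fin 4) × (Fin 4 × Fin 4),
      (x.child j g.snd t.1 t.2 (g.weight e t.1.1 t.1.2 t.2.1 t.2.2)).contrib δ e gs P Q =
      if t = ((P j, P g.snd), (Q j, Q g.snd)) then (if x.Agree gs P Q then
        x.amp * g.weight e t.1.1 t.1.2 t.2.1 t.2.2 * R else 0) else 0 := by
    intro t
    have h1 := agree_succ_iff (gs := gs)
      (y := x.child j g.snd t.1 t.2 (g.weight e t.1.1 t.1.2 t.2.1 t.2.2)) hj rfl (fun i hi => by
      have h1 : i ≠ j := by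
        rintro rfl
        rw [hoj] at hi
        omega
      have h2 : i ≠ g.snd := by
        rintro rfl
        rw [hok] at hi
        omega
      exact ⟨setPair_of_ne _ _ _ h1 h2, setPair_of_ne _ _ _ h1 h2⟩) P Q
    rw [Node.contrib_of_agree δ e hj rfl h1]
    simp only [owner_eq_iff_of_fst hd hg hf, forall_eq_or_imp, forall_eq, Node.child,
      setPair_fst, setPair_snd _ hk, Prod.ext_iff]
    rw [← ite_and]
    refine if_congr ?_ rfl rfl
    tauto
  have hs : siteFactor δ e gs P Q j = g.weight e (P j) (P g.snd) (Q j) (Q g.snd) := by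
    simp [siteFactor, hg, hf]
  simp only [hf, if_true, List.map_cons, List.map_map, List.sum_cons, Function.comp_def, hc, hrc,
    transitions]
  rw [sum_map_toList_ite]
  have hx0 := hx j (by rw [hoj, hj])
  have hx1 := hx g.snd (by rw [hok, hj])
  simp only [owner_eq_iff_of_fst hd hg hf, forall_eq_or_imp, forall_eq, Node.rest, hx0, hx1, hs,
    Finset.mem_filter, Finset.mem_univ, true_and, eq_comm (a := (0 : Fin 4))]
  by_cases hA : x.Agree gs P Q
  swap
  · simp [hA]
  by_cases hP : (P j, P g.snd) = 0 <;> by_cases hQ : (Q j, Q g.snd) = 0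
  · have h1 := Prod.ext_iff.1 hP
    have h2 := Prod.ext_iff.1 hQ
    simp only [Prod.fst_zero, Prod.snd_zero] at h1 h2
    simp [hA, h1.1, h1.2, h2.1, h2.2, g.weight_zero]
  · have h1 := Prod.ext_iff.1 hP
    simp only [Prod.fst_zero, Prod.snd_zero] at h1
    have h2 : ¬(Q j = 0 ∧ Q g.snd = 0) := fun h => hQ (Prod.ext h.1 h.2)
    have h3 : g.weight e 0 0 (Q j) (Q g.snd) = 0 := g.weight_zero_left e (q := (Q j, Q g.snd)) hQ
    have h4 : Q j = 0 → Q g.snd ≠ 0 := fun a b => h2 ⟨a, b⟩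
    simp [h1.1, h1.2, h3]
    exact fun _ a b => absurd b (h4 a)
  · have h1 := Prod.ext_iff.1 hQ
    simp only [Prod.fst_zero, Prod.snd_zero] at h1
    have h2 : ¬(P j = 0 ∧ P g.snd = 0) := fun h => hP (Prod.ext h.1 h.2)
    have h3 : g.weight e (P j) (P g.snd) 0 0 = 0 := g.weight_zero_right e (p := (P j, P g.snd)) hP
    have h4 : P j = 0 → P g.snd ≠ 0 := fun a b => h2 ⟨a, b⟩
    simp [h1.1, h1.2, h3]
    exact fun _ a b => absurd b (h4 a)
  · have h2 : ¬(P j = 0 ∧ P g.snd = 0) := fun h => hP (Prod.ext h.1 h.2)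
    rw [if_neg fun h => h2 ⟨h.2.1.1, h.2.2.1⟩, if_pos ⟨hP, hQ⟩, if_pos hA, if_pos hA]
    ring

/-- The second qubit of a gate owns no letters: its site factor is 1, and there is nothing to
choose. -/
lemma Node.sum_extend_contrib_of_snd {n : ℕ} (δ e : ℂ) {gs : List (Gate n)} (hd : DisjointGates gs)
    {x : Node n} {j : Fin n} (hj : x.pos = j.val) {g : Gate n}
    (hg : gateOf gs j = some g) (hf : g.fst ≠ j) (P Q : Pauli n) :
    ((x.extend δ e gs j).map fun y => y.contrib δ e gs P Q).sum = x.contrib δ e gs P Q := by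
  classical
  have hrest := agree_succ_iff (gs := gs) (y := x.rest) hj rfl (fun i _ => ⟨rfl, rfl⟩) P Q
  rw [Node.contrib_eq δ e hj]
  have hrc := Node.contrib_of_agree δ e hj rfl hrest
  have hra : x.rest.amp = x.amp := rfl
  rw [hra] at hrc
  set R := ∏ i ∈ Finset.univ.filter (fun i : Fin n => j.val + 1 ≤ i.val),
    siteFactor δ e gs P Q i
  unfold Node.extend
  rw [hg]
  have hs : siteFactor δ e gs P Q j = 1 := by simp [siteFactor, hg, hf]
  simp [hf, hrc, hs, owner_ne_of_snd hd hg hf]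

lemma Node.sum_extend_contrib {n : ℕ} (δ e : ℂ) {gs : List (Gate n)} (hd : DisjointGates gs)
    {x : Node n} (hx : x.Valid gs) {j : Fin n} (hj : x.pos = j.val) (P Q : Pauli n) :
    ((x.extend δ e gs j).map fun y => y.contrib δ e gs P Q).sum = x.contrib δ e gs P Q := by
  cases hg : gateOf gs j with
  | none => exact Node.sum_extend_contrib_of_none δ e hd hx hj hg P Q
  | some g =>
    by_cases hf : g.fst = j
    · exact Node.sum_extend_contrib_of_fst δ e hd hx hj hg hf P Q
    · exact Node.sum_extend_contrib_of_snd δ e hd hj hg hf P Q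

lemma Node.sum_children_contrib {n : ℕ} (δ e : ℂ) {gs : List (Gate n)} (hd : DisjointGates gs)
    {l : ℕ} {x : Node n} (hx : x.Valid gs) (ha : x.Active l) (P Q : Pauli n) :
    ((x.children δ e gs l).map fun y => y.contrib δ e gs P Q).sum = x.contrib δ e gs P Q := by
  rw [Node.children, dif_pos ha, List.map_reverse, List.sum_reverse]
  exact x.sum_extend_contrib δ e hd hx rfl P Q

lemma Pauli.eq_of_weight_le {n : ℕ} {P P' : Pauli n} (h : ∀ i, P i ≠ 0 → P i = P' i)
    (hw : P'.weight ≤ P.weight) : P = P' := by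
  have hs : (Finset.univ.filter fun j => P j ≠ 0) ⊆ Finset.univ.filter fun j => P' j ≠ 0 := by
    intro i hi
    simp only [Finset.mem_filter, Finset.mem_univ, true_and] at hi ⊢
    rwa [← h i hi]
  have he := Finset.eq_of_subset_of_card_le hs hw
  funext i
  by_cases hi : P i = 0
  · have : i ∉ Finset.univ.filter fun j => P' j ≠ 0 := by rw [← he]; simp [hi]
    simpa [hi, eq_comm] using this
  · exact h i hi

lemma Node.eq_of_agree {n : ℕ} {gs : List (Gate n)} {x : Node n} {P Q : Pauli n}
    (hA : x.Agree gs P Q) (hP : ∀ i, x.pos ≤ (owner gs i).val → x.P i = P i ∧ x.Q i = Q i) :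
    x.P = P ∧ x.Q = Q := by
  have h : ∀ i, x.P i = P i ∧ x.Q i = Q i := fun i =>
    (lt_or_ge (owner gs i).val x.pos).elim (hA i) (hP i)
  exact ⟨funext fun i => (h i).1, funext fun i => (h i).2⟩

/-- Stopping as soon as one weight reaches the threshold is safe. If, say, `x.P` has weight at least
`l`, the string `P` has no room for further letters, and then `zero_iff_of_siteFactor_ne_zero` rules
out further letters of `Q` as well. -/
lemma Node.eq_of_contrib_ne_zero {n : ℕ} {δ e : ℂ} {gs : List (Gate n)} (hd : DisjointGates gs)
    {l : ℕ} {x : Node n} (hx : x.Valid gs) (ha : ¬x.Active l) {P Q : Pauli n}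
    (hP : P.weight ≤ l) (hQ : Q.weight ≤ l) (h : x.contrib δ e gs P Q ≠ 0) :
    x.P = P ∧ x.Q = Q := by
  classical
  rw [Node.contrib, ite_ne_right_iff] at h
  obtain ⟨hA, h⟩ := h
  have hz : ∀ i, x.pos ≤ (owner gs i).val → siteFactor δ e gs P Q (owner gs i) ≠ 0 := by
    intro i hi
    exact Finset.prod_ne_zero_iff.1 (right_ne_zero_of_mul h) _ (by simpa using hi)
  have hPx : ∀ i, x.P i ≠ 0 → x.P i = P i := fun i hi => by
    refine (hA i ?_).1
    by_contra hc
    exact hi (hx i (not_lt.1 hc)).1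
  have hQx : ∀ i, x.Q i ≠ 0 → x.Q i = Q i := fun i hi => by
    refine (hA i ?_).2
    by_contra hc
    exact hi (hx i (not_lt.1 hc)).2
  refine Node.eq_of_agree hA fun i hi => ?_
  by_cases hw : x.P.weight < l
  · by_cases hw' : x.Q.weight < l
    · refine absurd ⟨lt_of_le_of_lt hi (owner gs i).2, hw, hw'⟩ ha
    · have hQe := Pauli.eq_of_weight_le hQx (hQ.trans (not_lt.1 hw'))
      have h1 := (zero_iff_of_siteFactor_ne_zero hd (hz i hi)).2 fun j hj => by
        rw [← hQe]; exact (hx j (by rw [hj]; exact hi)).2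
      rw [(hx i hi).1, h1 i rfl, hQe]
      exact ⟨rfl, rfl⟩
  · have hPe := Pauli.eq_of_weight_le hPx (hP.trans (not_lt.1 hw))
    have h1 := (zero_iff_of_siteFactor_ne_zero hd (hz i hi)).1 fun j hj => by
      rw [← hPe]; exact (hx j (by rw [hj]; exact hi)).1
    rw [(hx i hi).2, h1 i rfl, hPe]
    exact ⟨rfl, rfl⟩

lemma Node.contrib_self {n : ℕ} (δ e : ℂ) {gs : List (Gate n)} (hd : DisjointGates gs)
    {x : Node n} (hx : x.Valid gs) : x.contrib δ e gs x.P x.Q = x.amp := by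
  rw [Node.contrib, if_pos (show x.Agree gs x.P x.Q from fun i _ => ⟨rfl, rfl⟩), Finset.prod_eq_one, mul_one]
  intro i hi
  simp only [Finset.mem_filter, Finset.mem_univ, true_and] at hi
  cases hg : gateOf gs i with
  | none =>
    have := hx i (by rw [owner_of_none hg]; exact hi)
    simp [siteFactor, hg, this, damp]
  | some g =>
    simp only [siteFactor, hg]
    split_ifs with hf
    · have h1 := hx i (by rw [owner_of_some hg, hf]; exact hi)
      have h2 := hx g.snd (by
        rw [(owner_eq_iff_of_fst hd hg hf).2 (Or.inr rfl)]; exact hi)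
      rw [hf, h1.1, h1.2, h2.1, h2.2, g.weight_zero]
    · rfl

lemma Node.valid_of_mem_extend {n : ℕ} {δ e : ℂ} {gs : List (Gate n)} (hd : DisjointGates gs)
    {x y : Node n} (hx : x.Valid gs) {j : Fin n} (hj : x.pos = j.val)
    (hy : y ∈ x.extend δ e gs j) : y.Valid gs := by
  have hrest : x.rest.Valid gs := fun i hi => hx i (Nat.le_of_succ_le hi)
  unfold Node.extend at hy
  cases hg : gateOf gs j with
  | none =>
    simp only [hg, List.mem_cons, List.mem_map] at hy
    rcases hy with rfl | ⟨a, _, rfl⟩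
    · exact hrest
    · intro i hi
      have h1 : i ≠ j := by
        rintro rfl
        rw [owner_of_none hg] at hi
        simp only [Node.child] at hi
        omega
      simp only [Node.child, setPair_of_ne _ _ _ h1 h1]
      exact hx i (Nat.le_of_succ_le hi)
  | some g =>
    by_cases hf : g.fst = j
    · simp only [hg, hf, if_true, List.mem_cons, List.mem_map] at hy
      rcases hy with rfl | ⟨t, _, rfl⟩
      · exact hrest
      · intro i hi
        have ho : owner gs i ≠ j := by
          intro ho
          rw [ho] at hi
          simp only [Node.child] at hi
          omega
        rw [ne_eq, owner_eq_iff_of_fst hd hg hf, not_or] at ho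
        simp only [Node.child, setPair_of_ne _ _ _ ho.1 ho.2]
        exact hx i (Nat.le_of_succ_le hi)
    · simp only [hg, hf, if_false, List.mem_cons, List.not_mem_nil, or_false] at hy
      rw [hy]
      exact hrest

lemma Node.pos_of_mem_extend {n : ℕ} {δ e : ℂ} {gs : List (Gate n)} {x y : Node n} {j : Fin n}
    (hy : y ∈ x.extend δ e gs j) : y.pos = x.pos + 1 := by
  unfold Node.extend at hy
  split at hy
  · simp only [List.mem_cons, List.mem_map] at hy
    rcases hy with rfl | ⟨a, _, rfl⟩ <;> rfl
  · split_ifs at hy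
    · simp only [List.mem_cons, List.mem_map] at hy
      rcases hy with rfl | ⟨a, _, rfl⟩ <;> rfl
    · simp only [List.mem_cons, List.not_mem_nil, or_false] at hy
      rw [hy]; rfl

lemma Node.mem_children {n : ℕ} {δ e : ℂ} {gs : List (Gate n)} {l : ℕ} {x y : Node n} :
    y ∈ x.children δ e gs l ↔ ∃ h : x.Active l, y ∈ x.extend δ e gs ⟨x.pos, h.1⟩ := by
  rw [Node.children]
  split_ifs with h
  · simp [h]
  · simp [h]

open scoped Classical in
/-- Summing over the leaves below a node amounts to summing over all transitions between strings
of low weight. -/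
lemma Node.sum_leaves {n : ℕ} (δ e : ℂ) {gs : List (Gate n)} (hd : DisjointGates gs) (l : ℕ)
    (Φ : Pauli n → Pauli n → ℂ) (m : ℕ) {x : Node n} (hx : x.Valid gs) (hm : n ≤ x.pos + m) :
    ((x.leaves δ e gs l m).map fun y => y.amp * Φ y.P y.Q).sum =
      ∑ P : Pauli n, ∑ Q : Pauli n, if P.weight ≤ l ∧ Q.weight ≤ l then
        x.contrib δ e gs P Q * Φ P Q else 0 := by
  -- At a leaf the double sum collapses to the strings of the node itself, or to 0 if they are too
  -- heavy.
  have leaf : ∀ x : Node n, x.Valid gs → ¬x.Active l →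
      (((if x.Low l then [x] else []).map fun y => y.amp * Φ y.P y.Q).sum =
      ∑ P : Pauli n, ∑ Q : Pauli n, if P.weight ≤ l ∧ Q.weight ≤ l then
        x.contrib δ e gs P Q * Φ P Q else 0) := by
    intro x hx ha
    have h0 : ∀ P Q, (x.P ≠ P ∨ x.Q ≠ Q) → (if P.weight ≤ l ∧ Q.weight ≤ l then
        x.contrib δ e gs P Q * Φ P Q else 0) = 0 := by
      intro P Q hPQ
      split_ifs with hw
      · by_contra hc
        have := Node.eq_of_contrib_ne_zero hd hx ha hw.1 hw.2 (left_ne_zero_of_mul hc)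
        tauto
      · rfl
    rw [Finset.sum_eq_single x.P, Finset.sum_eq_single x.Q, Node.contrib_self δ e hd hx]
    · by_cases hl : x.Low l
      · rw [if_pos hl, if_pos (show x.P.weight ≤ l ∧ x.Q.weight ≤ l from hl)]
        simp
      · rw [if_neg hl, if_neg (show ¬(x.P.weight ≤ l ∧ x.Q.weight ≤ l) from hl)]
        simp
    · exact fun Q _ hQ => h0 _ _ (Or.inr hQ.symm)
    · simp
    · exact fun P _ hP => Finset.sum_eq_zero fun Q _ => h0 _ _ (Or.inl hP.symm)
    · simp
  induction m generalizing x with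
  | zero => exact leaf x hx fun ha => by have := ha.1; omega
  | succ m ih =>
    rw [Node.leaves]
    split_ifs with ha hl
    · rw [List.map_flatMap, List.flatMap, List.sum_flatten, List.map_map]
      simp only [Function.comp_def]
      have h1 : ∀ y ∈ x.children δ e gs l,
          ((y.leaves δ e gs l m).map fun y => y.amp * Φ y.P y.Q).sum =
          ∑ P : Pauli n, ∑ Q : Pauli n, if P.weight ≤ l ∧ Q.weight ≤ l then
            y.contrib δ e gs P Q * Φ P Q else 0 := fun y hy => by
        obtain ⟨_, hy⟩ := Node.mem_children.1 hy
        refine ih (Node.valid_of_mem_extend hd hx rfl hy) ?_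
        rw [Node.pos_of_mem_extend hy]
        omega
      rw [List.map_congr_left h1]
      have h2 : ∀ L : List (Node n), (L.map fun y => ∑ P : Pauli n, ∑ Q : Pauli n,
          if P.weight ≤ l ∧ Q.weight ≤ l then y.contrib δ e gs P Q * Φ P Q else 0).sum =
          ∑ P : Pauli n, ∑ Q : Pauli n, if P.weight ≤ l ∧ Q.weight ≤ l then
            (L.map fun y => y.contrib δ e gs P Q).sum * Φ P Q else 0 := by
        intro L
        induction L with
        | nil => simp
        | cons y L ihL =>
          rw [List.map_cons, List.sum_cons, ihL, ← Finset.sum_add_distrib]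
          refine Finset.sum_congr rfl fun P _ => ?_
          rw [← Finset.sum_add_distrib]
          refine Finset.sum_congr rfl fun Q _ => ?_
          rw [List.map_cons, List.sum_cons]
          split_ifs <;> ring
      rw [h2]
      simp only [Node.sum_children_contrib δ e hd hx ha]
    · have := leaf x hx ha
      rwa [if_pos hl] at this
    · have := leaf x hx ha
      rwa [if_neg hl] at this

/-! ### The size of the search tree -/

/-- Bound on the number of nodes of a search tree of height `m` with weight budget `r`, if all
but one child of every node use up some of the budget. -/
def treeBound (B : ℕ) : ℕ → ℕ → ℕ
  | 0, _ => 1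
  -- A node without budget is a leaf; following identity choices below it would cost another factor
  -- of order m.
  | _ + 1, 0 => 1
  | m + 1, r + 1 => 1 + treeBound B m (r + 1) + B * treeBound B m r

lemma treeBound_mono_succ (B m r : ℕ) : treeBound B m r ≤ treeBound B m (r + 1) := by
  induction m generalizing r with
  | zero => simp [treeBound]
  | succ m ih =>
    cases r with
    | zero => simp only [treeBound]; omega
    | succ r =>
      simp only [treeBound]
      have := Nat.mul_le_mul_left B (ih r)
      have := ih (r + 1)
      omega

lemma treeBound_mono (B m : ℕ) : Monotone (treeBound B m) :=
  monotone_nat_of_le_succ (treeBound_mono_succ B m)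

/-- The discrete form of integrating x^r: sums of m^r telescope to at most m^(r+1)/(r+1). The
divisor is what later makes the constant uniform in the threshold. -/
lemma pow_succ_add_le (r m : ℕ) : (m : ℝ) ^ (r + 1) + (r + 1) * (m : ℝ) ^ r ≤ (m + 1 : ℝ) ^ (r + 1) := by
  induction r with
  | zero => simp
  | succ r ih =>
    have h0 : (0 : ℝ) ≤ (m : ℝ) ^ r := by positivity
    have h1 := mul_le_mul_of_nonneg_right ih (show (0 : ℝ) ≤ m + 1 by positivity)
    have h2 : (m + 1 : ℝ) ^ (r + 1 + 1) = (m + 1 : ℝ) ^ (r + 1) * (m + 1) := pow_succ _ _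
    rw [h2]
    refine le_trans ?_ h1
    push_cast
    have : 0 ≤ (r + 1) * (m : ℝ) ^ r := by positivity
    ring_nf at this ⊢
    linarith

/-- The constants in the bound of `treeBound B m r` by a multiple of `m ^ r`. -/
noncomputable def treeConst (B : ℕ) : ℕ → ℝ
  | 0 => 1
  | r + 1 => 2 + B + B * treeConst B r / (r + 1)

lemma treeConst_nonneg (B r : ℕ) : 0 ≤ treeConst B r := by
  induction r with
  | zero => simp [treeConst]
  | succ r ih => rw [treeConst]; positivity

lemma treeBound_le (B r m : ℕ) (hm : 1 ≤ m) :
    (treeBound B m r : ℝ) ≤ treeConst B r * (m : ℝ) ^ r := by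
  induction r generalizing m with
  | zero =>
    obtain ⟨m, rfl⟩ := Nat.exists_eq_add_of_le' hm
    simp [treeBound, treeConst]
  | succ r ih =>
    set G := treeConst B r
    have hG : 0 ≤ G := treeConst_nonneg B r
    -- The recursion summed over the height: one node per level gives `m`, and the terms `B * G * m
    -- ^ r` telescope.
    have key : (treeBound B m (r + 1) : ℝ) ≤
        (1 + B) + m + B * G / (r + 1) * (m : ℝ) ^ (r + 1) := by
      induction m, hm using Nat.le_induction with
      | base =>
        have : (0 : ℝ) ≤ B * G / (r + 1) := by positivity
        have h : treeBound B 1 (r + 1) = 1 + 1 + B * 1 := rfl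
        rw [h]
        push_cast
        rw [one_pow]
        linarith
      | succ m hm ihm =>
        have h1 := ih m hm
        have h : treeBound B (m + 1) (r + 1) =
          1 + treeBound B m (r + 1) + B * treeBound B m r := rfl
        rw [h]
        push_cast
        have h2 : (B : ℝ) * treeBound B m r ≤ B * (G * (m : ℝ) ^ r) :=
          mul_le_mul_of_nonneg_left h1 (by positivity)
        have h3 := mul_le_mul_of_nonneg_left (pow_succ_add_le r m)
          (show (0 : ℝ) ≤ B * G / (r + 1) by positivity)
        have h4 : (B : ℝ) * G / (r + 1) * ((r + 1) * (m : ℝ) ^ r) = B * (G * (m : ℝ) ^ r) := by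
          field_simp
        rw [mul_add, h4] at h3
        linarith
    refine key.trans ?_
    rw [treeConst]
    have h1 : (1 : ℝ) ≤ m := by exact_mod_cast hm
    have h2 : (m : ℝ) ≤ (m : ℝ) ^ (r + 1) := le_self_pow₀ h1 (by omega)
    have h3 : (0 : ℝ) ≤ 1 + B := by positivity
    have h5 : (1 + B : ℝ) ≤ (1 + B) * (m : ℝ) ^ (r + 1) :=
      le_mul_of_one_le_right h3 (h1.trans h2)
    linarith

/-- From r + 1 ≥ 2B on, the next constant is at most 2 + B plus half the previous one, and 4 + 2B is
the fixed point of that map. The finitely many earlier constants are bounded by their sum. -/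
lemma exists_treeConst_le (B : ℕ) : ∃ K : ℝ, ∀ r, treeConst B r ≤ K := by
  refine ⟨∑ i ∈ Finset.range (2 * B + 1), treeConst B i + (4 + 2 * B), fun r => ?_⟩
  induction r with
  | zero =>
    have := Finset.single_le_sum (f := treeConst B) (fun i _ => treeConst_nonneg B i)
      (Finset.mem_range.2 (show 0 < 2 * B + 1 by omega))
    have hB : (0 : ℝ) ≤ B := by positivity
    linarith
  | succ r ih =>
    by_cases hr : r + 1 < 2 * B + 1
    · have := Finset.single_le_sum (f := treeConst B) (fun i _ => treeConst_nonneg B i)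
        (Finset.mem_range.2 hr)
      have hB : (0 : ℝ) ≤ B := by positivity
      linarith
    · have hS : 0 ≤ ∑ i ∈ Finset.range (2 * B + 1), treeConst B i :=
        Finset.sum_nonneg fun i _ => treeConst_nonneg B i
      have h1 : (2 * B : ℝ) ≤ r + 1 := by
        have : 2 * B ≤ r + 1 := by omega
        exact_mod_cast this
      have h2 : B * treeConst B r / (r + 1) ≤ treeConst B r / 2 := by
        rw [div_le_div_iff₀ (by positivity) (by norm_num)]
        nlinarith [treeConst_nonneg B r]
      rw [treeConst]
      linarith

/-- The size of the search tree is at most a universal multiple of `n ^ l`. -/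
lemma exists_treeBound_le (B : ℕ) : ∃ K : ℕ, ∀ m r, 1 ≤ m → treeBound B m r ≤ K * m ^ r := by
  obtain ⟨K, hK⟩ := exists_treeConst_le B
  refine ⟨⌈K⌉₊, fun m r hm => ?_⟩
  have h1 := treeBound_le B r m hm
  have h2 : treeConst B r * (m : ℝ) ^ r ≤ ⌈K⌉₊ * (m : ℝ) ^ r :=
    mul_le_mul_of_nonneg_right ((hK r).trans (Nat.le_ceil K)) (by positivity)
  exact_mod_cast h1.trans h2

/-- The case `j = k` is an idle qubit, treated as a pair with second letter 0 so that idle qubits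
and gates share one construction. -/
lemma Pauli.weight_setPair {n : ℕ} {P : Pauli n} {j k : Fin n} {a b : Fin 4} (hj : P j = 0)
    (hk : P k = 0) (h : j = k ∧ b = 0 ∨ j ≠ k) :
    (setPair P j k a b).weight =
      P.weight + ((if a = 0 then 0 else 1) + if b = 0 then 0 else 1) := by
  have key : ∀ (R : Pauli n) (i : Fin n) (c : Fin 4), R i = 0 →
      Pauli.weight (Function.update R i c : Pauli n) = R.weight + if c = 0 then 0 else 1 := by
    intro R i c hi
    split_ifs with hc
    · rw [hc, ← hi, Function.update_eq_self, add_zero]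
    · have : (Finset.univ.filter fun j => (Function.update R i c : Pauli n) j ≠ 0) =
          insert i (Finset.univ.filter fun j => R j ≠ 0) := by
        ext t
        by_cases ht : t = i
        · subst ht; simp [hc]
        · simp [ht]
      rw [Pauli.weight, this, Finset.card_insert_of_notMem (by simp [hi])]
      rfl
  have h1 : (Function.update P k b : Pauli n) j = 0 := by
    rcases h with ⟨rfl, hb⟩ | h
    · simp [hb]
    · simp [h, hj]
  rw [setPair, key _ _ _ h1, key _ _ _ hk]
  omega

/-- The number of children of a node that use up weight. -/
noncomputable def branching : ℕ := letters.length + transitions.length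

lemma mem_letters {a : Fin 4} : a ∈ letters ↔ a ≠ 0 := by simp [letters]

lemma mem_transitions {t : (Fin 4 × Fin 4) × (Fin 4 × Fin 4)} :
    t ∈ transitions ↔ t.1 ≠ 0 ∧ t.2 ≠ 0 := by simp [transitions]

/-- The remaining weight budget at a node. -/
def Node.budget {n : ℕ} (l : ℕ) (x : Node n) : ℕ := min (l - x.P.weight) (l - x.Q.weight)

/-- Every child except `rest` adds a non-identity letter to both strings, so the smaller of the two
remaining budgets drops by at least one. -/
lemma Node.size_le {n : ℕ} (δ e : ℂ) {gs : List (Gate n)} (hd : DisjointGates gs) (l m : ℕ)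
    {x : Node n} (hx : x.Valid gs) :
    x.size δ e gs l m ≤ treeBound branching m (x.budget l) := by
  induction m generalizing x with
  | zero => simp [Node.size, treeBound]
  | succ m ih =>
    rw [Node.size]
    by_cases ha : x.Active l
    swap
    · rw [Node.children, dif_neg ha]
      have : treeBound branching (m + 1) 0 = 1 := rfl
      exact le_trans (by simp [this]) (treeBound_mono branching (m + 1) (Nat.zero_le _))
    obtain ⟨r, hr⟩ : ∃ r, x.budget l = r + 1 := by
      refine Nat.exists_eq_succ_of_ne_zero ?_
      have := ha.2
      simp only [Node.budget]
      omega
    rw [hr, treeBound, Node.children, dif_pos ha, List.map_reverse, List.sum_reverse]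
    have hval : ∀ y ∈ x.extend δ e gs ⟨x.pos, ha.1⟩, y.Valid gs :=
      fun y hy => Node.valid_of_mem_extend hd hx rfl hy
    have hrest : x.rest ∈ x.extend δ e gs ⟨x.pos, ha.1⟩ →
        x.rest.size δ e gs l m ≤ treeBound branching m (r + 1) := fun h => by
      have := ih (hval _ h)
      rwa [show x.rest.budget l = r + 1 from hr] at this
    have hlist : ∀ L : List (Node n), (∀ y ∈ L, y.Valid gs ∧ y.budget l ≤ r) →
        L.length ≤ branching →
        (L.map (Node.size δ e gs l m)).sum ≤ branching * treeBound branching m r := by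
      intro L hL hlen
      have h1 : (L.map (Node.size δ e gs l m)).sum ≤
          (L.map (Node.size δ e gs l m)).length • treeBound branching m r :=
        List.sum_le_card_nsmul _ _ fun s hs => by
          obtain ⟨y, hy, rfl⟩ := List.mem_map.1 hs
          exact (ih (hL y hy).1).trans (treeBound_mono _ _ (hL y hy).2)
      rw [List.length_map, smul_eq_mul] at h1
      exact h1.trans (Nat.mul_le_mul_right _ hlen)
    have hcons : ∀ L, x.extend δ e gs ⟨x.pos, ha.1⟩ = x.rest :: L →
        (∀ y ∈ L, y.budget l ≤ r) → L.length ≤ branching →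
        1 + ((x.extend δ e gs ⟨x.pos, ha.1⟩).map (Node.size δ e gs l m)).sum ≤
          1 + treeBound branching m (r + 1) + branching * treeBound branching m r := by
      intro L hL hb hlen
      rw [hL] at hrest hval ⊢
      have h1 := hrest (by simp)
      have h2 := hlist L (fun y hy => ⟨hval y (by simp [hy]), hb y hy⟩) hlen
      rw [List.map_cons, List.sum_cons]
      omega
    simp only [Node.budget] at hr
    cases hg : gateOf gs ⟨x.pos, ha.1⟩ with
    | none =>
      refine hcons (letters.map fun a => x.child ⟨x.pos, ha.1⟩ ⟨x.pos, ha.1⟩ (a, 0) (a, 0) δ) ?_ ?_ ?_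
      · simp only [Node.extend, hg]
      · intro y hy
        obtain ⟨a, hma, rfl⟩ := List.mem_map.1 hy
        have h0 := hx ⟨x.pos, ha.1⟩ (by rw [owner_of_none hg])
        have h1 := mem_letters.1 hma
        simp only [Node.budget, Node.child]
        rw [Pauli.weight_setPair h0.1 h0.1 (Or.inl ⟨rfl, rfl⟩),
          Pauli.weight_setPair h0.2 h0.2 (Or.inl ⟨rfl, rfl⟩)]
        simp only [h1, if_false, if_true]
        omega
      · simp [branching]
    | some g =>
      by_cases hf : g.fst = ⟨x.pos, ha.1⟩
      · refine hcons (transitions.map fun t =>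
          x.child ⟨x.pos, ha.1⟩ g.snd t.1 t.2 (g.weight e t.1.1 t.1.2 t.2.1 t.2.2)) ?_ ?_ ?_
        · simp only [Node.extend, hg, hf, if_true]
        · intro y hy
          obtain ⟨t, ht, rfl⟩ := List.mem_map.1 hy
          have h1 := mem_transitions.1 ht
          have ho := fun i => owner_eq_iff_of_fst (i := i) hd hg hf
          have h0 := hx ⟨x.pos, ha.1⟩ (by rw [(ho _).2 (Or.inl rfl)])
          have h0' := hx g.snd (by rw [(ho _).2 (Or.inr rfl)])
          have hne : (⟨x.pos, ha.1⟩ : Fin n) ≠ g.snd := hf ▸ g.ne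
          simp only [Node.budget, Node.child]
          rw [Pauli.weight_setPair h0.1 h0'.1 (Or.inr hne),
            Pauli.weight_setPair h0.2 h0'.2 (Or.inr hne)]
          have h2 : ∀ p : Fin 4 × Fin 4, p ≠ 0 →
              1 ≤ (if p.1 = 0 then 0 else 1) + if p.2 = 0 then 0 else 1 := by
            intro p hp
            by_cases h1 : p.1 = 0 <;> by_cases h2 : p.2 = 0 <;> simp_all [Prod.ext_iff]
          have := h2 _ h1.1
          have := h2 _ h1.2
          omega
        · simp [branching]
      · refine hcons [] ?_ (by simp) (by simp)
        simp only [Node.extend, hg, hf, if_false]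

/-! ### The effect of the depth-first search on the memory -/

/-- The part of the memory that the search reads and writes apart from its stack: the letters of
the current string, and the coefficients. -/
abbrev Memory := (ℕ → ℕ) × (ℕ → ℂ)

/-- The letters of a Pauli string as an array. -/
def Pauli.array {n : ℕ} (P : Pauli n) (i : ℕ) : ℕ := if h : i < n then (P ⟨i, h⟩).val else 0

lemma readPauli_array {n : ℕ} (P : Pauli n) : readPauli n P.array = P := by
  funext j
  simp only [readPauli, Pauli.array, j.2, dif_pos]
  exact Fin.ofNat_val_eq_self (P j)

/-- Entering a node: its letter is recorded, and a leaf of low weight contributes `amp * val` to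
the coefficient at address `dst`. -/
noncomputable def Node.enter {n : ℕ} (l : ℕ) (dst : Pauli n → Pauli n → ℕ)
    (val : Pauli n → Pauli n → Memory → ℂ) (x : Node n) (a : Memory) : Memory :=
  -- At the root the subtraction is truncated, and its letter 0 goes to address 0, where it does no
  -- harm.
  let g := Function.update a.1 (x.pos - 1) x.letter.val
  if x.Active l then (g, a.2)
  else if x.Low l then
    (g, Function.update a.2 (dst x.P x.Q) (a.2 (dst x.P x.Q) + x.amp * val x.P x.Q (g, a.2)))
  else (g, a.2)

/-- Depth-first search below a node. -/
noncomputable def Node.search {n : ℕ} (δ e : ℂ) (gs : List (Gate n)) (l : ℕ)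
    (dst : Pauli n → Pauli n → ℕ) (val : Pauli n → Pauli n → Memory → ℂ) :
    ℕ → Node n → Memory → Memory
  | 0, x, a => x.enter l dst val a
  | m + 1, x, a =>
    (x.children δ e gs l).foldl (fun a y => Node.search δ e gs l dst val m y a)
      (x.enter l dst val a)

lemma Node.enter_fst {n : ℕ} (l : ℕ) (dst : Pauli n → Pauli n → ℕ)
    (val : Pauli n → Pauli n → Memory → ℂ) (x : Node n) (a : Memory) :
    (x.enter l dst val a).1 = Function.update a.1 (x.pos - 1) x.letter.val := by
  rw [Node.enter]
  split_ifs <;> rfl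

lemma Node.extend_eq_cons {n : ℕ} (δ e : ℂ) (gs : List (Gate n)) (x : Node n) (j : Fin n) :
    ∃ L, x.extend δ e gs j = x.rest :: L := by
  unfold Node.extend
  split
  · exact ⟨_, rfl⟩
  · split_ifs
    · exact ⟨_, rfl⟩
    · exact ⟨_, rfl⟩

/-- The search leaves no letters behind. -/
lemma Node.search_fst {n : ℕ} (δ e : ℂ) (gs : List (Gate n)) (l : ℕ)
    (dst : Pauli n → Pauli n → ℕ) (val : Pauli n → Pauli n → Memory → ℂ) (m : ℕ) (x : Node n)
    (a : Memory) (h0 : x.pos = 0 → x.letter = 0) (ha : ∀ i, x.pos ≤ i → a.1 i = 0) :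
    (x.search δ e gs l dst val m a).1 = Function.update a.1 (x.pos - 1) x.letter.val := by
  induction m generalizing x a with
  | zero => exact x.enter_fst l dst val a
  | succ m ih =>
    rw [Node.search, Node.children]
    split_ifs with hact
    swap
    · exact x.enter_fst l dst val a
    have henter := x.enter_fst l dst val a
    set b := x.enter l dst val a
    have hb : ∀ i, x.pos ≤ i → b.1 i = 0 := by
      intro i hi
      rw [henter, Function.update_apply]
      split_ifs with hi'
      · rw [h0 (by omega)]; rfl
      · exact ha i hi
    obtain ⟨L, hL⟩ := x.extend_eq_cons δ e gs ⟨x.pos, hact.1⟩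
    -- The last child is `rest`; it resets the only address that its siblings leave changed.
    rw [hL, List.reverse_cons, List.foldl_append, List.foldl_cons, List.foldl_nil]
    have hfold : ∀ (M : List (Node n)) (c : Memory), (∀ y ∈ M, y.pos = x.pos + 1) →
        (∀ i, i ≠ x.pos → c.1 i = b.1 i) → ∀ i, i ≠ x.pos →
          (M.foldl (fun a y => Node.search δ e gs l dst val m y a) c).1 i = b.1 i := by
      intro M
      induction M with
      | nil => exact fun c _ hc => hc
      | cons y M ihM =>
        intro c hM hc
        have hy := hM y (by simp)
        rw [List.foldl_cons]
        refine ihM _ (fun z hz => hM z (by simp [hz])) fun i hi => ?_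
        rw [ih y c (by omega) fun i hi => ?_]
        · rw [hy, Nat.add_sub_cancel, Function.update_of_ne hi, hc i hi]
        · rw [hc i (by omega), hb i (by omega)]
    have hmem : ∀ y ∈ L.reverse, y.pos = x.pos + 1 := fun y hy =>
      Node.pos_of_mem_extend (δ := δ) (e := e) (gs := gs) (j := ⟨x.pos, hact.1⟩)
        (by rw [hL]; simp at hy; simp [hy])
    have h1 := hfold L.reverse b hmem fun i _ => rfl
    rw [ih _ _ (fun h => absurd h (Nat.succ_ne_zero _)) fun i hi => ?_]
    · rw [← henter]
      funext i
      have hp : x.rest.pos - 1 = x.pos := rfl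
      rw [hp, Function.update_apply]
      split_ifs with hi
      · rw [hi, hb _ le_rfl]; rfl
      · exact h1 i hi
    · have hi' : x.pos + 1 ≤ i := hi
      rw [h1 i (by omega), hb i (by omega)]

/-- The letters array shows the string of a node upon entering it. -/
def Node.Shows {n : ℕ} (x : Node n) (g : ℕ → ℕ) : Prop :=
  Function.update g (x.pos - 1) x.letter.val = x.P.array

/-- Over an empty layer each child sets one letter, so the array is always complete. A gate would
also set the letter of its second qubit, which the array does not record; but coefficients of `O`
and ρ are queried only in searches over the empty layer. -/
lemma Node.shows_of_mem_extend_nil {n : ℕ} {δ e : ℂ} {x y : Node n} (hx : x.Valid [])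
    {j : Fin n} (hj : x.pos = j.val) (hy : y ∈ x.extend δ e [] j) {g : ℕ → ℕ}
    (hg : ∀ i, i ≠ x.pos → g i = x.P.array i) : y.Shows g := by
  have hx0 : x.P j = 0 := (hx j (by rw [owner_of_none rfl, hj])).1
  have hg0 : gateOf ([] : List (Gate n)) j = none := rfl
  simp only [Node.extend, hg0, List.mem_cons, List.mem_map] at hy
  have key : ∀ (P : Pauli n) (a : Fin 4), P j = a → (∀ i, i ≠ j → P i = x.P i) →
      Function.update g x.pos a.val = P.array := by
    intro P a ha hP
    funext i
    rw [Function.update_apply]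
    split_ifs with hi
    · subst hi
      simp [Pauli.array, hj, ha]
    · rw [hg i hi]
      simp only [Pauli.array]
      split_ifs with h
      · rw [hP]
        intro h'
        exact hi (by rw [hj, ← h'])
      · rfl
  rcases hy with rfl | ⟨a, _, rfl⟩
  · exact key x.P 0 hx0 fun _ _ => rfl
  · exact key _ a (setPair_fst _ _ _ _ _) fun i hi => setPair_of_ne _ _ _ hi hi

/-- The search adds the contributions of all leaves. -/
lemma Node.search_snd {n : ℕ} (δ e : ℂ) {gs : List (Gate n)} (hd : DisjointGates gs) (l : ℕ)
    (dst : Pauli n → Pauli n → ℕ) (val : Pauli n → Pauli n → Memory → ℂ) (b : ℕ) (c₀ : ℕ → ℂ)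
    (V : Pauli n → Pauli n → ℂ) (hdst : ∀ P Q, b ≤ dst P Q)
    (hval : ∀ P Q (a : Memory), (∀ i < b, a.2 i = c₀ i) → (gs = [] → a.1 = P.array) →
      P.weight ≤ l → val P Q a = V P Q)
    (m : ℕ) (x : Node n) (a : Memory) (hx : x.Valid gs) (hm : n ≤ x.pos + m)
    (h0 : x.pos = 0 → x.letter = 0)
    (ha : ∀ i, x.pos ≤ i → a.1 i = 0) (hg : gs = [] → x.Shows a.1) (hc : ∀ i < b, a.2 i = c₀ i) :
    (x.search δ e gs l dst val m a).2 = fun i => a.2 i +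
      ((x.leaves δ e gs l m).map fun y =>
        y.amp * (if dst y.P y.Q = i then V y.P y.Q else 0)).sum := by
  have leaf : ∀ (x : Node n) (a : Memory), ¬x.Active l → (gs = [] → x.Shows a.1) →
      (∀ i < b, a.2 i = c₀ i) →
      (x.enter l dst val a).2 = fun i => a.2 i +
        ((if x.Low l then [x] else []).map fun y =>
          y.amp * (if dst y.P y.Q = i then V y.P y.Q else 0)).sum := by
    intro x a hact hg hc
    rw [Node.enter]
    simp only [if_neg hact]
    split_ifs with hl
    · funext i
      rw [hval x.P x.Q (Function.update a.1 (x.pos - 1) x.letter.val, a.2) hc hg hl.1]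
      simp only [List.map_cons, List.map_nil, List.sum_cons, List.sum_nil, add_zero,
        Function.update_apply]
      by_cases hi : i = dst x.P x.Q
      · simp [hi]
      · simp [hi, Ne.symm hi]
    · simp
  induction m generalizing x a with
  | zero => exact leaf x a (fun h => by have := h.1; omega) hg hc
  | succ m ih =>
    rw [Node.leaves]
    by_cases hact : x.Active l
    swap
    · rw [if_neg hact, ← leaf x a hact hg hc, Node.search, Node.children, dif_neg hact]
      rfl
    rw [if_pos hact, Node.search]
    have henter := x.enter_fst l dst val a
    have henter2 : (x.enter l dst val a).2 = a.2 := by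
      rw [Node.enter]; simp only [if_pos hact]
    set a' := x.enter l dst val a with ha'
    have hb : ∀ i, x.pos ≤ i → a'.1 i = 0 := by
      intro i hi
      rw [henter, Function.update_apply]
      split_ifs with hi'
      · rw [h0 (by omega)]; rfl
      · exact ha i hi
    have hshow : gs = [] → a'.1 = x.P.array := fun h => by rw [henter]; exact hg h
    -- Siblings leave the letters correct except at `x.pos`, which the next one overwrites.
    -- Addresses below `b` stay as they were because all additions go to addresses from `b` on;
    -- hence `val` sees the same data throughout.
    have hfold : ∀ (M : List (Node n)) (a : Memory),
        (∀ y ∈ M, y ∈ x.extend δ e gs ⟨x.pos, hact.1⟩) →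
        (∀ i, i ≠ x.pos → a.1 i = a'.1 i) → (∀ i < b, a.2 i = c₀ i) →
        (M.foldl (fun a y => Node.search δ e gs l dst val m y a) a).2 = fun i => a.2 i +
          ((M.flatMap (Node.leaves δ e gs l m)).map fun y =>
            y.amp * (if dst y.P y.Q = i then V y.P y.Q else 0)).sum := by
      intro M
      induction M with
      | nil => intro a _ _ _; simp
      | cons y M ihM =>
        intro a hM h1 h2
        have hy := hM y (by simp)
        have hpos := Node.pos_of_mem_extend hy
        have hzero : ∀ i, y.pos ≤ i → a.1 i = 0 := fun i hi => by
          rw [h1 i (by omega), hb i (by omega)]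
        have hs1 := Node.search_fst δ e gs l dst val m y a (by omega) hzero
        have hs2 := ih y a (Node.valid_of_mem_extend hd hx rfl hy) (by omega) (by omega) hzero
          (by
            rintro rfl
            exact Node.shows_of_mem_extend_nil hx rfl hy fun i hi => by
              rw [h1 i hi, hshow rfl]) h2
        rw [List.foldl_cons, ihM _ (fun z hz => hM z (by simp [hz])) (fun i hi => by
          rw [hs1, hpos, Nat.add_sub_cancel, Function.update_of_ne hi, h1 i hi]) (fun i hi => by
          rw [hs2]
          simp only
          rw [h2 i hi, List.sum_eq_zero, add_zero]
          intro v hv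
          obtain ⟨z, _, rfl⟩ := List.mem_map.1 hv
          have := hdst z.P z.Q
          rw [if_neg (by omega), mul_zero])]
        rw [hs2]
        funext i
        rw [List.flatMap_cons, List.map_append, List.sum_append]
        ring
    rw [hfold _ a' (fun y hy => by
      obtain ⟨_, h⟩ := Node.mem_children.1 hy
      exact h) (fun _ _ => rfl) (by rwa [henter2]), henter2]

/-- The empty partial transition. -/
def Node.root (n : ℕ) : Node n := ⟨0, 0, 0, 1, 0⟩

lemma Node.root_valid {n : ℕ} (gs : List (Gate n)) : (Node.root n).Valid gs :=
  fun _ _ => ⟨rfl, rfl⟩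

/-- The search from the empty partial transition evaluates a sum over all transitions between
strings of low weight. -/
theorem Node.search_root {n : ℕ} (δ e : ℂ) {gs : List (Gate n)} (hd : DisjointGates gs) (l : ℕ)
    (dst : Pauli n → Pauli n → ℕ) (val : Pauli n → Pauli n → Memory → ℂ) (b : ℕ) (c₀ : ℕ → ℂ)
    (V : Pauli n → Pauli n → ℂ) (hdst : ∀ P Q, b ≤ dst P Q)
    (hval : ∀ P Q (a : Memory), (∀ i < b, a.2 i = c₀ i) → (gs = [] → a.1 = P.array) →
      P.weight ≤ l → val P Q a = V P Q) :
    (Node.root n).search δ e gs l dst val n (0, c₀) = (0, fun i => c₀ i +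
      ∑ P : Pauli n, ∑ Q : Pauli n, if P.weight ≤ l ∧ Q.weight ≤ l then
        (∏ j, siteFactor δ e gs P Q j) * (if dst P Q = i then V P Q else 0) else 0) := by
  have harr : (0 : Pauli n).array = 0 := by
    funext i
    simp [Pauli.array]
  have hroot : ∀ P Q : Pauli n, (Node.root n).contrib δ e gs P Q = ∏ j, siteFactor δ e gs P Q j := by
    intro P Q
    rw [Node.contrib, if_pos]
    · simp [Node.root]
    · intro i hi
      simp [Node.root] at hi
  refine Prod.ext ?_ ?_
  · rw [Node.search_fst _ _ _ _ _ _ _ _ _ (fun _ => rfl) (fun _ _ => rfl)]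
    funext i
    simp [Node.root, Function.update_apply]
  · rw [Node.search_snd δ e hd l dst val b c₀ V hdst hval n _ _ (Node.root_valid gs)
      (by simp) (fun _ => rfl) (fun _ _ => rfl) (fun _ => ?_) (fun _ _ => rfl)]
    · funext i
      simp only
      rw [Node.sum_leaves δ e hd l (fun P Q => if dst P Q = i then V P Q else 0) n
        (Node.root_valid gs) (by simp)]
      congr 1
      refine Finset.sum_congr rfl fun P _ => Finset.sum_congr rfl fun Q _ => ?_
      rw [hroot]
    · change Function.update (0 : ℕ → ℕ) 0 0 = (0 : Pauli n).array
      rw [harr]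
      funext i
      simp [Function.update_apply]

/-! ### Executing programs -/

/-- Programs without loops. -/
def Prog.LoopFree : Prog → Prop
  | seq p q => p.LoopFree ∧ q.LoopFree
  | ite _ p q => p.LoopFree ∧ q.LoopFree
  | .while _ _ => False
  | _ => True

/-- The effect of a loop-free program. -/
noncomputable def Prog.run {n : ℕ} (I : Instance n) : Prog → Store → Store
  | skip, s => s
  | setWord x e, s => { s with word := Function.update s.word x (e.eval I s) }
  | setNum x e, s => { s with num := Function.update s.num x (e.eval I s) }
  | putWord a i e, s => { s with wordArr := putAt s.wordArr a (i.eval I s) (e.eval I s) }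
  | putNum a i e, s => { s with numArr := putAt s.numArr a (i.eval I s) (e.eval I s) }
  | seq p q, s => q.run I (p.run I s)
  | ite b p q, s => if b.eval I s ≠ 0 then p.run I s else q.run I s
  | .while _ _, s => s

/-- The largest number of steps of a loop-free program. -/
def Prog.bound : Prog → ℕ
  | skip => 1
  | setWord _ e => e.cost + 1
  | setNum _ e => e.cost + 1
  | putWord _ i e => i.cost + e.cost + 1
  | putNum _ i e => i.cost + e.cost + 1
  | seq p q => p.bound + q.bound
  | ite b p q => b.cost + 1 + (p.bound + q.bound)
  | .while _ _ => 0

/-- The program takes the first memory to the second one in at most `T` steps. -/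
def Runs {n : ℕ} (I : Instance n) (p : Prog) (s s' : Store) (T : ℕ) : Prop :=
  ∃ t ≤ T, Exec I p s s' t

lemma Prog.LoopFree.runs {n : ℕ} (I : Instance n) {p : Prog} (hp : p.LoopFree) (s : Store) :
    Runs I p s (p.run I s) p.bound := by
  induction p generalizing s with
  | skip => exact ⟨_, le_rfl, Exec.skip s⟩
  | setWord x e => exact ⟨_, le_rfl, Exec.setWord x e s⟩
  | setNum x e => exact ⟨_, le_rfl, Exec.setNum x e s⟩
  | putWord a i e => exact ⟨_, le_rfl, Exec.putWord a i e s⟩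
  | putNum a i e => exact ⟨_, le_rfl, Exec.putNum a i e s⟩
  | seq p q ihp ihq =>
    obtain ⟨t₁, h₁, e₁⟩ := ihp hp.1 s
    obtain ⟨t₂, h₂, e₂⟩ := ihq hp.2 (p.run I s)
    exact ⟨_, add_le_add h₁ h₂, e₁.seq e₂⟩
  | ite b p q ihp ihq =>
    by_cases hb : b.eval I s = 0
    · obtain ⟨t, h, e⟩ := ihq hp.2 s
      rw [Prog.run, if_neg (not_not.2 hb)]
      exact ⟨_, by rw [Prog.bound]; omega, Exec.iteFalse hb e⟩
    · obtain ⟨t, h, e⟩ := ihp hp.1 s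
      rw [Prog.run, if_pos hb]
      exact ⟨_, by rw [Prog.bound]; omega, Exec.iteTrue hb e⟩
  | _ => exact absurd hp (by simp [Prog.LoopFree])

lemma Runs.seq {n : ℕ} {I : Instance n} {p q : Prog} {s₁ s₂ s₃ : Store} {T₁ T₂ : ℕ}
    (h₁ : Runs I p s₁ s₂ T₁) (h₂ : Runs I q s₂ s₃ T₂) : Runs I (p.seq q) s₁ s₃ (T₁ + T₂) := by
  obtain ⟨t₁, h₁, e₁⟩ := h₁
  obtain ⟨t₂, h₂, e₂⟩ := h₂
  exact ⟨_, add_le_add h₁ h₂, e₁.seq e₂⟩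

lemma Runs.mono {n : ℕ} {I : Instance n} {p : Prog} {s s' : Store} {T T' : ℕ}
    (h : Runs I p s s' T) (hT : T ≤ T') : Runs I p s s' T' := by
  obtain ⟨t, h, e⟩ := h
  exact ⟨t, h.trans hT, e⟩

lemma Runs.whileDone {n : ℕ} {I : Instance n} {b : WExpr} {p : Prog} {s : Store}
    (h : b.eval I s = 0) : Runs I (.while b p) s s (b.cost + 1) :=
  ⟨_, le_rfl, Exec.whileDone h⟩

lemma Runs.whileStep {n : ℕ} {I : Instance n} {b : WExpr} {p : Prog} {s₁ s₂ s₃ : Store}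
    {T₁ T₂ : ℕ} (h : b.eval I s₁ ≠ 0) (h₁ : Runs I p s₁ s₂ T₁)
    (h₂ : Runs I (.while b p) s₂ s₃ T₂) : Runs I (.while b p) s₁ s₃ (b.cost + 1 + T₁ + T₂) := by
  obtain ⟨t₁, h₁, e₁⟩ := h₁
  obtain ⟨t₂, h₂, e₂⟩ := h₂
  exact ⟨_, by omega, Exec.whileStep h e₁ e₂⟩

/-- The loop body, run as long as the test succeeds, takes the first memory to the second one in
the given number of iterations. -/
inductive Iterates {n : ℕ} (I : Instance n) (b : WExpr) (p : Prog) : ℕ → Store → Store → Prop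
  | refl (s : Store) : Iterates I b p 0 s s
  | step {k : ℕ} {s s' : Store} : b.eval I s ≠ 0 → Iterates I b p k (p.run I s) s' →
      Iterates I b p (k + 1) s s'

lemma Iterates.trans {n : ℕ} {I : Instance n} {b : WExpr} {p : Prog} {k k' : ℕ}
    {s₁ s₂ s₃ : Store} (h : Iterates I b p k s₁ s₂) (h' : Iterates I b p k' s₂ s₃) :
    Iterates I b p (k + k') s₁ s₃ := by
  induction h with
  | refl s => rwa [zero_add]
  | step hb _ ih =>
    rw [Nat.add_right_comm]
    exact Iterates.step hb (ih h')

lemma Iterates.runs {n : ℕ} {I : Instance n} {b : WExpr} {p : Prog} (hp : p.LoopFree) {k : ℕ}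
    {s s' : Store} (h : Iterates I b p k s s') (hb : b.eval I s' = 0) :
    Runs I (.while b p) s s' (k * (b.cost + 1 + p.bound) + (b.cost + 1)) := by
  induction h with
  | refl s => simpa using Runs.whileDone hb
  | step hb' _ ih =>
    refine (Runs.whileStep hb' (hp.runs I _) (ih hb)).mono (le_of_eq ?_)
    ring

/-- A sequence of programs. -/
def Prog.seqs : List Prog → Prog
  | [] => .skip
  | p :: ps => .seq p (Prog.seqs ps)

lemma Prog.loopFree_seqs {ps : List Prog} (h : ∀ p ∈ ps, p.LoopFree) :
    (Prog.seqs ps).LoopFree := by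
  induction ps with
  | nil => trivial
  | cons p ps ih => exact ⟨h p (by simp), ih fun q hq => h q (by simp [hq])⟩

/-! ### Addresses of Pauli strings -/

/-- The number of a Pauli string, with its letters as digits in base `4`. -/
def Pauli.code {n : ℕ} (P : Pauli n) : ℕ := ∑ i, (P i).val * 4 ^ i.val

lemma Pauli.code_eq {n : ℕ} (P : Pauli n) : P.code = (finFunctionFinEquiv P).val := by
  rw [finFunctionFinEquiv_apply, Pauli.code]

lemma Pauli.code_injective {n : ℕ} : Function.Injective (Pauli.code (n := n)) := by
  intro P Q h
  rw [Pauli.code_eq, Pauli.code_eq] at h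
  exact finFunctionFinEquiv.injective (Fin.ext h)

lemma Pauli.code_lt {n : ℕ} (P : Pauli n) : P.code < 4 ^ n := by
  rw [Pauli.code_eq]
  exact (finFunctionFinEquiv P).2

lemma Pauli.code_zero {n : ℕ} : (0 : Pauli n).code = 0 := by simp [Pauli.code]

lemma Pauli.weight_zero {n : ℕ} : (0 : Pauli n).weight = 0 := by simp [Pauli.weight]

lemma Pauli.code_update {n : ℕ} {P : Pauli n} {i : Fin n} (a : Fin 4) (hi : P i = 0) :
    Pauli.code (Function.update P i a : Pauli n) = P.code + a.val * 4 ^ i.val := by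
  rw [Pauli.code, Pauli.code, ← Finset.add_sum_erase _ _ (Finset.mem_univ i),
    ← Finset.add_sum_erase _ (fun j => (P j).val * 4 ^ j.val) (Finset.mem_univ i)]
  have : ∑ j ∈ Finset.univ.erase i, ((Function.update P i a : Pauli n) j).val * 4 ^ j.val =
      ∑ j ∈ Finset.univ.erase i, (P j).val * 4 ^ j.val :=
    Finset.sum_congr rfl fun j hj => by rw [Function.update_of_ne (Finset.ne_of_mem_erase hj)]
  rw [this, Function.update_self, hi]
  simp only [Fin.val_zero]
  omega

lemma Pauli.code_setPair {n : ℕ} {P : Pauli n} {j k : Fin n} {a b : Fin 4} (hj : P j = 0)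
    (hk : P k = 0) (h : j = k ∧ b = 0 ∨ j ≠ k) :
    (setPair P j k a b).code = P.code + (a.val * 4 ^ j.val + b.val * 4 ^ k.val) := by
  have h1 : (Function.update P k b : Pauli n) j = 0 := by
    rcases h with ⟨rfl, hb⟩ | h
    · simp [hb]
    · simp [h, hj]
  rw [setPair, Pauli.code_update _ h1, Pauli.code_update _ hk]
  omega

/-! ### Expressions -/

/-- A literal multiple of a word. -/
def WExpr.times : ℕ → WExpr → WExpr
  | 0, _ => .lit 0
  | k + 1, e => .add (WExpr.times k e) e

lemma WExpr.eval_times {n : ℕ} (I : Instance n) (s : Store) (k : ℕ) (e : WExpr) :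
    (WExpr.times k e).eval I s = k * e.eval I s := by
  induction k with
  | zero => simp [WExpr.times, WExpr.eval]
  | succ k ih => simp only [WExpr.times, WExpr.eval, ih]; ring

/-- A sum of numbers. -/
def NExpr.sum : List NExpr → NExpr
  | [] => .rat 0
  | e :: es => .add e (NExpr.sum es)

lemma NExpr.eval_sum {n : ℕ} (I : Instance n) (s : Store) (es : List NExpr) :
    (NExpr.sum es).eval I s = (es.map (NExpr.eval I s)).sum := by
  induction es with
  | nil => simp [NExpr.sum, NExpr.eval]
  | cons e es ih => simp [NExpr.sum, NExpr.eval, ih]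

/-- A sum over a finite type. -/
noncomputable def NExpr.sumOver {ι : Type} [Fintype ι] (e : ι → NExpr) : NExpr :=
  NExpr.sum (Finset.univ.toList.map e)

lemma NExpr.eval_sumOver {n : ℕ} (I : Instance n) (s : Store) {ι : Type} [Fintype ι]
    (e : ι → NExpr) : (NExpr.sumOver e).eval I s = ∑ i, (e i).eval I s := by
  rw [NExpr.sumOver, NExpr.eval_sum, List.map_map]
  exact Finset.sum_map_toList _ _

/-- An entry of a single-qubit Pauli matrix. -/
def NExpr.pauli (a : Fin 4) (i j : Fin 2) : NExpr :=
  if a = 0 then .rat (if i = j then 1 else 0)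
  else if a = 1 then .rat (if i = j then 0 else 1)
  else if a = 2 then .mul (.rat (if i = j then 0 else if i = 0 then -1 else 1)) .imag
  else .rat (if i = j then (if i = 0 then 1 else -1) else 0)

lemma NExpr.eval_pauli {n : ℕ} (I : Instance n) (s : Store) (a : Fin 4) (i j : Fin 2) :
    (NExpr.pauli a i j).eval I s = pauli1 a i j := by
  fin_cases a <;> fin_cases i <;> fin_cases j <;> simp [NExpr.pauli, NExpr.eval, pauli1]

/-- The entry of the matrix of the gate whose layer and index are in word registers `3` and
`14`. -/
def NExpr.gateEntry (r c : Fin 2 × Fin 2) : NExpr :=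
  .entry (.reg 3) (.reg 14) (.lit (2 * r.1.val + r.2.val)) (.lit (2 * c.1.val + c.2.val))

lemma Gate.entry_eq {n : ℕ} (g : Gate n) (r c : Fin 2 × Fin 2) :
    g.entry (2 * r.1.val + r.2.val) (2 * c.1.val + c.2.val) =
      (g.mat : Matrix (Fin 2 × Fin 2) (Fin 2 × Fin 2) ℂ) r c := by
  have h : ∀ r : Fin 2 × Fin 2, 2 * r.1.val + r.2.val < 4 ∧
      (Fin.ofNat 2 ((2 * r.1.val + r.2.val) / 2), Fin.ofNat 2 (2 * r.1.val + r.2.val)) = r := by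
    decide
  rw [Gate.entry, if_pos ⟨(h r).1, (h c).1⟩, (h r).2, (h c).2]

/-- The damping factor of a letter. -/
def NExpr.damp (q : Fin 4) : NExpr := if q = 0 then .rat 1 else .damping

-- The amplitude as a fixed sum of 256 products of matrix entries. Unrolled into one expression, it
-- costs a constant number of steps per child.
open scoped Kronecker in
lemma Gate.factor_eq_sum {n : ℕ} (g : Gate n) (p₁ p₂ q₁ q₂ : Fin 4) :
    g.factor p₁ p₂ q₁ q₂ = ((1 / 4 : ℚ) : ℂ) * ∑ a : Fin 2 × Fin 2, ∑ d : Fin 2 × Fin 2,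
      ∑ c : Fin 2 × Fin 2, ∑ b : Fin 2 × Fin 2,
      star ((g.mat : Matrix (Fin 2 × Fin 2) (Fin 2 × Fin 2) ℂ) b a) *
        (pauli1 p₁ b.1 c.1 * pauli1 p₂ b.2 c.2) *
        (g.mat : Matrix (Fin 2 × Fin 2) (Fin 2 × Fin 2) ℂ) c d *
        (pauli1 q₁ d.1 a.1 * pauli1 q₂ d.2 a.2) := by
  have h : ((1 / 4 : ℚ) : ℂ) = 1 / 4 := by norm_num
  rw [Gate.factor, h, div_eq_mul_one_div, mul_comm]
  congr 1
  simp only [Matrix.trace, Matrix.diag, Matrix.mul_apply, Matrix.conjTranspose_apply,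
    Matrix.kroneckerMap_apply, Finset.sum_mul]

/-- The damped transition amplitude of the gate whose layer and index are in word registers `3`
and `14`. -/
noncomputable def NExpr.gateWeight (p q : Fin 4 × Fin 4) : NExpr :=
  .mul (.mul (NExpr.damp q.1) (NExpr.damp q.2)) (.mul (.rat (1 / 4))
    (NExpr.sumOver fun a : Fin 2 × Fin 2 => NExpr.sumOver fun d : Fin 2 × Fin 2 =>
      NExpr.sumOver fun c : Fin 2 × Fin 2 => NExpr.sumOver fun b : Fin 2 × Fin 2 =>
        .mul (.mul (.mul (.conj (NExpr.gateEntry b a))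
          (.mul (NExpr.pauli p.1 b.1 c.1) (NExpr.pauli p.2 b.2 c.2))) (NExpr.gateEntry c d))
          (.mul (NExpr.pauli q.1 d.1 a.1) (NExpr.pauli q.2 d.2 a.2))))

lemma NExpr.eval_gateWeight {n : ℕ} (I : Instance n) (s : Store) {g : Gate n}
    (hg : I.circuit.gate? (s.word 3) (s.word 14) = some g) (p q : Fin 4 × Fin 4) :
    (NExpr.gateWeight p q).eval I s = g.weight (Real.exp (-I.γ)) p.1 p.2 q.1 q.2 := by
  have he : ∀ r c, (NExpr.gateEntry r c).eval I s =
      (g.mat : Matrix (Fin 2 × Fin 2) (Fin 2 × Fin 2) ℂ) r c := fun r c => by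
    simp [NExpr.gateEntry, NExpr.eval, WExpr.eval, hg, Gate.entry_eq]
  have hd : ∀ q, (NExpr.damp q).eval I s = GateNoise.damp (Real.exp (-I.γ)) q := fun q => by
    rw [NExpr.damp, GateNoise.damp]
    split_ifs <;> simp [NExpr.eval]
  rw [Gate.weight, Gate.factor_eq_sum]
  simp only [NExpr.gateWeight, NExpr.eval, NExpr.eval_sumOver, NExpr.eval_pauli, he, hd]

/-! ### Access to the gates -/

/-- The gates of layer `t`, if there is one. -/
def gatesAt {n : ℕ} (C : Circuit n) (t : ℕ) : List (Gate n) :=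
  match C[t]? with
  | none => []
  | some L => L.gates

lemma disjointGates_gatesAt {n : ℕ} (C : Circuit n) (t : ℕ) : DisjointGates (gatesAt C t) := by
  rw [gatesAt]
  split
  · exact List.Pairwise.nil
  · exact Layer.disjoint _

/-- The machine looks gates up by index, the search by value; both return the first gate in the list
that contains the qubit. -/
lemma gateAt_eq {n : ℕ} (C : Circuit n) (t : ℕ) (j : Fin n) :
    (C.gateAt t j = 0 ∧ gateOf (gatesAt C t) j = none) ∨
      ∃ i g, C.gateAt t j = i + 1 ∧ C.gate? t i = some g ∧ gateOf (gatesAt C t) j = some g := by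
  rw [Circuit.gateAt, gatesAt]
  cases hC : C[t]? with
  | none => exact Or.inl ⟨rfl, rfl⟩
  | some L =>
    simp only
    have hp : (fun g : Gate n => decide (g.fst.val = j.val ∨ g.snd.val = j.val)) =
        fun g => decide (g.fst = j ∨ g.snd = j) := by
      funext g
      simp [Fin.ext_iff]
    rw [hp]
    cases hi : L.gates.findIdx? fun g => decide (g.fst = j ∨ g.snd = j) with
    | none =>
      refine Or.inl ⟨rfl, ?_⟩
      rw [List.findIdx?_eq_none_iff] at hi
      rw [gateOf, List.find?_eq_none]
      intro g hg
      simp [hi g hg]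
    | some i =>
      rw [List.findIdx?_eq_some_iff_getElem] at hi
      obtain ⟨hl, h1, h2⟩ := hi
      refine Or.inr ⟨i, L.gates[i], rfl, ?_, ?_⟩
      · simp [Circuit.gate?, hC, hl]
      · rw [gateOf, List.find?_eq_some_iff_getElem]
        exact ⟨h1, i, hl, rfl, fun k hk => by simpa using h2 k hk⟩

/-! ### The search program

Word registers: `0` number of qubits, `2` threshold, `3` layer, `4` and `5` base addresses of the
old and new coefficients, `6` the number of Pauli strings, `7` loop counter, `8` height of the
stack, `9` to `13` position, codes and weights of the current node, `14` gate, `15` second qubit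
of the gate, `16` and `17` powers of `4`. Number registers: `1` amplitude of the current node,
`2` damping of idle qubits. Word arrays: `0` letters, `1` powers of `4`, `2` to `7` positions,
codes, weights and letters on the stack. Number arrays: `0` coefficients, `1` amplitudes on the
stack. -/

/-- The number of non-identity letters in a pair. -/
def pairWeight (p : Fin 4 × Fin 4) : ℕ := (if p.1 = 0 then 0 else 1) + if p.2 = 0 then 0 else 1

/-- Push a child of the current node. -/
def Prog.push (p q : Fin 4 × Fin 4) (f : NExpr) : Prog :=
  .seqs [.putWord 2 (.reg 8) (.add (.reg 9) (.lit 1)),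
    .putWord 3 (.reg 8) (.add (.reg 10) (.add (.times p.1.val (.reg 16)) (.times p.2.val (.reg 17)))),
    .putWord 4 (.reg 8) (.add (.reg 11) (.add (.times q.1.val (.reg 16)) (.times q.2.val (.reg 17)))),
    .putWord 5 (.reg 8) (.add (.reg 12) (.lit (pairWeight p))),
    .putWord 6 (.reg 8) (.add (.reg 13) (.lit (pairWeight q))),
    .putWord 7 (.reg 8) (.lit p.1.val),
    .putNum 1 (.reg 8) (.mul (.reg 1) f),
    .setWord 8 (.add (.reg 8) (.lit 1))]

/-- Push the child with the same strings. -/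
def Prog.pushRest : Prog := .push 0 0 (.rat 1)

/-- Push the children at an idle qubit. -/
noncomputable def Prog.pushIdle : Prog :=
  .seqs (.pushRest :: letters.map fun a => .push (a, 0) (a, 0) (.reg 2))

/-- Push the children at the first qubit of a gate. -/
noncomputable def Prog.pushGate : Prog :=
  .seqs (.pushRest :: transitions.map fun t => .push t.1 t.2 (.gateWeight t.1 t.2))

/-- Push the children of the current node. -/
noncomputable def Prog.expand : Prog :=
  .seqs [.setWord 14 (.gateAt (.reg 3) (.reg 9)),
    .setWord 16 (.get 1 (.reg 9)),
    .ite (.reg 14)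
      (.seqs [.setWord 14 (.sub (.reg 14) (.lit 1)),
        .setWord 15 (.gateSnd (.reg 3) (.reg 14)),
        .setWord 17 (.get 1 (.reg 15)),
        -- The two truncated differences add up to a distance, nonzero exactly when the current
        -- qubit is not the first one of its gate.
        .ite (.add (.sub (.gateFst (.reg 3) (.reg 14)) (.reg 9))
            (.sub (.reg 9) (.gateFst (.reg 3) (.reg 14))))
          .pushRest .pushGate])
      .pushIdle]

/-- Pop a node and record its letter. -/
def Prog.pop : Prog :=
  .seqs [.setWord 8 (.sub (.reg 8) (.lit 1)),
    .setWord 9 (.get 2 (.reg 8)),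
    .setWord 10 (.get 3 (.reg 8)),
    .setWord 11 (.get 4 (.reg 8)),
    .setWord 12 (.get 5 (.reg 8)),
    .setWord 13 (.get 6 (.reg 8)),
    .setNum 1 (.get 1 (.reg 8)),
    .putWord 0 (.sub (.reg 9) (.lit 1)) (.get 7 (.reg 8))]

/-- Test whether the current node is not extended. -/
def WExpr.leafTest : WExpr :=
  .add (.add (.sub (.lit 1) (.sub (.reg 0) (.reg 9))) (.sub (.lit 1) (.sub (.reg 2) (.reg 12))))
    (.sub (.lit 1) (.sub (.reg 2) (.reg 13)))

/-- Test whether a weight of the current node is above the threshold. -/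
def WExpr.highTest : WExpr := .add (.sub (.reg 12) (.reg 2)) (.sub (.reg 13) (.reg 2))

/-- Add `amp * val` to the coefficient at address `dst`. -/
def Prog.visit (dst : WExpr) (val : NExpr) : Prog :=
  .putNum 0 dst (.add (.get 0 dst) (.mul (.reg 1) val))

/-- One iteration of the search. -/
noncomputable def Prog.searchBody (dst : WExpr) (val : NExpr) : Prog :=
  .seq .pop (.ite .leafTest (.ite .highTest .skip (.visit dst val)) .expand)

/-- Push the root of the search tree. -/
def Prog.pushRoot : Prog :=
  .seqs [.putWord 2 (.lit 0) (.lit 0), .putWord 3 (.lit 0) (.lit 0), .putWord 4 (.lit 0) (.lit 0),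
    .putWord 5 (.lit 0) (.lit 0), .putWord 6 (.lit 0) (.lit 0), .putWord 7 (.lit 0) (.lit 0),
    .putNum 1 (.lit 0) (.rat 1), .setWord 8 (.lit 1)]

/-- Depth-first search of all transitions between strings of low weight. -/
noncomputable def Prog.search (dst : WExpr) (val : NExpr) : Prog :=
  .seq .pushRoot (.while (.reg 8) (.searchBody dst val))

/-! ### Loop invariants of the search program -/

/-- The stack holds the given nodes, the top of the stack first. -/
def StackAt {n : ℕ} (s : Store) : List (Node n) → Prop
  | [] => True
  | x :: σ => s.wordArr 2 σ.length = x.pos ∧ s.wordArr 3 σ.length = x.P.code ∧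
      s.wordArr 4 σ.length = x.Q.code ∧ s.wordArr 5 σ.length = x.P.weight ∧
      s.wordArr 6 σ.length = x.Q.weight ∧ s.wordArr 7 σ.length = x.letter.val ∧
      s.numArr 1 σ.length = x.amp ∧ StackAt s σ

lemma StackAt.congr {n : ℕ} {s s' : Store} {σ : List (Node n)} (h : StackAt s σ)
    (hw : ∀ a, 2 ≤ a → a ≤ 7 → ∀ i < σ.length, s'.wordArr a i = s.wordArr a i)
    (hn : ∀ i < σ.length, s'.numArr 1 i = s.numArr 1 i) : StackAt s' σ := by
  induction σ with
  | nil => trivial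
  | cons x σ ih =>
    obtain ⟨h1, h2, h3, h4, h5, h6, h7, h8⟩ := h
    have hl : σ.length < (x :: σ).length := by simp
    refine ⟨?_, ?_, ?_, ?_, ?_, ?_, ?_, ih h8 (fun a ha ha' i hi => hw a ha ha' i (hi.trans hl))
      fun i hi => hn i (hi.trans hl)⟩
    · rw [hw 2 (by omega) (by omega) _ hl, h1]
    · rw [hw 3 (by omega) (by omega) _ hl, h2]
    · rw [hw 4 (by omega) (by omega) _ hl, h3]
    · rw [hw 5 (by omega) (by omega) _ hl, h4]
    · rw [hw 6 (by omega) (by omega) _ hl, h5]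
    · rw [hw 7 (by omega) (by omega) _ hl, h6]
    · rw [hn _ hl, h7]

/-- While the children of a node are pushed, only the stack changes. -/
structure Pushing {n : ℕ} (s₁ : Store) (σ : List (Node n)) (s : Store) : Prop where
  word : ∀ r, r ≠ 8 → s.word r = s₁.word r
  num : s.num = s₁.num
  shown : s.wordArr 0 = s₁.wordArr 0
  pow : s.wordArr 1 = s₁.wordArr 1
  coeff : s.numArr 0 = s₁.numArr 0
  top : s.word 8 = σ.length
  stack : StackAt s σ

/-- The child that `Prog.push` pushes. -/
structure IsChild {n : ℕ} (I : Instance n) (s₁ : Store) (p q : Fin 4 × Fin 4) (f : NExpr)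
    (y : Node n) : Prop where
  pos : y.pos = s₁.word 9 + 1
  codeP : y.P.code = s₁.word 10 + (p.1.val * s₁.word 16 + p.2.val * s₁.word 17)
  codeQ : y.Q.code = s₁.word 11 + (q.1.val * s₁.word 16 + q.2.val * s₁.word 17)
  weightP : y.P.weight = s₁.word 12 + pairWeight p
  weightQ : y.Q.weight = s₁.word 13 + pairWeight q
  letter : y.letter = p.1
  -- The factor is evaluated only after earlier siblings have been pushed, so it may depend only on
  -- registers that pushing preserves.
  amp : ∀ s : Store, (∀ r, r ≠ 8 → s.word r = s₁.word r) → s.num = s₁.num →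
    y.amp = s₁.num 1 * f.eval I s

lemma Pushing.push {n : ℕ} {I : Instance n} {s₁ s : Store} {σ : List (Node n)}
    (h : Pushing s₁ σ s) {p q : Fin 4 × Fin 4} {f : NExpr} {y : Node n}
    (hy : IsChild I s₁ p q f y) : Pushing s₁ (y :: σ) ((Prog.push p q f).run I s) := by
  have h9 := h.word 9 (by norm_num)
  have h10 := h.word 10 (by norm_num)
  have h11 := h.word 11 (by norm_num)
  have h12 := h.word 12 (by norm_num)
  have h13 := h.word 13 (by norm_num)
  have h16 := h.word 16 (by norm_num)
  have h17 := h.word 17 (by norm_num)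
  have h8 := h.top
  simp only [Prog.push, Prog.seqs, Prog.run, WExpr.eval, WExpr.eval_times, NExpr.eval, h8, h9, h10,
    h11, h12, h13, h16, h17]
  refine ⟨fun r hr => ?_, h.num, ?_, ?_, ?_, ?_, ?_, ?_, ?_, ?_, ?_, ?_, ?_, ?_⟩
  · simp only [Function.update_of_ne hr]
    exact h.word r hr
  · simpa [putAt] using h.shown
  · simpa [putAt] using h.pow
  · simpa [putAt] using h.coeff
  · simp
  · simp [putAt, hy.pos]
  · simp [putAt, hy.codeP]
  · simp [putAt, hy.codeQ]
  · simp [putAt, hy.weightP]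
  · simp [putAt, hy.weightQ]
  · simp [putAt, hy.letter]
  · simp only [putAt, Function.update_self]
    rw [hy.amp _ ?_ ?_, ← h.num]
    · exact h.word
    · exact h.num
  · refine h.stack.congr (fun a h2 h7 i hi => ?_) fun i hi => ?_
    · have hi' : i ≠ σ.length := hi.ne
      interval_cases a <;> simp [putAt, hi']
    · simp [putAt, hi.ne]

lemma Pushing.seqs {n : ℕ} {I : Instance n} {s₁ : Store} {ι : Type*} {p q : ι → Fin 4 × Fin 4}
    {f : ι → NExpr} {y : ι → Node n} (L : List ι)
    (hy : ∀ a ∈ L, IsChild I s₁ (p a) (q a) (f a) (y a)) {σ : List (Node n)} {s : Store}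
    (h : Pushing s₁ σ s) :
    Pushing s₁ ((L.map y).reverse ++ σ)
      ((Prog.seqs (L.map fun a => Prog.push (p a) (q a) (f a))).run I s) := by
  induction L generalizing σ s with
  | nil => exact h
  | cons a L ih =>
    have := ih (fun b hb => hy b (by simp [hb])) (h.push (hy a (by simp)))
    simpa [Prog.seqs, Prog.run] using this

/-- The registers describe the current node. -/
structure Current {n : ℕ} (x : Node n) (s : Store) : Prop where
  pos : s.word 9 = x.pos
  codeP : s.word 10 = x.P.code
  codeQ : s.word 11 = x.Q.code
  weightP : s.word 12 = x.P.weight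
  weightQ : s.word 13 = x.Q.weight
  amp : s.num 1 = x.amp

/-- The input of the search program. -/
structure SearchInput {n : ℕ} (l : ℕ) (δ : ℂ) (s : Store) : Prop where
  qubits : s.word 0 = n
  threshold : s.word 2 = l
  pow : ∀ j < n, s.wordArr 1 j = 4 ^ j
  idle : s.num 2 = δ

lemma Current.isChild_rest {n : ℕ} (I : Instance n) {x : Node n} {s : Store} (h : Current x s) :
    IsChild I s 0 0 (.rat 1) x.rest where
  pos := by rw [h.pos]; rfl
  codeP := by simp [h.codeP, Node.rest]
  codeQ := by simp [h.codeQ, Node.rest]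
  weightP := by simp [h.weightP, Node.rest, pairWeight]
  weightQ := by simp [h.weightQ, Node.rest, pairWeight]
  letter := rfl
  amp := fun s' _ _ => by simp [h.amp, Node.rest, NExpr.eval]

/-- At an idle qubit, register 17 may hold a stale power of 4; it is multiplied by the second
letter, which is 0. -/
lemma Current.isChild {n : ℕ} {I : Instance n} {x : Node n} {s : Store} (h : Current x s)
    {j k : Fin n} {p q : Fin 4 × Fin 4} {f : NExpr} {v : ℂ} (hP : x.P j = 0 ∧ x.P k = 0)
    (hQ : x.Q j = 0 ∧ x.Q k = 0) (hjk : j = k ∧ p.2 = 0 ∧ q.2 = 0 ∨ j ≠ k)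
    (h16 : s.word 16 = 4 ^ j.val) (h17 : j ≠ k → s.word 17 = 4 ^ k.val)
    (hf : ∀ s' : Store, (∀ r, r ≠ 8 → s'.word r = s.word r) → s'.num = s.num → f.eval I s' = v) :
    IsChild I s p q f (x.child j k p q v) where
  pos := by rw [h.pos]; rfl
  codeP := by
    rw [Node.child, Pauli.code_setPair hP.1 hP.2 (by tauto), h.codeP, h16]
    rcases hjk with ⟨_, h0, _⟩ | hjk
    · simp [h0]
    · rw [h17 hjk]
  codeQ := by
    rw [Node.child, Pauli.code_setPair hQ.1 hQ.2 (by tauto), h.codeQ, h16]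
    rcases hjk with ⟨_, _, h0⟩ | hjk
    · simp [h0]
    · rw [h17 hjk]
  weightP := by rw [Node.child, Pauli.weight_setPair hP.1 hP.2 (by tauto), h.weightP, pairWeight]
  weightQ := by rw [Node.child, Pauli.weight_setPair hQ.1 hQ.2 (by tauto), h.weightQ, pairWeight]
  letter := rfl
  amp := fun s' hw hn => by rw [hf s' hw hn, h.amp]; rfl

/-- The state of the search program with the given stack and memory. -/
structure Searching {n : ℕ} (s₀ : Store) (σ : List (Node n)) (a : Memory) (s : Store) : Prop where
  word : ∀ r < 8, s.word r = s₀.word r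
  idle : s.num 2 = s₀.num 2
  pow : s.wordArr 1 = s₀.wordArr 1
  shown : s.wordArr 0 = a.1
  coeff : s.numArr 0 = a.2
  top : s.word 8 = σ.length
  stack : StackAt s σ

/-- Registers that describe the gate at the current node may change before pushing. -/
lemma Searching.pushing {n : ℕ} {s₀ s s₁ s₂ : Store} {σ τ : List (Node n)} {a : Memory}
    (h : Searching s₀ σ a s) (hw : ∀ r < 8, s₁.word r = s.word r) (hn : s₁.num = s.num)
    (hwa : s₁.wordArr = s.wordArr) (hna : s₁.numArr = s.numArr) (hp : Pushing s₁ τ s₂) :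
    Searching s₀ τ a s₂ where
  word := fun r hr => by rw [hp.word r (by omega), hw r hr, h.word r hr]
  idle := by rw [hp.num, hn, h.idle]
  pow := by rw [hp.pow, hwa, h.pow]
  shown := by rw [hp.shown, hwa, h.shown]
  coeff := by rw [hp.coeff, hna, h.coeff]
  top := hp.top
  stack := hp.stack

lemma Pushing.start {n : ℕ} {s₀ s s₁ : Store} {σ : List (Node n)} {a : Memory}
    (h : Searching s₀ σ a s) (hw : s₁.word 8 = s.word 8) (hwa : s₁.wordArr = s.wordArr)
    (hna : s₁.numArr = s.numArr) : Pushing s₁ σ s₁ where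
  word := fun _ _ => rfl
  num := rfl
  shown := rfl
  pow := rfl
  coeff := rfl
  top := by rw [hw, h.top]
  stack := h.stack.congr (fun _ _ _ _ _ => by rw [hwa]) fun _ _ => by rw [hna]

/-- The children of the current node are pushed. -/
lemma Searching.expand {n : ℕ} {I : Instance n} {l : ℕ} {δ : ℂ} {s₀ s : Store}
    (h₀ : SearchInput (n := n) l δ s₀) {x : Node n} {σ : List (Node n)} {a : Memory}
    (h : Searching s₀ σ a s) (hx : x.Valid (gatesAt I.circuit (s₀.word 3))) (hc : Current x s)
    (hact : x.Active l) :
    Searching s₀ (x.children δ (Real.exp (-I.γ)) (gatesAt I.circuit (s₀.word 3)) l ++ σ) a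
      (Prog.expand.run I s) := by
  have hd := disjointGates_gatesAt I.circuit (s₀.word 3)
  set j : Fin n := ⟨x.pos, hact.1⟩ with hj
  have h3 := h.word 3 (by norm_num)
  have hpow : ∀ k : Fin n, s.wordArr 1 k.val = 4 ^ k.val := fun k => by
    rw [h.pow, h₀.pow k.val k.2]
  have h9 : s.word 9 = j.val := hc.pos
  rw [Node.children, dif_pos hact, ← hj]
  simp only [Prog.expand, Prog.seqs, Prog.run, WExpr.eval, h3, h9]
  rcases gateAt_eq I.circuit (s₀.word 3) j with ⟨hz, hg⟩ | ⟨i, g, hi, hgi, hg⟩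
  · simp only [hz, h9, Function.update_of_ne (show (14 : ℕ) ≠ 16 by norm_num), Function.update_self,
      ne_eq, not_true_eq_false, if_false, Function.update_of_ne (show (9 : ℕ) ≠ 14 by norm_num), hpow]
    set s₁ : Store := ⟨Function.update (Function.update s.word 14 0) 16 (4 ^ j.val), s.num,
      s.wordArr, s.numArr⟩ with hs₁
    have hw : ∀ r, r ≠ 14 → r ≠ 16 → s₁.word r = s.word r := fun r hr hr' => by
      simp [hs₁, hr, hr']
    have hc₁ : Current x s₁ := ⟨by rw [hw _ (by norm_num) (by norm_num), hc.pos],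
      by rw [hw _ (by norm_num) (by norm_num), hc.codeP],
      by rw [hw _ (by norm_num) (by norm_num), hc.codeQ],
      by rw [hw _ (by norm_num) (by norm_num), hc.weightP],
      by rw [hw _ (by norm_num) (by norm_num), hc.weightQ], hc.amp⟩
    refine h.pushing (s₁ := s₁) (fun r hr => hw r (by omega) (by omega)) rfl rfl rfl ?_
    have hp := Pushing.start (s₁ := s₁) h (hw 8 (by norm_num) (by norm_num)) rfl rfl
    have hp1 := hp.push (hc₁.isChild_rest I)
    have h0 := hx j (by rw [owner_of_none hg])
    have hp2 := hp1.seqs (I := I) (p := fun a => (a, 0)) (q := fun a => (a, 0))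
      (f := fun _ => .reg 2) (y := fun a => x.child j j (a, 0) (a, 0) δ) letters fun a _ =>
        hc₁.isChild ⟨h0.1, h0.1⟩ ⟨h0.2, h0.2⟩ (Or.inl ⟨rfl, rfl, rfl⟩) (by simp [hs₁])
          (fun h => absurd rfl h) fun s' _ hn => by
            rw [NExpr.eval, hn]
            exact h.idle.trans h₀.idle
    have he : (x.extend δ (Real.exp (-I.γ)) (gatesAt I.circuit (s₀.word 3)) j).reverse ++ σ =
        (letters.map fun a => x.child j j (a, 0) (a, 0) δ).reverse ++ x.rest :: σ := by
      simp [Node.extend, hg]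
    rw [he]
    exact hp2
  · simp only [hi, h3, h9, Function.update_of_ne (show (14 : ℕ) ≠ 16 by norm_num),
      Function.update_self, ne_eq, Nat.succ_ne_zero, not_false_eq_true, if_true,
      Function.update_of_ne (show (9 : ℕ) ≠ 14 by norm_num), hpow, Nat.add_sub_cancel,
      Function.update_of_ne (show (3 : ℕ) ≠ 14 by norm_num),
      Function.update_of_ne (show (3 : ℕ) ≠ 15 by norm_num),
      Function.update_of_ne (show (3 : ℕ) ≠ 16 by norm_num),
      Function.update_of_ne (show (3 : ℕ) ≠ 17 by norm_num),
      Function.update_of_ne (show (14 : ℕ) ≠ 15 by norm_num),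
      Function.update_of_ne (show (14 : ℕ) ≠ 17 by norm_num),
      Function.update_of_ne (show (9 : ℕ) ≠ 15 by norm_num),
      Function.update_of_ne (show (9 : ℕ) ≠ 16 by norm_num),
      Function.update_of_ne (show (9 : ℕ) ≠ 17 by norm_num), hgi, Option.map_some, Option.getD_some]
    set s₁ : Store := ⟨Function.update (Function.update (Function.update (Function.update
      (Function.update s.word 14 (i + 1)) 16 (4 ^ j.val)) 14 i) 15 g.snd.val) 17 (4 ^ g.snd.val),
      s.num, s.wordArr, s.numArr⟩ with hs₁
    have hw : ∀ r, r < 14 → s₁.word r = s.word r := fun r hr => by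
      simp [hs₁, show r ≠ 14 by omega, show r ≠ 15 by omega,
        show r ≠ 16 by omega, show r ≠ 17 by omega]
    have hc₁ : Current x s₁ := ⟨by rw [hw _ (by norm_num), hc.pos],
      by rw [hw _ (by norm_num), hc.codeP], by rw [hw _ (by norm_num), hc.codeQ],
      by rw [hw _ (by norm_num), hc.weightP], by rw [hw _ (by norm_num), hc.weightQ], hc.amp⟩
    have hp := Pushing.start (s₁ := s₁) h (hw 8 (by norm_num)) rfl rfl
    have hp1 := hp.push (hc₁.isChild_rest I)
    refine h.pushing (s₁ := s₁) (fun r hr => hw r (by omega)) rfl rfl rfl ?_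
    by_cases hf : g.fst = j
    · have hne : j ≠ g.snd := hf ▸ g.ne
      rw [hf, if_neg (by simp)]
      have ho := fun i => owner_eq_iff_of_fst (i := i) hd hg hf
      have h0 := hx j (by rw [(ho _).2 (Or.inl rfl)])
      have h0' := hx g.snd (by rw [(ho _).2 (Or.inr rfl)])
      have hp2 := hp1.seqs (I := I) (p := fun t => t.1) (q := fun t => t.2)
        (f := fun t => .gateWeight t.1 t.2)
        (y := fun t => x.child j g.snd t.1 t.2
          (g.weight (Real.exp (-I.γ)) t.1.1 t.1.2 t.2.1 t.2.2)) transitions fun t _ =>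
          hc₁.isChild ⟨h0.1, h0'.1⟩ ⟨h0.2, h0'.2⟩ (Or.inr hne)
            (by simp [hs₁]) (fun _ => by simp [hs₁]) fun s' hw' _ => by
              refine NExpr.eval_gateWeight I s' ?_ t.1 t.2
              rw [hw' 3 (by norm_num), hw' 14 (by norm_num), hw 3 (by norm_num), h3]
              simpa [hs₁] using hgi
      have he : (x.extend δ (Real.exp (-I.γ)) (gatesAt I.circuit (s₀.word 3)) j).reverse ++ σ =
          (transitions.map fun t => x.child j g.snd t.1 t.2
            (g.weight (Real.exp (-I.γ)) t.1.1 t.1.2 t.2.1 t.2.2)).reverse ++ x.rest :: σ := by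
        simp [Node.extend, hg, hf]
      rw [he]
      exact hp2
    · have hne : g.fst.val ≠ j.val := fun h => hf (Fin.ext h)
      rw [if_pos (by omega)]
      have he : (x.extend δ (Real.exp (-I.γ)) (gatesAt I.circuit (s₀.word 3)) j).reverse ++ σ =
          x.rest :: σ := by
        simp [Node.extend, hg, hf]
      rw [he]
      exact hp1

lemma Searching.pop {n : ℕ} (I : Instance n) {s₀ s : Store} {x : Node n} {σ : List (Node n)}
    {a : Memory} (h : Searching s₀ (x :: σ) a s) :
    Searching s₀ σ (Function.update a.1 (x.pos - 1) x.letter.val, a.2) (Prog.pop.run I s) ∧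
      Current x (Prog.pop.run I s) := by
  obtain ⟨hw, hi, hp, hl, hcf, ht, h1, h2, h3, h4, h5, h6, h7, hs⟩ := h
  have h8 : s.word 8 - 1 = σ.length := by rw [ht]; simp
  simp only [Prog.pop, Prog.seqs, Prog.run, WExpr.eval, NExpr.eval, h8]
  constructor
  · refine ⟨fun r hr => ?_, ?_, ?_, ?_, hcf, ?_, ?_⟩
    · rw [← hw r hr]
      simp [show r ≠ 8 by omega, show r ≠ 9 by omega, show r ≠ 10 by omega,
        show r ≠ 11 by omega, show r ≠ 12 by omega, show r ≠ 13 by omega]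
    · simpa using hi
    · simpa [putAt] using hp
    · simp [putAt, h1, h6, hl]
    · simp
    · exact hs.congr (fun a ha _ i _ => by simp [putAt, show a ≠ 0 by omega]) fun _ _ => rfl
  · exact ⟨by simp [h1], by simp [h2], by simp [h3], by simp [h4], by simp [h5], by simp [h7]⟩

/-- What the expressions of `Prog.visit` evaluate to at a node. -/
def VisitSpec {n : ℕ} (I : Instance n) (s₀ : Store) (dstE : WExpr) (valE : NExpr)
    (dst : Pauli n → Pauli n → ℕ) (val : Pauli n → Pauli n → Memory → ℂ) : Prop :=
  ∀ (s : Store) (P Q : Pauli n), (∀ r < 8, s.word r = s₀.word r) → s.word 10 = P.code →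
    s.word 11 = Q.code → dstE.eval I s = dst P Q ∧
      valE.eval I s = val P Q (s.wordArr 0, s.numArr 0)

lemma Searching.body {n : ℕ} {I : Instance n} {l : ℕ} {δ : ℂ} {s₀ s : Store}
    (h₀ : SearchInput (n := n) l δ s₀) {dstE : WExpr} {valE : NExpr}
    {dst : Pauli n → Pauli n → ℕ} {val : Pauli n → Pauli n → Memory → ℂ}
    (hv : VisitSpec I s₀ dstE valE dst val) {x : Node n} {σ : List (Node n)} {a : Memory}
    (h : Searching s₀ (x :: σ) a s) (hx : x.Valid (gatesAt I.circuit (s₀.word 3))) :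
    Searching s₀ (x.children δ (Real.exp (-I.γ)) (gatesAt I.circuit (s₀.word 3)) l ++ σ)
      (x.enter l dst val a) ((Prog.searchBody dstE valE).run I s) := by
  obtain ⟨hs, hc⟩ := h.pop I
  rw [Prog.searchBody, Prog.run]
  set s₁ := Prog.pop.run I s
  -- Comparisons by truncated subtraction: 1 - (a - b) is nonzero iff a ≤ b, and a - b is nonzero
  -- iff a > b. Addition acts as disjunction.
  have hl : WExpr.leafTest.eval I s₁ ≠ 0 ↔ ¬x.Active l := by
    simp only [WExpr.leafTest, WExpr.eval, hc.pos, hc.weightP, hc.weightQ,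
      hs.word 0 (by norm_num), hs.word 2 (by norm_num), h₀.qubits, h₀.threshold, Node.Active]
    omega
  have hh : WExpr.highTest.eval I s₁ ≠ 0 ↔ ¬x.Low l := by
    simp only [WExpr.highTest, WExpr.eval, hc.weightP, hc.weightQ, hs.word 2 (by norm_num),
      h₀.threshold, Node.Low]
    omega
  simp only [Prog.run, hl, hh]
  by_cases hact : x.Active l
  · rw [if_neg (not_not.2 hact), Node.enter]
    simp only [if_pos hact]
    exact Searching.expand h₀ hs hx hc hact
  · rw [if_pos hact, Node.children, dif_neg hact, Node.enter]
    simp only [if_neg hact, List.nil_append]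
    by_cases hlow : x.Low l
    · rw [if_pos hlow, if_neg (not_not.2 hlow)]
      obtain ⟨h1, h2⟩ := hv s₁ x.P x.Q hs.word hc.codeP hc.codeQ
      simp only [Prog.visit, Prog.run, NExpr.eval, h1, h2, hc.amp]
      refine ⟨hs.word, hs.idle, hs.pow, hs.shown, ?_, hs.top, hs.stack.congr
        (fun _ _ _ _ _ => rfl) fun i _ => by simp [putAt]⟩
      simp [putAt, hs.coeff, hs.shown]
    · rw [if_neg hlow, if_pos hlow]
      exact hs

/-- Each iteration replaces the top node by its children, so clearing a node off the stack takes as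
many iterations as its subtree has nodes. The induction is over the height, and within it over the
children on the stack. -/
lemma Searching.iterates {n : ℕ} {I : Instance n} {l : ℕ} {δ : ℂ} {s₀ : Store}
    (h₀ : SearchInput (n := n) l δ s₀) {dstE : WExpr} {valE : NExpr}
    {dst : Pauli n → Pauli n → ℕ} {val : Pauli n → Pauli n → Memory → ℂ}
    (hv : VisitSpec I s₀ dstE valE dst val) (m : ℕ) {x : Node n} {σ : List (Node n)} {a : Memory}
    {s : Store} (h : Searching s₀ (x :: σ) a s) (hx : x.Valid (gatesAt I.circuit (s₀.word 3)))
    (hm : n ≤ x.pos + m) :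
    ∃ s', Iterates I (.reg 8) (Prog.searchBody dstE valE)
        (x.size δ (Real.exp (-I.γ)) (gatesAt I.circuit (s₀.word 3)) l m) s s' ∧
      Searching s₀ σ (x.search δ (Real.exp (-I.γ)) (gatesAt I.circuit (s₀.word 3)) l dst val m a)
        s' := by
  have hd := disjointGates_gatesAt I.circuit (s₀.word 3)
  have htest : ∀ {x : Node n} {σ : List (Node n)} {a : Memory} {s : Store},
      Searching s₀ (x :: σ) a s → (WExpr.reg 8).eval I s ≠ 0 := fun h => by
    rw [WExpr.eval, h.top]; simp
  induction m generalizing x σ a s with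
  | zero =>
    have hb := h.body h₀ hv hx
    rw [Node.children, dif_neg fun h => by have := h.1; omega] at hb
    exact ⟨_, Iterates.step (htest h) (Iterates.refl _), hb⟩
  | succ m ih =>
    have hb := h.body h₀ hv hx
    have key : ∀ (L : List (Node n)) (a : Memory) (s : Store), Searching s₀ (L ++ σ) a s →
        (∀ y ∈ L, y.Valid (gatesAt I.circuit (s₀.word 3)) ∧ n ≤ y.pos + m) →
        ∃ s', Iterates I (.reg 8) (Prog.searchBody dstE valE) ((L.map (Node.size δ
            (Real.exp (-I.γ)) (gatesAt I.circuit (s₀.word 3)) l m)).sum) s s' ∧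
          Searching s₀ σ (L.foldl (fun a y => Node.search δ (Real.exp (-I.γ))
            (gatesAt I.circuit (s₀.word 3)) l dst val m y a) a) s' := by
      intro L
      induction L with
      | nil => exact fun a s h _ => ⟨s, Iterates.refl s, h⟩
      | cons y L ihL =>
        intro a s hs hL
        obtain ⟨s₁, hi₁, hs₁⟩ := ih hs (hL y (by simp)).1 (hL y (by simp)).2
        obtain ⟨s₂, hi₂, hs₂⟩ := ihL _ s₁ hs₁ fun z hz => hL z (by simp [hz])
        exact ⟨s₂, by rw [List.map_cons, List.sum_cons]; exact hi₁.trans hi₂, hs₂⟩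
    obtain ⟨s', hi, hs'⟩ := key _ _ _ hb fun y hy => by
      obtain ⟨_, hy⟩ := Node.mem_children.1 hy
      have := Node.pos_of_mem_extend hy
      exact ⟨Node.valid_of_mem_extend hd hx rfl hy, by omega⟩
    refine ⟨s', ?_, hs'⟩
    rw [Node.size, add_comm]
    exact Iterates.step (htest h) hi

lemma Prog.loopFree_push (p q : Fin 4 × Fin 4) (f : NExpr) : (Prog.push p q f).LoopFree := by
  simp [Prog.push, Prog.seqs, Prog.LoopFree]

lemma Prog.loopFree_searchBody (dst : WExpr) (val : NExpr) :
    (Prog.searchBody dst val).LoopFree := by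
  have h1 : Prog.pushIdle.LoopFree := Prog.loopFree_seqs fun p hp => by
    simp only [List.mem_cons, List.mem_map] at hp
    rcases hp with rfl | ⟨a, _, rfl⟩ <;> exact Prog.loopFree_push _ _ _
  have h2 : Prog.pushGate.LoopFree := Prog.loopFree_seqs fun p hp => by
    simp only [List.mem_cons, List.mem_map] at hp
    rcases hp with rfl | ⟨a, _, rfl⟩ <;> exact Prog.loopFree_push _ _ _
  have h3 : Prog.pushRest.LoopFree := Prog.loopFree_push _ _ _
  simp [Prog.searchBody, Prog.pop, Prog.expand, Prog.visit, Prog.seqs, Prog.LoopFree, h1, h2, h3]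

/-- The search program evaluates a sum over all transitions between strings of low weight. -/
theorem Prog.runs_search {n : ℕ} {I : Instance n} {l : ℕ} {δ : ℂ} {s₀ : Store}
    (h₀ : SearchInput (n := n) l δ s₀) (hl : s₀.wordArr 0 = 0) {dstE : WExpr} {valE : NExpr}
    {dst : Pauli n → Pauli n → ℕ} {val : Pauli n → Pauli n → Memory → ℂ}
    (hv : VisitSpec I s₀ dstE valE dst val) (b : ℕ) (V : Pauli n → Pauli n → ℂ)
    (hdst : ∀ P Q, b ≤ dst P Q)
    (hval : ∀ P Q (a : Memory), (∀ i < b, a.2 i = s₀.numArr 0 i) →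
      (gatesAt I.circuit (s₀.word 3) = [] → a.1 = P.array) → P.weight ≤ l → val P Q a = V P Q) :
    ∃ s', Runs I (Prog.search dstE valE) s₀ s' (Prog.pushRoot.bound + (treeBound branching n l *
        (2 + (Prog.searchBody dstE valE).bound) + 2)) ∧
      (∀ r < 8, s'.word r = s₀.word r) ∧ s'.num 2 = s₀.num 2 ∧
      s'.wordArr 1 = s₀.wordArr 1 ∧ s'.wordArr 0 = 0 ∧
      ∀ i, s'.numArr 0 i = s₀.numArr 0 i +
        ∑ P : Pauli n, ∑ Q : Pauli n, if P.weight ≤ l ∧ Q.weight ≤ l then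
          (∏ j, siteFactor δ (Real.exp (-I.γ)) (gatesAt I.circuit (s₀.word 3)) P Q j) *
            (if dst P Q = i then V P Q else 0) else 0 := by
  have hd := disjointGates_gatesAt I.circuit (s₀.word 3)
  have hroot : Searching s₀ [Node.root n] (0, s₀.numArr 0) (Prog.pushRoot.run I s₀) := by
    simp only [Prog.pushRoot, Prog.seqs, Prog.run, WExpr.eval, NExpr.eval]
    refine ⟨fun r hr => ?_, rfl, ?_, ?_, ?_, ?_, ?_, ?_, ?_, ?_, ?_, ?_, ?_, trivial⟩
    · simp [show r ≠ 8 by omega]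
    all_goals simp [putAt, Node.root, Pauli.code_zero, Pauli.weight_zero, hl]
  obtain ⟨s', hi, hs⟩ := hroot.iterates h₀ hv n (Node.root_valid _) (Nat.le_add_left _ _)
  rw [Node.search_root _ _ hd l dst val b _ V hdst hval] at hs
  have hf : Prog.pushRoot.LoopFree := by simp [Prog.pushRoot, Prog.seqs, Prog.LoopFree]
  refine ⟨s', ?_, hs.word, hs.idle, hs.pow, hs.shown, fun i => by rw [hs.coeff]⟩
  refine (hf.runs I s₀).seq ((hi.runs (Prog.loopFree_searchBody _ _)
    (by rw [WExpr.eval, hs.top]; rfl)).mono ?_)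
  have hsz := Node.size_le δ (Real.exp (-I.γ)) hd l n (Node.root_valid (gatesAt I.circuit (s₀.word 3)))
  have hbud : (Node.root n).budget l = l := by
    simp [Node.budget, Node.root, Pauli.weight_zero]
  rw [hbud] at hsz
  exact Nat.add_le_add (Nat.mul_le_mul_right _ hsz) le_rfl

/-! ### The whole program -/

/-- Compute the powers of `4`. -/
def Prog.powers : Prog :=
  .while (.reg 7) (.seqs [.putWord 1 (.sub (.reg 0) (.reg 7)) (.reg 6),
    .setWord 6 (.times 4 (.reg 6)), .setWord 7 (.sub (.reg 7) (.lit 1))])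

/-- Search to compute the initial coefficients. -/
noncomputable def Prog.searchInit : Prog := .search (.add (.reg 5) (.reg 11)) (.obsCoeff 0)

/-- Search to compute the coefficients after a layer. -/
noncomputable def Prog.searchLayer : Prog :=
  .search (.add (.reg 5) (.reg 11)) (.get 0 (.add (.reg 4) (.reg 10)))

/-- Search to compute the expectation value. -/
noncomputable def Prog.searchOutput : Prog :=
  .search (.reg 5) (.mul (.get 0 (.add (.reg 4) (.reg 10))) (.stateCoeff 0))

/-- Evolve the coefficients through a layer. -/
noncomputable def Prog.layer : Prog :=
  .seq (.setWord 5 (.add (.reg 4) (.reg 6))) (.seq .searchLayer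
    (.seqs [.setWord 4 (.reg 5), .setWord 3 (.add (.reg 3) (.lit 1)),
      .setWord 7 (.sub (.reg 7) (.lit 1))]))

/-- Compute the initial coefficients. -/
noncomputable def Prog.setup : Prog :=
  .seq (.seqs [.setWord 3 (.reg 1), .setNum 2 .damping]) (.seq .searchInit
    (.seqs [.setNum 2 (.rat 1), .setWord 3 (.lit 0), .setWord 7 (.reg 1)]))

/-- Compute the expectation value. -/
noncomputable def Prog.output : Prog :=
  .seq (.setWord 5 (.add (.reg 4) (.reg 6))) (.seq .searchOutput (.setNum 0 (.get 0 (.reg 5))))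

/-- Evaluation of the weight-truncated evolution for a positive threshold. -/
noncomputable def Prog.evaluatePos : Prog :=
  .seq (.seqs [.setWord 6 (.lit 1), .setWord 7 (.reg 0)])
    (.seq .powers (.seq .setup (.seq (.while (.reg 7) .layer) .output)))

/-- Evaluation of the weight-truncated evolution. -/
noncomputable def Prog.evaluate : Prog :=
  .ite (.reg 2) .evaluatePos (.setNum 0 (.mul (.obsCoeff 0) (.stateCoeff 0)))

/-! #### Threshold zero -/

lemma Pauli.weight_eq_zero {n : ℕ} {P : Pauli n} : P.weight = 0 ↔ P = 0 := by
  rw [Pauli.weight, Finset.card_eq_zero, Finset.filter_eq_empty_iff]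
  constructor
  · intro h
    funext j
    simpa using h (Finset.mem_univ j)
  · rintro rfl
    simp

lemma filter_weight_le_zero {n : ℕ} :
    (Finset.univ.filter fun P : Pauli n => P.weight ≤ 0) = {0} := by
  ext P
  simp [Pauli.weight_eq_zero]

lemma Layer.amplitude_zero {n : ℕ} (L : Layer n) : L.amplitude 0 0 = 1 := by
  rw [L.amplitude_eq_coef, Pauli.op_zero, mul_one, L.conjTranspose_mul_self, ← Pauli.op_zero,
    coef_op, if_pos rfl]

/-- Only the identity string survives, and its coefficient is neither damped nor changed by
unitaries. -/
lemma truncated_zero {n : ℕ} (γ : ℝ) (C : Circuit n) (O : Op n) :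
    C.truncated γ 0 O = coef O 0 • 1 := by
  have h : ∀ (C : Circuit n) (c : Pauli n → ℂ), C.foldl (stepCoeff γ 0) c 0 = c 0 := by
    intro C
    induction C with
    | nil => exact fun c => rfl
    | cons L C ih =>
      intro c
      rw [List.foldl_cons, ih, stepCoeff, if_pos Pauli.weight_zero.le, filter_weight_le_zero,
        Finset.sum_singleton, L.amplitude_zero, one_mul]
      simp [Layer.weight]
  rw [Circuit.truncated, filter_weight_le_zero, Finset.sum_singleton, h, Pauli.op_zero, initCoeff,
    if_pos Pauli.weight_zero.le, Pauli.weight_zero]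
  simp [coef]

lemma trace_mul_truncated {n : ℕ} (γ : ℝ) (l : ℕ) (C : Circuit n) (O ρ : Op n) :
    (ρ * C.truncated γ l O).trace = ∑ P : Pauli n, if P.weight ≤ l then
      C.foldl (stepCoeff γ l) (initCoeff γ l O) P * (ρ * P.op).trace else 0 := by
  rw [Circuit.truncated, Finset.sum_filter, Finset.mul_sum, Matrix.trace_sum]
  refine Finset.sum_congr rfl fun P _ => ?_
  split_ifs
  · rw [Matrix.mul_smul, Matrix.trace_smul, smul_eq_mul]
  · simp

/-! #### Positive threshold -/

/-- The state of the program while the powers of `4` are computed, with `k` powers missing. -/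
structure PowersState (n d l k : ℕ) (s : Store) : Prop where
  qubits : s.word 0 = n
  depth : s.word 1 = d
  threshold : s.word 2 = l
  old : s.word 4 = 0
  new : s.word 5 = 0
  power : s.word 6 = 4 ^ (n - k)
  counter : s.word 7 = k
  pow : ∀ j < n - k, s.wordArr 1 j = 4 ^ j
  shown : s.wordArr 0 = 0
  coeff : s.numArr 0 = 0

lemma PowersState.runs {n : ℕ} (I : Instance n) {d l k : ℕ} {s : Store} (hk : k ≤ n)
    (h : PowersState n d l k s) :
    ∃ s', Runs I Prog.powers s s' (k * 24 + 2) ∧ PowersState n d l 0 s' := by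
  induction k generalizing s with
  | zero => exact ⟨s, Runs.whileDone h.counter, h⟩
  | succ k ih =>
    set p : Prog := .seqs [.putWord 1 (.sub (.reg 0) (.reg 7)) (.reg 6),
      .setWord 6 (.times 4 (.reg 6)), .setWord 7 (.sub (.reg 7) (.lit 1))] with hp
    have hf : p.LoopFree := by simp [hp, Prog.seqs, Prog.LoopFree]
    -- Together with 2 steps for the test, this is the 24 in the statement.
    have hb : p.bound ≤ 22 := by decide
    have h1 : PowersState n d l k (p.run I s) := by
      have hn : n - (k + 1) + 1 = n - k := by omega
      simp only [hp, Prog.seqs, Prog.run, WExpr.eval, WExpr.eval_times]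
      refine ⟨by simp [h.qubits], by simp [h.depth], by simp [h.threshold], by simp [h.old],
        by simp [h.new], ?_, by simp [h.counter], fun j hj => ?_, by simp [putAt, h.shown],
        h.coeff⟩
      · simp [h.power, ← hn, pow_succ, mul_comm]
      · simp only [putAt, Function.update_self, h.qubits, h.counter, h.power, Function.update_apply]
        split_ifs with hj'
        · rw [hj']
        · exact h.pow j (by omega)
    obtain ⟨s', hr, hs'⟩ := ih (by omega) h1
    refine ⟨s', ?_, hs'⟩
    have := Runs.whileStep (b := .reg 7) (by rw [WExpr.eval, h.counter]; omega) (hf.runs I s) hr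
    refine this.mono ?_
    have : (WExpr.reg 7).cost = 1 := rfl
    omega

/-- The state of the program after `k` layers. -/
structure LayersState {n : ℕ} (I : Instance n) (l k : ℕ) (s : Store) : Prop where
  qubits : s.word 0 = n
  threshold : s.word 2 = l
  layer : s.word 3 = k
  old : s.word 4 = k * 4 ^ n
  power : s.word 6 = 4 ^ n
  counter : s.word 7 = I.circuit.length - k
  pow : ∀ j < n, s.wordArr 1 j = 4 ^ j
  idle : s.num 2 = 1
  shown : s.wordArr 0 = 0
  coeff : ∀ P : Pauli n, P.weight ≤ l → s.numArr 0 (k * 4 ^ n + P.code) =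
    (I.circuit.take k).foldl (stepCoeff I.γ l) (initCoeff I.γ l I.obs) P
  -- Every search writes to a new block of addresses. Since arrays are zero at the start, no time is
  -- spent on clearing them, although a block has 4^n cells.
  fresh : ∀ i, (k + 1) * 4 ^ n ≤ i → s.numArr 0 i = 0

/-- The number of steps of a search program. -/
noncomputable def searchSteps (dst : WExpr) (val : NExpr) (S : ℕ) : ℕ := Prog.pushRoot.bound + (S *
  (2 + (Prog.searchBody dst val).bound) + 2)

lemma visitSpec_init {n : ℕ} (I : Instance n) (s₀ : Store) :
    VisitSpec I s₀ (.add (.reg 5) (.reg 11)) (.obsCoeff 0) (fun _ Q => s₀.word 5 + Q.code)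
      fun _ _ a => (I.obs * (readPauli n a.1).op).trace / 2 ^ n :=
  fun s _ _ hw _ h11 => ⟨by simp only [WExpr.eval, hw 5 (by norm_num), h11], rfl⟩

lemma visitSpec_layer {n : ℕ} (I : Instance n) (s₀ : Store) :
    VisitSpec I s₀ (.add (.reg 5) (.reg 11)) (.get 0 (.add (.reg 4) (.reg 10)))
      (fun _ Q => s₀.word 5 + Q.code) fun P _ a => a.2 (s₀.word 4 + P.code) :=
  fun s _ _ hw h10 h11 => ⟨by simp only [WExpr.eval, hw 5 (by norm_num), h11],
    by simp only [NExpr.eval, WExpr.eval, hw 4 (by norm_num), h10]⟩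

lemma visitSpec_output {n : ℕ} (I : Instance n) (s₀ : Store) :
    VisitSpec I s₀ (.reg 5) (.mul (.get 0 (.add (.reg 4) (.reg 10))) (.stateCoeff 0))
      (fun _ _ => s₀.word 5) fun P _ a =>
        a.2 (s₀.word 4 + P.code) * (I.state * (readPauli n a.1).op).trace :=
  fun s _ _ hw h10 _ => ⟨by simp only [WExpr.eval, hw 5 (by norm_num)],
    by simp only [NExpr.eval, WExpr.eval, hw 4 (by norm_num), h10]⟩

/-- Layer number d, one past the end, is the empty layer over which the first and the last search
run. -/
lemma gatesAt_length {n : ℕ} (C : Circuit n) : gatesAt C C.length = [] := by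
  simp [gatesAt]

lemma gatesAt_of_lt {n : ℕ} (C : Circuit n) {k : ℕ} (hk : k < C.length) :
    gatesAt C k = C[k].gates := by
  simp [gatesAt, hk]

/-- Distinct strings have distinct addresses, so a cell collects exactly the transitions into its
own string. -/
lemma sum_sum_code {n : ℕ} (l b : ℕ) (w : Pauli n → Pauli n → ℂ) (V : Pauli n → ℂ) {R : Pauli n}
    (hR : R.weight ≤ l) :
    (∑ P : Pauli n, ∑ Q : Pauli n, if P.weight ≤ l ∧ Q.weight ≤ l then
      w P Q * (if b + Q.code = b + R.code then V P else 0) else 0) =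
      ∑ P : Pauli n, if P.weight ≤ l then w P R * V P else 0 := by
  refine Finset.sum_congr rfl fun P _ => ?_
  rw [Finset.sum_eq_single R]
  · simp [hR]
  · intro Q _ hQ
    have : b + Q.code ≠ b + R.code := fun h => hQ (Pauli.code_injective (Nat.add_left_cancel h))
    rw [if_neg this, mul_zero, ite_self]
  · simp

lemma sum_sum_code_eq_zero {n : ℕ} (l b i : ℕ) (w : Pauli n → Pauli n → ℂ) (V : Pauli n → ℂ)
    (hi : b + 4 ^ n ≤ i) :
    (∑ P : Pauli n, ∑ Q : Pauli n, if P.weight ≤ l ∧ Q.weight ≤ l then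
      w P Q * (if b + Q.code = i then V P else 0) else 0) = 0 := by
  refine Finset.sum_eq_zero fun P _ => Finset.sum_eq_zero fun Q _ => ?_
  have := Q.code_lt
  rw [if_neg (show b + Q.code ≠ i by omega), mul_zero, ite_self]

lemma LayersState.of_powers {n : ℕ} (I : Instance n) {l : ℕ} {s : Store}
    (h : PowersState n I.circuit.length l 0 s) :
    ∃ s', Runs I .setup s s'
        (5 + (searchSteps (.add (.reg 5) (.reg 11)) (.obsCoeff 0) (treeBound branching n l) + 7)) ∧
      LayersState I l 0 s' := by
  set p : Prog := .seqs [.setWord 3 (.reg 1), .setNum 2 .damping] with hp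
  set q : Prog := .seqs [.setNum 2 (.rat 1), .setWord 3 (.lit 0), .setWord 7 (.reg 1)] with hq
  have hpf : p.LoopFree := by simp [hp, Prog.seqs, Prog.LoopFree]
  have hqf : q.LoopFree := by simp [hq, Prog.seqs, Prog.LoopFree]
  set s₀ := p.run I s with hs₀
  have hw : ∀ r, r ≠ 3 → s₀.word r = s.word r := fun r hr => by
    simp [hs₀, hp, Prog.seqs, Prog.run, hr]
  have h3 : s₀.word 3 = I.circuit.length := by
    simp [hs₀, hp, Prog.seqs, Prog.run, WExpr.eval, h.depth]
  have hδ : s₀.num 2 = Real.exp (-I.γ) := by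
    simp [hs₀, hp, Prog.seqs, Prog.run, NExpr.eval]
  have hwa : s₀.wordArr = s.wordArr := rfl
  have hna : s₀.numArr = s.numArr := rfl
  have hin : SearchInput (n := n) l (Real.exp (-I.γ)) s₀ := ⟨by rw [hw 0 (by norm_num), h.qubits],
    by rw [hw 2 (by norm_num), h.threshold], fun j hj => h.pow j hj, hδ⟩
  have hg : gatesAt I.circuit (s₀.word 3) = [] := by rw [h3, gatesAt_length]
  have h5 : s₀.word 5 = 0 := by rw [hw 5 (by norm_num), h.new]
  -- Here `b = 0`: the value added at a leaf is queried from the letter array, and no stored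
  -- coefficient is read.
  obtain ⟨s₁, hr, hw₁, -, hpow₁, hsh₁, hc₁⟩ := Prog.runs_search hin h.shown (visitSpec_init I s₀) 0
    (fun P _ => coef I.obs P) (fun _ _ => Nat.zero_le _) fun P Q a _ ha _ => by
      rw [ha hg, readPauli_array]; rfl
  refine ⟨q.run I s₁, (hpf.runs I s).seq (hr.seq (hqf.runs I s₁)), ?_⟩
  have hqw : ∀ r, r ≠ 3 → r ≠ 7 → (q.run I s₁).word r = s₁.word r := fun r h3 h7 => by
    simp [hq, Prog.seqs, Prog.run, h3, h7]
  have hqn : (q.run I s₁).numArr = s₁.numArr := rfl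
  refine ⟨?_, ?_, ?_, ?_, ?_, ?_, ?_, ?_, ?_, ?_, ?_⟩
  · rw [hqw 0 (by norm_num) (by norm_num), hw₁ 0 (by norm_num), hin.qubits]
  · rw [hqw 2 (by norm_num) (by norm_num), hw₁ 2 (by norm_num), hin.threshold]
  · simp [hq, Prog.seqs, Prog.run, WExpr.eval]
  · rw [hqw 4 (by norm_num) (by norm_num), hw₁ 4 (by norm_num), hw 4 (by norm_num), h.old, zero_mul]
  · rw [hqw 6 (by norm_num) (by norm_num), hw₁ 6 (by norm_num), hw 6 (by norm_num), h.power,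
      Nat.sub_zero]
  · simp [hq, Prog.seqs, Prog.run, WExpr.eval, hw₁ 1 (by norm_num), hw 1 (by norm_num), h.depth]
  · intro j hj
    have : (q.run I s₁).wordArr = s₁.wordArr := rfl
    rw [this, hpow₁, hin.pow j hj]
  · simp [hq, Prog.seqs, Prog.run, NExpr.eval]
  · exact hsh₁
  · intro P hP
    have hcode : ∀ Q : Pauli n, s₀.word 5 + Q.code = 0 + Q.code := fun Q => by rw [h5]
    rw [hqn, hc₁, hna, h.coeff, hg]
    simp only [hcode, zero_mul]
    rw [sum_sum_code l 0 _ (coef I.obs) hP]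
    simp only [prod_siteFactor_nil, List.take_zero, List.foldl_nil, initCoeff, hP, if_true]
    rw [Finset.sum_eq_single P]
    · rw [prod_damp]
      rw [if_pos hP, if_pos rfl, Pi.zero_apply, zero_add]
      rfl
    · intro Q _ hQ
      simp [hQ]
    · simp
  · intro i hi
    have hcode : ∀ Q : Pauli n, s₀.word 5 + Q.code = 0 + Q.code := fun Q => by rw [h5]
    rw [hqn, hc₁, hna, h.coeff]
    simp only [hcode]
    rw [sum_sum_code_eq_zero l 0 i _ (coef I.obs) (by simpa using hi)]
    simp

lemma LayersState.step {n : ℕ} {I : Instance n} {l k : ℕ} {s : Store} (h : LayersState I l k s)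
    (hk : k < I.circuit.length) :
    ∃ s', Runs I .layer s s' (4 + (searchSteps (.add (.reg 5) (.reg 11))
        (.get 0 (.add (.reg 4) (.reg 10))) (treeBound branching n l) + 11)) ∧
      LayersState I l (k + 1) s' := by
  set p : Prog := .setWord 5 (.add (.reg 4) (.reg 6)) with hp
  set q : Prog := .seqs [.setWord 4 (.reg 5), .setWord 3 (.add (.reg 3) (.lit 1)),
      .setWord 7 (.sub (.reg 7) (.lit 1))] with hq
  have hpf : p.LoopFree := trivial
  have hqf : q.LoopFree := by simp [hq, Prog.seqs, Prog.LoopFree]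
  set s₀ := p.run I s with hs₀
  have hw : ∀ r, r ≠ 5 → s₀.word r = s.word r := fun r hr => by
    simp [hs₀, hp, Prog.run, hr]
  have h5 : s₀.word 5 = (k + 1) * 4 ^ n := by
    simp [hs₀, hp, Prog.run, WExpr.eval, h.old, h.power, add_mul]
  have h4 : s₀.word 4 = k * 4 ^ n := by rw [hw 4 (by norm_num), h.old]
  have hna : s₀.numArr = s.numArr := rfl
  have hin : SearchInput (n := n) l 1 s₀ := ⟨by rw [hw 0 (by norm_num), h.qubits],
    by rw [hw 2 (by norm_num), h.threshold], h.pow, h.idle⟩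
  have hg : gatesAt I.circuit (s₀.word 3) = I.circuit[k].gates := by
    rw [hw 3 (by norm_num), h.layer, gatesAt_of_lt _ hk]
  -- The separating address is the end of block `k`, from which the old coefficients are read, and
  -- the start of block `k + 1`, to which the new ones are written.
  obtain ⟨s₁, hr, hw₁, hn₁, hpow₁, hsh₁, hc₁⟩ := Prog.runs_search hin h.shown
    (visitSpec_layer I s₀) ((k + 1) * 4 ^ n)
    (fun P _ => (I.circuit.take k).foldl (stepCoeff I.γ l) (initCoeff I.γ l I.obs) P)
    (fun _ _ => by rw [h5]; exact Nat.le_add_right _ _) fun P Q a ha _ hP => by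
      have := P.code_lt
      rw [ha _ (by rw [h4, add_mul]; omega), h4, hna, h.coeff P hP]
  refine ⟨q.run I s₁, (hpf.runs I s).seq (hr.seq (hqf.runs I s₁)), ?_⟩
  have hqw : ∀ r, r ≠ 3 → r ≠ 4 → r ≠ 7 → (q.run I s₁).word r = s₁.word r := fun r h3 h4 h7 => by
    simp [hq, Prog.seqs, Prog.run, h3, h4, h7]
  have hqn : (q.run I s₁).numArr = s₁.numArr := rfl
  refine ⟨?_, ?_, ?_, ?_, ?_, ?_, ?_, ?_, ?_, ?_, ?_⟩
  · rw [hqw 0 (by norm_num) (by norm_num) (by norm_num), hw₁ 0 (by norm_num), hin.qubits]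
  · rw [hqw 2 (by norm_num) (by norm_num) (by norm_num), hw₁ 2 (by norm_num), hin.threshold]
  · simp [hq, Prog.seqs, Prog.run, WExpr.eval, hw₁ 3 (by norm_num), hw 3 (by norm_num), h.layer]
  · simp [hq, Prog.seqs, Prog.run, WExpr.eval, hw₁ 5 (by norm_num), h5]
  · rw [hqw 6 (by norm_num) (by norm_num) (by norm_num), hw₁ 6 (by norm_num), hw 6 (by norm_num),
      h.power]
  · simp [hq, Prog.seqs, Prog.run, WExpr.eval, hw₁ 7 (by norm_num), hw 7 (by norm_num), h.counter]
    omega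
  · intro j hj
    have : (q.run I s₁).wordArr = s₁.wordArr := rfl
    rw [this, hpow₁, hin.pow j hj]
  · have : (q.run I s₁).num = s₁.num := rfl
    rw [this, hn₁, hin.idle]
  · exact hsh₁
  · intro P hP
    rw [hqn, hc₁, hna, h.fresh _ (Nat.le_add_right _ _), hg, zero_add]
    simp only [h5]
    rw [sum_sum_code l _ _ _ hP, List.take_succ_eq_append_getElem hk, List.foldl_append,
      List.foldl_cons, List.foldl_nil, stepCoeff, if_pos hP, Finset.mul_sum, Finset.sum_filter]
    refine Finset.sum_congr rfl fun R _ => ?_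
    rw [Layer.prod_siteFactor, mul_assoc]
  · intro i hi
    have hi' : (k + 1) * 4 ^ n + 4 ^ n ≤ i := by rw [add_mul] at hi; omega
    have hi'' : (k + 1) * 4 ^ n ≤ i := (Nat.le_add_right _ _).trans hi'
    rw [hqn, hc₁, hna, h.fresh i hi'', zero_add]
    simp only [h5]
    exact sum_sum_code_eq_zero l _ i _ _ hi'

lemma LayersState.loop {n : ℕ} {I : Instance n} {l : ℕ} (m : ℕ) {k : ℕ} {s : Store}
    (h : LayersState I l k s) (hk : k + m = I.circuit.length) :
    ∃ s', Runs I (.while (.reg 7) .layer) s s' (m * (17 + searchSteps (.add (.reg 5) (.reg 11))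
        (.get 0 (.add (.reg 4) (.reg 10))) (treeBound branching n l)) + 2) ∧
      LayersState I l I.circuit.length s' := by
  induction m generalizing k s with
  | zero =>
    have hk' : k = I.circuit.length := hk
    subst hk'
    exact ⟨s, (Runs.whileDone (by rw [WExpr.eval, h.counter, Nat.sub_self])).mono (by simp [WExpr.cost]), h⟩
  | succ m ih =>
    obtain ⟨s₁, h₁, hs₁⟩ := h.step (by omega)
    obtain ⟨s₂, h₂, hs₂⟩ := ih hs₁ (by omega)
    -- The constant 17 is 2 for the test plus 4 + 11 for the bookkeeping around the search.
    refine ⟨s₂, (Runs.whileStep (by rw [WExpr.eval, h.counter]; omega) h₁ h₂).mono ?_, hs₂⟩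
    have : (WExpr.reg 7).cost = 1 := rfl
    rw [this, Nat.succ_mul]
    omega

/-- The empty layer with δ = 1 allows only Q = P, and all leaves add to one fresh cell, which
therefore accumulates the sum of coefficients times tr(ρP). -/
lemma LayersState.output {n : ℕ} {I : Instance n} {l : ℕ} {s : Store}
    (h : LayersState I l I.circuit.length s) :
    ∃ s', Runs I .output s s' (4 + (searchSteps (.reg 5)
        (.mul (.get 0 (.add (.reg 4) (.reg 10))) (.stateCoeff 0)) (treeBound branching n l) + 3)) ∧
      s'.num 0 = (I.state * I.circuit.truncated I.γ l I.obs).trace := by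
  set p : Prog := .setWord 5 (.add (.reg 4) (.reg 6)) with hp
  set q : Prog := .setNum 0 (.get 0 (.reg 5)) with hq
  have hpf : p.LoopFree := trivial
  have hqf : q.LoopFree := trivial
  set d := I.circuit.length with hd
  set s₀ := p.run I s with hs₀
  have hw : ∀ r, r ≠ 5 → s₀.word r = s.word r := fun r hr => by
    simp [hs₀, hp, Prog.run, hr]
  have h5 : s₀.word 5 = (d + 1) * 4 ^ n := by
    simp [hs₀, hp, Prog.run, WExpr.eval, h.old, h.power, add_mul]
  have h4 : s₀.word 4 = d * 4 ^ n := by rw [hw 4 (by norm_num), h.old]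
  have hna : s₀.numArr = s.numArr := rfl
  have hin : SearchInput (n := n) l 1 s₀ := ⟨by rw [hw 0 (by norm_num), h.qubits],
    by rw [hw 2 (by norm_num), h.threshold], h.pow, h.idle⟩
  have hg : gatesAt I.circuit (s₀.word 3) = [] := by
    rw [hw 3 (by norm_num), h.layer, gatesAt_length]
  obtain ⟨s₁, hr, hw₁, -, -, -, hc₁⟩ := Prog.runs_search hin h.shown
    (visitSpec_output I s₀) ((d + 1) * 4 ^ n)
    (fun P _ => I.circuit.foldl (stepCoeff I.γ l) (initCoeff I.γ l I.obs) P *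
      (I.state * P.op).trace)
    (fun _ _ => by rw [h5]) fun P Q a ha hsh hP => by
      have := P.code_lt
      rw [ha _ (by rw [h4, add_mul]; omega), h4, hna, h.coeff P hP, hsh hg, readPauli_array,
        List.take_length]
  refine ⟨q.run I s₁, (hpf.runs I s).seq (hr.seq (hqf.runs I s₁)), ?_⟩
  have hq0 : (q.run I s₁).num 0 = s₁.numArr 0 (s₁.word 5) := by
    simp [hq, Prog.run, NExpr.eval, WExpr.eval]
  rw [hq0, hc₁, hw₁ 5 (by norm_num), h5, hna, h.fresh _ le_rfl, zero_add, hg, trace_mul_truncated]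
  refine Finset.sum_congr rfl fun P _ => ?_
  rw [Finset.sum_eq_single P]
  · simp only [prod_siteFactor_nil, if_true, and_self]
    have : ∀ q, damp 1 q = 1 := fun q => by simp [damp]
    simp [this]
  · intro Q _ hQ
    simp [prod_siteFactor_nil, hQ.symm]
  · simp

/-- The number of steps of a search is at most a universal multiple of `n ^ l`. -/
lemma exists_searchSteps_le (dst : WExpr) (val : NExpr) : ∃ K : ℕ, ∀ n l, 1 ≤ n →
    searchSteps dst val (treeBound branching n l) ≤ K * n ^ l := by
  obtain ⟨K, hK⟩ := exists_treeBound_le branching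
  refine ⟨Prog.pushRoot.bound + (K * (2 + (Prog.searchBody dst val).bound) + 2), fun n l hn => ?_⟩
  have h1 := Nat.mul_le_mul_right (2 + (Prog.searchBody dst val).bound) (hK n l hn)
  have h2 : 1 ≤ n ^ l := Nat.one_le_pow _ _ hn
  unfold searchSteps
  generalize (Prog.searchBody dst val).bound = B at *
  generalize Prog.pushRoot.bound = A at *
  have h3 : A ≤ A * n ^ l := Nat.le_mul_of_pos_right _ h2
  nlinarith

/-- The program evaluates the weight-truncated evolution. -/
theorem Prog.exists_outputs_evaluate : ∃ K : ℕ, ∀ (n : ℕ), 1 ≤ n → ∀ (I : Instance n),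
    I.state.trace = 1 → ∀ l : ℕ, Prog.evaluate.Outputs I l
      (I.state * I.circuit.truncated I.γ l I.obs).trace (K * max I.circuit.length 1 * n ^ l) := by
  obtain ⟨K₁, hK₁⟩ := exists_searchSteps_le (.add (.reg 5) (.reg 11)) (.obsCoeff 0)
  obtain ⟨K₂, hK₂⟩ := exists_searchSteps_le (.add (.reg 5) (.reg 11))
    (.get 0 (.add (.reg 4) (.reg 10)))
  obtain ⟨K₃, hK₃⟩ := exists_searchSteps_le (.reg 5)
    (.mul (.get 0 (.add (.reg 4) (.reg 10))) (.stateCoeff 0))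
  refine ⟨K₁ + K₂ + K₃ + 100, fun n hn I htr l => ?_⟩
  set D := max I.circuit.length 1 with hD
  have hD1 : 1 ≤ D := le_max_right _ _
  have hd : I.circuit.length ≤ D := le_max_left _ _
  rcases Nat.eq_zero_or_pos l with rfl | hl
  -- As n^0 = 1, there is no time to tabulate n powers of 4. The letter array is still zero and
  -- shows the identity string, so two queries and a product give the result.
  · refine ⟨_, _, Exec.iteFalse rfl (Exec.setNum _ _ _), ?_, ?_⟩
    · have h0 : readPauli n (fun _ => 0) = 0 := rfl
      rw [truncated_zero]
      simp only [NExpr.eval, startStore, h0, Function.update_self, Pauli.op_zero]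
      rw [Matrix.mul_smul, Matrix.trace_smul, smul_eq_mul, coef, Pauli.op_zero]
    · simp only [WExpr.cost, NExpr.cost, pow_zero, mul_one]
      nlinarith
  · set p : Prog := .seqs [.setWord 6 (.lit 1), .setWord 7 (.reg 0)] with hp
    have hpf : p.LoopFree := by simp [hp, Prog.seqs, Prog.LoopFree]
    have h0 : PowersState n I.circuit.length l n
        (p.run I (startStore n I.circuit.length l)) := by
      refine ⟨by simp [hp, Prog.seqs, Prog.run, startStore], by simp [hp, Prog.seqs, Prog.run, startStore],
        by simp [hp, Prog.seqs, Prog.run, startStore], by simp [hp, Prog.seqs, Prog.run, startStore],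
        by simp [hp, Prog.seqs, Prog.run, startStore], by simp [hp, Prog.seqs, Prog.run, WExpr.eval],
        by simp [hp, Prog.seqs, Prog.run, WExpr.eval, startStore], fun j hj => by omega, rfl, rfl⟩
    obtain ⟨s₁, r₁, h₁⟩ := h0.runs I le_rfl
    obtain ⟨s₂, r₂, h₂⟩ := LayersState.of_powers I h₁
    obtain ⟨s₃, r₃, h₃⟩ := h₂.loop I.circuit.length (Nat.zero_add _)
    obtain ⟨s₄, r₄, h₄⟩ := h₃.output
    obtain ⟨t, ht, e⟩ := (hpf.runs I (startStore n I.circuit.length l)).seq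
      (r₁.seq (r₂.seq (r₃.seq r₄)))
    refine ⟨s₄, _, Exec.iteTrue (show l ≠ 0 by omega) e, h₄, ?_⟩
    have hpb : p.bound = 5 := by decide
    have hc : (WExpr.reg 2).cost = 1 := rfl
    rw [hpb] at ht
    rw [hc]
    have hN : 1 ≤ n ^ l := Nat.one_le_pow _ _ hn
    -- For l ≥ 1 this pays for the table of powers.
    have hnN : n ≤ n ^ l := Nat.le_self_pow (by omega) n
    have h1 := hK₁ n l hn
    have h2 := hK₂ n l hn
    have h3 := hK₃ n l hn
    generalize searchSteps (.add (.reg 5) (.reg 11)) (.obsCoeff 0) (treeBound branching n l) = S₁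
      at ht h1
    generalize searchSteps (.add (.reg 5) (.reg 11)) (.get 0 (.add (.reg 4) (.reg 10)))
      (treeBound branching n l) = S₂ at ht h2
    generalize searchSteps (.reg 5) (.mul (.get 0 (.add (.reg 4) (.reg 10))) (.stateCoeff 0))
      (treeBound branching n l) = S₃ at ht h3
    generalize n ^ l = N at *
    have hNX : N ≤ D * N := Nat.le_mul_of_pos_left _ hD1
    have h1' := h1.trans (Nat.mul_le_mul_left K₁ hNX)
    have h3' := h3.trans (Nat.mul_le_mul_left K₃ hNX)
    have h2' : I.circuit.length * (17 + S₂) ≤ D * (17 * N + K₂ * N) :=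
      Nat.mul_le_mul hd (by omega)
    have h2'' : D * (17 * N + K₂ * N) = 17 * (D * N) + K₂ * (D * N) := by ring
    have hfin : (K₁ + K₂ + K₃ + 100) * D * N =
      K₁ * (D * N) + K₂ * (D * N) + K₃ * (D * N) + 100 * (D * N) := by ring
    rw [hfin]
    omega

end GateNoise

theorem theorem2 :
    ∃ (A : Prog) (K : ℕ), ∀ (n : ℕ), 1 ≤ n → ∀ (γ : ℝ), 0 < γ →
      ∀ (C : Circuit n) (O : Op n), O.IsHermitian →
        -- the program evaluates the weight-truncated evolution, in the stated time
        (∀ (l : ℕ) (ρ : Op n), IsState ρ →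
          A.Outputs ⟨γ, C, O, ρ⟩ l (ρ * C.truncated γ l O).trace
            (K * max C.length 1 * n ^ l)) ∧
        -- truncation error
        (∀ l : ℕ, frobNorm (C.heisenberg γ O - C.truncated γ l O) ≤
          Real.sqrt (C.length + 1) * Real.exp (-γ * (l + 1)) * frobNorm O) ∧
        -- root-mean-square error and running time for a prescribed accuracy
        (frobNorm O = 1 → ∀ (ε : ℝ), 0 < ε →
          ∀ (m : ℕ), 1 ≤ m → ∀ (ρ : Fin m → Op n), (∀ i, IsState (ρ i)) →
          ∀ (c : ℝ), IsLowAverage ρ c →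
            ∃ v : Fin m → ℂ,
              (∀ i, A.Outputs ⟨γ, C, O, ρ i⟩ (threshold γ ε C.length) (v i)
                (K * max C.length 1 * n ^ threshold γ ε C.length)) ∧
              Real.sqrt ((∑ i, ‖(C.channel γ (ρ i) * O).trace - v i‖ ^ 2) / m) ≤
                Real.sqrt c * ε) := by
  obtain ⟨K, hK⟩ := Prog.exists_outputs_evaluate
  refine ⟨Prog.evaluate, K, fun n hn γ hγ C O _ => ⟨fun l ρ hρ => hK n hn ⟨γ, C, O, ρ⟩ hρ.2 l,
    fun l => frobNorm_heisenberg_sub_truncated_le hγ l C O, fun hO ε hε m _ ρ hρ c hc => ?_⟩⟩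
  exact ⟨fun i => (ρ i * C.truncated γ (threshold γ ε C.length) O).trace,
    fun i => hK n hn ⟨γ, C, O, ρ i⟩ (hρ i).2 _, rms_error_le hγ C hO hε hρ hc⟩
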